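/- **Setting.** Let $d\ge 2$ and let $\Omega\subset\mathbb R^d$ be a bounded Lipschitz domain such that $\Omega\cap\{x_d=t\}$ is connected for every $t\in\mathbb R$ for which it is nonempty. Let $\kappa>0$, $A=\mathrm{Id}$, $B=\mathrm{diag}(1,\dots,1,1+\kappa)$, and let $W:\mathbb R^{d\times d}\to[0,\infty)$ be continuous with $W(QF)=W(F)$ for $Q\in SO(d)$, $W(A)=W(B)=0$, and $W(F)\ge c_1\,\mathrm{dist}^2(F,SO(d)\{A,B\})$ for some $c_1>0$ (Frobenius norm). For $y\in H^2(\Omega;\mathbb R^d)$ and $\varepsilon>0$ put $$\mathcal E_\varepsilon(y)=\frac1{\varepsilon^2}\int_\Omega W(\nabla y)\,dx+\varepsilon^2\int_\Omega|\nabla^2y|^2\,dx+\varepsilon^{-2+1/d}\int_\Omega\big(|\nabla^2y|^2-|\partial^2_{dd}y|^2\big)\,dx\in[0,\infty].$$ Fix $p\in(1,2)$ and a sequence $\varepsilon\to0$ of positive numbers. **Partitions, limit classes.** A set $P$ has essential boundary $\partial^*P$, the set of points of $\mathbb R^d$ at which $P$ has neither density $0$ nor density $1$. A Caccioppoli partition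 of $\Omega$ is a countable family of measurable sets $P_j\subset\Omega$, pairwise disjoint and covering $\Omega$ up to null sets, ordered by $\mathcal L^d(P_i)\ge\mathcal L^d(P_j)$ for $i\le j$, with $\sum_j\mathcal H^{d-1}(\partial^*P_j)<\infty$. Let $\mathscr P(\Omega)$ be the set of those with $\bigcup_j\partial P_j\cap\Omega$ (topological boundaries) contained in countably many hyperplanes orthogonal to $e_d$. Let $\mathscr U(\Omega)$ be the set of $u\in SBV^2_{\rm loc}(\Omega;\mathbb R^d)$ whose approximate jump set $J_u$ is contained in countably many such hyperplanes. For $R\in SO(d)$ let $\mathcal Y_R(\Omega)$ be the set of $y\in H^1(\Omega;\mathbb R^d)$ with zero mean, $\nabla y\in BV(\Omega;\mathbb R^{d\times d})$ and $\nabla y\in\{RA,RB\}$ a.e., and $\mathscr Y(\Omega)=\bigcup_R\mathcal Y_R(\Omega)$. **Admissible triples.** A triple $(y,u,\mathcal P)\in\mathscr Y(\Omega)\times\mathscr U(\Omega)\times\mathscr P(\Omega)$, $\mathcal P=\{P_j\}_j$, is admissible for a sequence $\{y^\varepsilon\}_\varepsilon\subset H^2(\Omega;\mathbb R^d)$ if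 there are $R^\varepsilon\in SO(d)$, Caccioppoli partitions $\{P^\varepsilon_j\}_j$ of $\Omega$, $M^\varepsilon_j\in\{A,B\}$ and $t^\varepsilon_j\in\mathbb R^d$ such that: 1. $\sup_\varepsilon\mathcal H^{d-1}(\bigcup_j\partial^*P^\varepsilon_j)<\infty$; and for every open $\Omega'\subset\subset\Omega$ there is $C_{\Omega'}$ with, for all $\varepsilon$, $\sum_j\min\{\mathcal L^d(\Omega'\cap P_j^\varepsilon),\mathcal L^d(L_{\Omega'}(P_j^\varepsilon)\setminus P_j^\varepsilon)\}\le C_{\Omega'}\varepsilon^p$ and $\|\nabla y^\varepsilon-\sum_jR^\varepsilon M_j^\varepsilon\chi_{P_j^\varepsilon}\|_{L^2(\Omega')}\le C_{\Omega'}\varepsilon$, where $L_{\Omega'}(S)$ is the set of points of $\Omega'$ having the same last coordinate as some point of $S$; 2. $R^\varepsilon\to R$ with $y\in\mathcal Y_R(\Omega)$; $\mathcal L^d(P^\varepsilon_j\triangle P_j)\to0$ for all $j$; $y^\varepsilon-\frac{1}{\mathcal L^d(\Omega)}\int_\Omega y^\varepsilon\,dx\to y$ in $H^1(\Omega;\mathbb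 R^d)$; and $\sum_jR^\varepsilon M_j^\varepsilon\chi_{P_j^\varepsilon}\rightharpoonup^*\nabla y$ weakly* in $BV(\Omega;\mathbb R^{d\times d})$; 3. $|t^\varepsilon_i-t^\varepsilon_j|/\varepsilon\to\infty$ whenever $i\ne j$, $\mathcal L^d(P_i),\mathcal L^d(P_j)>0$ and $\lim M_i^\varepsilon=\lim M_j^\varepsilon$; 4. $u^\varepsilon:=\varepsilon^{-1}\big(y^\varepsilon-\sum_j(R^\varepsilon M^\varepsilon_jx+t^\varepsilon_j)\chi_{P^\varepsilon_j}\big)\to u$ in measure in $\Omega$ and $\nabla u^\varepsilon\rightharpoonup\nabla u$ weakly in $L^2_{\rm loc}(\Omega;\mathbb R^{d\times d})$, where $\nabla$ denotes the approximate gradient. **Proposition.** Let $\{y^\varepsilon\}_\varepsilon\subset H^2(\Omega;\mathbb R^d)$ satisfy $\sup_\varepsilon\mathcal E_\varepsilon(y^\varepsilon)<\infty$. Then for every triple $(y,u,\mathcal P)$ admissible for $\{y^\varepsilon\}_\varepsilon$, the approximate jump set of $\nabla y$ satisfies $$J_{\nabla y}\subset\bigcup\nolimits_j\partial P_j\cap\Omega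 .$$ Moreover, there are a sequence $\{y^\varepsilon\}_\varepsilon\subset H^2(\Omega;\mathbb R^d)$ with $\sup_\varepsilon\mathcal E_\varepsilon(y^\varepsilon)<\infty$ and an admissible triple $(y,u,\mathcal P)$ for it such that the inclusion is strict, and in fact $$\mathcal H^{d-1}\Big(\big(\bigcup\nolimits_j\partial^*P_j\cap\Omega\big)\setminus J_{\nabla y}\Big)>0 .$$ -/

import Mathlib

open MeasureTheory Filter Topology Set
open scoped ENNReal NNReal ContDiff Matrix

noncomputable section

/-! The space dimension is `d = m + 1`; the distinguished direction `e_d` is the coordinate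
`Fin.last m`. -/

/-- The Euclidean space `ℝ^d`. -/
abbrev Euc (d : ℕ) : Type := EuclideanSpace ℝ (Fin d)

/-- Real `d × d` matrices. -/
abbrev Mat (d : ℕ) : Type := Matrix (Fin d) (Fin d) ℝ

/-- The matrix `F` as an element of the Euclidean space of its entries, whose norm and inner product
are the Frobenius norm `|F|` and the Frobenius scalar product. -/
def frob {d : ℕ} (F : Mat d) : EuclideanSpace ℝ (Fin d × Fin d) :=
  WithLp.toLp 2 fun ij => F ij.1 ij.2

/-! ### Domains -/

/-- The first `m` coordinates `x'` of `x = (x', x_d)`. -/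
def headCoords {m : ℕ} (x : Euc (m + 1)) : Euc m :=
  WithLp.toLp 2 fun i : Fin m => x i.castSucc

/-- Bounded Lipschitz domain: a nonempty bounded connected open set which near each of its boundary
points is, in suitable Cartesian coordinates, the region above the graph of a Lipschitz function. -/
structure IsBoundedLipschitzDomain {m : ℕ} (Ω : Set (Euc (m + 1))) : Prop where
  isOpen : IsOpen Ω
  isConnected : IsConnected Ω
  isBounded : Bornology.IsBounded Ω
  lipschitz_boundary : ∀ x ∈ frontier Ω,
    ∃ (U : Set (Euc (m + 1))) (Φ : Euc (m + 1) ≃ᵃⁱ[ℝ] Euc (m + 1)) (γ : Euc m → ℝ) (K : ℝ≥0),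
      IsOpen U ∧ x ∈ U ∧ LipschitzWith K γ ∧
        Ω ∩ U = {z | γ (headCoords (Φ z)) < Φ z (Fin.last m)} ∩ U

/-- All slices of `Ω` orthogonal to `e_d` are connected (or empty). -/
def SlicesConnected {m : ℕ} (Ω : Set (Euc (m + 1))) : Prop :=
  ∀ t : ℝ, IsPreconnected (Ω ∩ {x | x (Fin.last m) = t})

/-- `Ω' ⊂⊂ Ω`. -/
def CompactlyInside {d : ℕ} (Ω' Ω : Set (Euc d)) : Prop :=
  IsOpen Ω' ∧ IsCompact (closure Ω') ∧ closure Ω' ⊆ Ω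

/-- `S` is contained in countably many hyperplanes orthogonal to `e_d`. -/
def InCountableHyperplanes {m : ℕ} (S : Set (Euc (m + 1))) : Prop :=
  ∃ s : ℕ → ℝ, S ⊆ ⋃ i, {x | x (Fin.last m) = s i}

/-! ### Test functions, weak derivatives, Sobolev functions -/

/-- `φ` is a smooth function with compact support in `Ω`. -/
structure IsTestFunction {d : ℕ} (Ω : Set (Euc d)) (φ : Euc d → ℝ) : Prop where
  smooth : ContDiff ℝ ∞ φ
  compact : HasCompactSupport φ
  support : tsupport φ ⊆ Ω

/-- The classical partial derivative `∂_k φ`. -/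
def partialDeriv {d : ℕ} (k : Fin d) (φ : Euc d → ℝ) (x : Euc d) : ℝ :=
  fderiv ℝ φ x (EuclideanSpace.single k 1)

/-- `g` is the weak `k`-th partial derivative of `f` in the open set `Ω`. -/
def HasWeakPartial {d : ℕ} (Ω : Set (Euc d)) (k : Fin d) (f g : Euc d → ℝ) : Prop :=
  LocallyIntegrableOn f Ω ∧ LocallyIntegrableOn g Ω ∧
    ∀ φ, IsTestFunction Ω φ →
      ∫ x in Ω, f x * partialDeriv k φ x = -∫ x in Ω, g x * φ x

open Classical in
/-- A representative of the weak `k`-th partial derivative (unique up to null subsets of `Ω`);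
`0` if there is none. -/
def weakPartial {d : ℕ} (Ω : Set (Euc d)) (k : Fin d) (f : Euc d → ℝ) : Euc d → ℝ :=
  if h : ∃ g, HasWeakPartial Ω k f g then h.choose else 0

/-- The weak gradient `∇y`, with entries `(∇y)_{ik} = ∂_k y_i`. -/
def weakGrad {d : ℕ} (Ω : Set (Euc d)) (y : Euc d → Euc d) (x : Euc d) : Mat d :=
  Matrix.of fun i k => weakPartial Ω k (fun z => y z i) x

/-- The entries `∂_k ∂_j y_i` of the weak second gradient `∇²y`. -/
def weakHess {d : ℕ} (Ω : Set (Euc d)) (y : Euc d → Euc d) (i j k : Fin d) : Euc d → ℝ :=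
  weakPartial Ω k (weakPartial Ω j fun z => y z i)

/-- `y ∈ H¹(Ω; ℝ^d)`. -/
def MemH1 {d : ℕ} (Ω : Set (Euc d)) (y : Euc d → Euc d) : Prop :=
  MemLp y 2 (volume.restrict Ω) ∧
    ∀ i k, ∃ g, HasWeakPartial Ω k (fun z => y z i) g ∧ MemLp g 2 (volume.restrict Ω)

/-- `y ∈ H²(Ω; ℝ^d)`. -/
def MemH2 {d : ℕ} (Ω : Set (Euc d)) (y : Euc d → Euc d) : Prop :=
  MemH1 Ω y ∧
    ∀ i j k, ∃ g, HasWeakPartial Ω k (weakPartial Ω j fun z => y z i) g ∧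
      MemLp g 2 (volume.restrict Ω)

/-! ### The two-well energy -/

/-- The well `B = diag(1, …, 1, 1 + κ)`; the other well is `A = 1`. -/
def wellB (m : ℕ) (κ : ℝ) : Mat (m + 1) :=
  Matrix.diagonal fun i => if i = Fin.last m then 1 + κ else 1

/-- `SO(d){A, B}`. -/
def wells (m : ℕ) (κ : ℝ) : Set (Mat (m + 1)) :=
  {F | ∃ Q ∈ Matrix.specialOrthogonalGroup (Fin (m + 1)) ℝ, F = Q ∨ F = Q * wellB m κ}

/-- Stored-energy densities with the two wells `A`, `B`: nonnegative, continuous, frame indifferent,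
vanishing at `A` and `B`, and coercive. -/
structure IsTwoWellDensity {m : ℕ} (κ : ℝ) (W : Mat (m + 1) → ℝ) : Prop where
  nonneg : ∀ F, 0 ≤ W F
  continuous : Continuous W
  frame_indifferent :
    ∀ Q ∈ Matrix.specialOrthogonalGroup (Fin (m + 1)) ℝ, ∀ F, W (Q * F) = W F
  well_A : W 1 = 0
  well_B : W (wellB m κ) = 0
  coercive : ∃ c : ℝ, 0 < c ∧ ∀ F, c * Metric.infDist (frob F) (frob '' wells m κ) ^ 2 ≤ W F

/-- `|∇²y|²`. -/
def hessSq {m : ℕ} (Ω : Set (Euc (m + 1))) (y : Euc (m + 1) → Euc (m + 1)) (x : Euc (m + 1)) : ℝ :=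
  ∑ i, ∑ j, ∑ k, weakHess Ω y i j k x ^ 2

/-- `|∂²_{dd} y|²`. -/
def hessLastSq {m : ℕ} (Ω : Set (Euc (m + 1))) (y : Euc (m + 1) → Euc (m + 1))
    (x : Euc (m + 1)) : ℝ :=
  ∑ i, weakHess Ω y i (Fin.last m) (Fin.last m) x ^ 2

/-- The penalization parameter `ε ^ (-1 + 1/(2d))`, `d = m + 1`. -/
def etaBar (m : ℕ) (ε : ℝ) : ℝ := ε ^ (-1 + 1 / (2 * ((m : ℝ) + 1)))

/-- The energy `𝓔_ε(y)`, with values in `[0, ∞]`. -/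
def energy {m : ℕ} (Ω : Set (Euc (m + 1))) (W : Mat (m + 1) → ℝ) (ε : ℝ)
    (y : Euc (m + 1) → Euc (m + 1)) : ℝ≥0∞ :=
  ENNReal.ofReal (1 / ε ^ 2) * (∫⁻ x in Ω, ENNReal.ofReal (W (weakGrad Ω y x)))
  + ENNReal.ofReal (ε ^ 2) * (∫⁻ x in Ω, ENNReal.ofReal (hessSq Ω y x))
  + ENNReal.ofReal (etaBar m ε ^ 2) *
      ∫⁻ x in Ω, ENNReal.ofReal (hessSq Ω y x - hessLastSq Ω y x)

/-- A sequence in `H²(Ω; ℝ^d)` with equibounded energies `𝓔_{ε_n}(y_n)`. -/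
def EquiboundedEnergy {m : ℕ} (Ω : Set (Euc (m + 1))) (W : Mat (m + 1) → ℝ) (ε : ℕ → ℝ)
    (y : ℕ → Euc (m + 1) → Euc (m + 1)) : Prop :=
  (∀ n, MemH2 Ω (y n)) ∧ ∃ C₀ : ℝ≥0, ∀ n, energy Ω W (ε n) (y n) ≤ C₀

/-! ### Approximate limits, jump sets, approximate gradients -/

/-- The mean of `|u - a|` over `B_ρ(x) ∩ H` tends to `0` as `ρ ↓ 0`. -/
def MeanTendsto {d : ℕ} {F : Type*} [NormedAddCommGroup F] (u : Euc d → F) (x : Euc d)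
    (H : Set (Euc d)) (a : F) : Prop :=
  Tendsto (fun ρ : ℝ => (∫⁻ z in Metric.ball x ρ ∩ H, ‖u z - a‖ₑ) / volume (Metric.ball x ρ ∩ H))
    (𝓝[>] 0) (𝓝 0)

/-- The approximate discontinuity set `S_u` of `u` in `Ω`. -/
def approxDiscontSet {d : ℕ} {F : Type*} [NormedAddCommGroup F] (Ω : Set (Euc d))
    (u : Euc d → F) : Set (Euc d) :=
  {x | x ∈ Ω ∧ ¬ ∃ a, MeanTendsto u x univ a}

/-- The approximate jump set `J_u` of `u` in `Ω`. -/
def jumpSet {d : ℕ} {F : Type*} [NormedAddCommGroup F] (Ω : Set (Euc d))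
    (u : Euc d → F) : Set (Euc d) :=
  {x | x ∈ Ω ∧ ∃ (a b : F) (ν : Euc d), a ≠ b ∧ ‖ν‖ = 1 ∧
    MeanTendsto u x {z | 0 < inner ℝ (z - x) ν} a ∧
    MeanTendsto u x {z | inner ℝ (z - x) ν < 0} b}

/-- The jump set `J_{∇y}` of the weak gradient of `y` in `Ω`. -/
def gradJumpSet {d : ℕ} (Ω : Set (Euc d)) (y : Euc d → Euc d) : Set (Euc d) :=
  jumpSet Ω fun x => frob (weakGrad Ω y x)

/-- The matrix `L` acting on the vector `x`. -/
def matAct {d : ℕ} (L : Mat d) (x : Euc d) : Euc d := WithLp.toLp 2 (L *ᵥ WithLp.ofLp x)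

/-- `u` is approximately differentiable at `x` with approximate limit `a` and differential `L`:
for every `δ > 0`, the set where `|u(z) - a - L (z - x)| > δ |z - x|` has density `0` at `x`. -/
def HasApproxGrad {d : ℕ} (u : Euc d → Euc d) (x : Euc d) (a : Euc d) (L : Mat d) : Prop :=
  ∀ δ : ℝ, 0 < δ → Tendsto (fun ρ : ℝ =>
    volume (Metric.ball x ρ ∩ {z | δ * ‖z - x‖ < ‖u z - a - matAct L (z - x)‖})
      / volume (Metric.ball x ρ)) (𝓝[>] 0) (𝓝 0)

open Classical in
/-- The approximate gradient of `u` (unique where it exists, `0` elsewhere). -/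
def approxGrad {d : ℕ} (u : Euc d → Euc d) (x : Euc d) : Mat d :=
  if h : ∃ L, ∃ a, HasApproxGrad u x a L then h.choose else 0

/-! ### Functions of bounded variation -/

/-- The finite signed measures `μ k`, concentrated on `Ω`, are the distributional partial
derivatives of `f` in `Ω`. -/
def IsBVDeriv {d : ℕ} (Ω : Set (Euc d)) (f : Euc d → ℝ) (μ : Fin d → SignedMeasure (Euc d)) :
    Prop :=
  ∀ k, (μ k).totalVariation Ωᶜ = 0 ∧
    ∀ φ, IsTestFunction Ω φ →
      ∫ x in Ω, f x * partialDeriv k φ x = -∫ᵛ x, φ x ∂<•(μ k)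

/-- `G ∈ BV(Ω; 𝕄^{d×d})`, with derivative `D G = μ`: `μ i j k` is the `k`-th distributional
derivative of the entry `G_{ij}`. -/
def HasMatBVDeriv {d : ℕ} (Ω : Set (Euc d)) (G : Euc d → Mat d)
    (μ : Fin d → Fin d → Fin d → SignedMeasure (Euc d)) : Prop :=
  ∀ i j, IntegrableOn (fun x => G x i j) Ω ∧ IsBVDeriv Ω (fun x => G x i j) (μ i j)

/-- Weak* convergence `G_n ⇀* G` in `BV(Ω; 𝕄^{d×d})`, for bounded `Ω`: convergence in `L¹`
together with weak* convergence of the derivatives against `C_0(Ω)`, the continuous functions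
that vanish outside `Ω`. -/
def TendstoWeakStarBV {d : ℕ} (Ω : Set (Euc d)) (Gn : ℕ → Euc d → Mat d) (G : Euc d → Mat d) :
    Prop :=
  Tendsto (fun n => eLpNorm (fun x => frob (Gn n x - G x)) 1 (volume.restrict Ω)) atTop (𝓝 0) ∧
  ∃ (μn : ℕ → Fin d → Fin d → Fin d → SignedMeasure (Euc d))
    (μ : Fin d → Fin d → Fin d → SignedMeasure (Euc d)),
    (∀ n, HasMatBVDeriv Ω (Gn n) (μn n)) ∧ HasMatBVDeriv Ω G μ ∧
    ∀ i j k, ∀ φ : Euc d → ℝ, Continuous φ → (∀ x ∉ Ω, φ x = 0) →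
      Tendsto (fun n => ∫ᵛ x, φ x ∂<•(μn n i j k)) atTop (𝓝 (∫ᵛ x, φ x ∂<•(μ i j k)))

/-- `u ∈ SBV(O; ℝ^d)`: `u ∈ BV(O; ℝ^d)` and the Cantor part of `D u`, that is, the restriction to
`O \ S_u` of the part of `D u` which is singular to Lebesgue measure, vanishes. -/
def MemSBV {d : ℕ} (O : Set (Euc d)) (u : Euc d → Euc d) : Prop :=
  IntegrableOn u O ∧
    ∀ i, ∃ μ : Fin d → SignedMeasure (Euc d), IsBVDeriv O (fun x => u x i) μ ∧
      ∀ k, ((μ k).singularPart volume).totalVariation (O \ approxDiscontSet O u) = 0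

/-- `u ∈ SBV²(O; ℝ^d)`, `d = m + 1`. (The normalization of the Hausdorff measure is irrelevant for
the finiteness required here.) -/
def MemSBV2 {m : ℕ} (O : Set (Euc (m + 1))) (u : Euc (m + 1) → Euc (m + 1)) : Prop :=
  MemSBV O u ∧ MemLp (fun x => frob (approxGrad u x)) 2 (volume.restrict O) ∧
    Measure.hausdorffMeasure (m : ℝ) (jumpSet O u) < ⊤

/-! ### Sets of finite perimeter and Caccioppoli partitions -/

/-- `P` has density `t` at `x`. -/
def HasDensity {d : ℕ} (P : Set (Euc d)) (x : Euc d) (t : ℝ≥0∞) : Prop :=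
  Tendsto (fun ρ : ℝ => volume (P ∩ Metric.ball x ρ) / volume (Metric.ball x ρ)) (𝓝[>] 0) (𝓝 t)

/-- The essential boundary `∂*P`: the points of `ℝ^d` where `P` has neither density `0` nor
density `1`. -/
def essBoundary {d : ℕ} (P : Set (Euc d)) : Set (Euc d) :=
  {x | ¬ HasDensity P x 0 ∧ ¬ HasDensity P x 1}

/-- Ordered Caccioppoli partitions `{P_j}_j` of `Ω` (up to null sets). Finite partitions are
included, completed by empty sets. -/
structure IsCaccioppoliPartition {m : ℕ} (Ω : Set (Euc (m + 1))) (P : ℕ → Set (Euc (m + 1))) :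
    Prop where
  measurable : ∀ j, NullMeasurableSet (P j)
  subset : ∀ j, P j ⊆ Ω
  disjoint : ∀ i j, i ≠ j → volume (P i ∩ P j) = 0
  cover : volume (Ω \ ⋃ j, P j) = 0
  ordered : ∀ i j, i ≤ j → volume (P j) ≤ volume (P i)
  perimeter : ∑' j, Measure.hausdorffMeasure (m : ℝ) (essBoundary (P j)) < ⊤

/-- `L_{Ω'}(S) = Ω' ∩ (ℝ^{d-1} × π_d(S))`. -/
def layerSet {m : ℕ} (Ω' S : Set (Euc (m + 1))) : Set (Euc (m + 1)) :=
  Ω' ∩ {x | ∃ z ∈ S, z (Fin.last m) = x (Fin.last m)}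

/-! ### Limiting deformations, displacements and partitions -/

/-- The class `𝓨_R(Ω)`: `y ∈ H¹(Ω; ℝ^d)` with zero mean, `∇y ∈ BV(Ω; R{A, B})`. -/
structure MemLimitDeformation {m : ℕ} (Ω : Set (Euc (m + 1))) (κ : ℝ) (R : Mat (m + 1))
    (y : Euc (m + 1) → Euc (m + 1)) : Prop where
  memH1 : MemH1 Ω y
  mean_zero : ⨍ x in Ω, y x = 0
  grad_bv : ∃ μ, HasMatBVDeriv Ω (weakGrad Ω y) μ
  grad_wells : ∀ᵐ x ∂(volume.restrict Ω), weakGrad Ω y x = R ∨ weakGrad Ω y x = R * wellB m κ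

/-- The class `𝓤(Ω)`: `u ∈ SBV²_loc(Ω; ℝ^d)` whose jump set lies in countably many hyperplanes
orthogonal to `e_d`. -/
def MemLimitDisplacement {m : ℕ} (Ω : Set (Euc (m + 1))) (u : Euc (m + 1) → Euc (m + 1)) : Prop :=
  (∀ O, CompactlyInside O Ω → MemSBV2 O u) ∧ InCountableHyperplanes (jumpSet Ω u)

/-- The class `𝓟(Ω)`: Caccioppoli partitions whose boundaries inside `Ω` lie in countably many
hyperplanes orthogonal to `e_d`. -/
def MemLimitPartition {m : ℕ} (Ω : Set (Euc (m + 1))) (P : ℕ → Set (Euc (m + 1))) : Prop :=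
  IsCaccioppoliPartition Ω P ∧ InCountableHyperplanes ((⋃ j, frontier (P j)) ∩ Ω)

/-! ### Admissible triples -/

/-- The piecewise constant map `∑_j R M_j χ_{P_j}`. -/
def phaseMap {d : ℕ} (R : Mat d) (P : ℕ → Set (Euc d)) (M : ℕ → Mat d) (x : Euc d) : Mat d :=
  ∑' j, (P j).indicator (fun _ => R * M j) x

/-- The rescaled displacement `ε⁻¹ (y - ∑_j (R M_j x + t_j) χ_{P_j})`. -/
def rescaledDisp {d : ℕ} (ε : ℝ) (y : Euc d → Euc d) (R : Mat d) (P : ℕ → Set (Euc d))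
    (M : ℕ → Mat d) (t : ℕ → Euc d) (x : Euc d) : Euc d :=
  ε⁻¹ • (y x - ∑' j, (P j).indicator (fun z => matAct (R * M j) z + t j) x)

/-- The quadruples `(R_n, 𝓟_n, 𝓜_n, 𝓣_n)`, with `𝓟_n = {P_{n,j}}_j`, `𝓜_n = {M_{n,j}}_j`,
`𝓣_n = {t_{n,j}}_j`, are admissible for the sequence `y_n` (with parameters `ε_n`), and their limit
is `(y, u, 𝓟)`. The number `p` is the exponent in the volume estimate `layers`. -/
structure IsAdmissibleQuadruple {m : ℕ} (Ω : Set (Euc (m + 1))) (κ p : ℝ) (ε : ℕ → ℝ)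
    (yn : ℕ → Euc (m + 1) → Euc (m + 1))
    (Rn : ℕ → Mat (m + 1)) (Pn : ℕ → ℕ → Set (Euc (m + 1))) (Mn : ℕ → ℕ → Mat (m + 1))
    (tn : ℕ → ℕ → Euc (m + 1))
    (y u : Euc (m + 1) → Euc (m + 1)) (P : ℕ → Set (Euc (m + 1))) : Prop where
  rotations : ∀ n, Rn n ∈ Matrix.specialOrthogonalGroup (Fin (m + 1)) ℝ
  partitions : ∀ n, IsCaccioppoliPartition Ω (Pn n)
  phases : ∀ n j, Mn n j = 1 ∨ Mn n j = wellB m κ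
  perimeter_bound : ∃ C : ℝ≥0, ∀ n,
    Measure.hausdorffMeasure (m : ℝ) (⋃ j, essBoundary (Pn n j)) ≤ C
  layers : ∀ Ω', CompactlyInside Ω' Ω → ∃ C : ℝ≥0, ∀ n,
    ∑' j, min (volume (Ω' ∩ Pn n j)) (volume (layerSet Ω' (Pn n j) \ Pn n j))
      ≤ C * ENNReal.ofReal (ε n ^ p)
  rigidity : ∀ Ω', CompactlyInside Ω' Ω → ∃ C : ℝ≥0, ∀ n,
    eLpNorm (fun x => frob (weakGrad Ω (yn n) x - phaseMap (Rn n) (Pn n) (Mn n) x)) 2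
      (volume.restrict Ω') ≤ C * ENNReal.ofReal (ε n)
  limit_deformation : ∃ R ∈ Matrix.specialOrthogonalGroup (Fin (m + 1)) ℝ,
    MemLimitDeformation Ω κ R y ∧ Tendsto Rn atTop (𝓝 R)
  limit_displacement : MemLimitDisplacement Ω u
  limit_partition : MemLimitPartition Ω P
  tendsto_sets : ∀ j, Tendsto (fun n => volume (symmDiff (Pn n j) (P j))) atTop (𝓝 0)
  tendsto_deformation : Tendsto (fun n =>
    eLpNorm (fun x => yn n x - (⨍ z in Ω, yn n z) - y x) 2 (volume.restrict Ω)) atTop (𝓝 0)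
  tendsto_gradient : Tendsto (fun n =>
    eLpNorm (fun x => frob (weakGrad Ω (yn n) x - weakGrad Ω y x)) 2 (volume.restrict Ω)) atTop (𝓝 0)
  tendsto_phases :
    TendstoWeakStarBV Ω (fun n => phaseMap (Rn n) (Pn n) (Mn n)) (weakGrad Ω y)
  selection : ∀ i j, i ≠ j → 0 < volume (P i) → 0 < volume (P j) →
    (∃ L, Tendsto (fun n => Mn n i) atTop (𝓝 L) ∧ Tendsto (fun n => Mn n j) atTop (𝓝 L)) →
    Tendsto (fun n => ‖tn n i - tn n j‖ / ε n) atTop atTop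
  tendsto_disp : TendstoInMeasure (volume.restrict Ω)
    (fun n => rescaledDisp (ε n) (yn n) (Rn n) (Pn n) (Mn n) (tn n)) atTop u
  tendsto_disp_grad : ∀ Ω', CompactlyInside Ω' Ω →
    (∀ n, MemLp (fun x =>
      frob (approxGrad (rescaledDisp (ε n) (yn n) (Rn n) (Pn n) (Mn n) (tn n)) x)) 2
      (volume.restrict Ω')) ∧
    ∀ ψ : Euc (m + 1) → EuclideanSpace ℝ (Fin (m + 1) × Fin (m + 1)),
      MemLp ψ 2 (volume.restrict Ω') →
      Tendsto (fun n => ∫ x in Ω', inner ℝ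
          (frob (approxGrad (rescaledDisp (ε n) (yn n) (Rn n) (Pn n) (Mn n) (tn n)) x)) (ψ x))
        atTop (𝓝 (∫ x in Ω', inner ℝ (frob (approxGrad u x)) (ψ x)))

/-- The triple `(y, u, 𝓟)` is admissible for the sequence `y_n`, i.e. `y_n` is asymptotically
represented by `(y, u, 𝓟)`. -/
def IsAdmissibleTriple {m : ℕ} (Ω : Set (Euc (m + 1))) (κ p : ℝ) (ε : ℕ → ℝ)
    (yn : ℕ → Euc (m + 1) → Euc (m + 1))
    (y u : Euc (m + 1) → Euc (m + 1)) (P : ℕ → Set (Euc (m + 1))) : Prop :=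
  ∃ Rn Pn Mn tn, IsAdmissibleQuadruple Ω κ p ε yn Rn Pn Mn tn y u P

end

/-!
The inclusion is a statement about interior points of the pieces. Along a subsequence the phase
`M_{n,j}` of a given piece is one fixed well, so the maps `∑_j R_n M_{n,j} χ_{P_{n,j}}` converge in
measure on `P_j` to a constant matrix; since they converge to `∇y` in `L¹`, the gradient `∇y` is
constant a.e. on `P_j` (`IsAdmissibleQuadruple.grad_ae_const`) and cannot jump in the interior of
`P_j`. It remains to see that a point `x ∈ Ω` on no boundary `∂P_j` is interior to some piece, which
is not clear for infinitely many pieces accumulating at `x`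
(`MemLimitPartition.exists_mem_interior`). The boundaries lie in countably many hyperplanes
orthogonal to `e_d`, so in a small cylinder around `x` a piece is, up to null sets, a union of
layers over an open set of heights. A piece which is neither null nor of full measure in the
cylinder has a height at which it changes from full to null measure: the heights with neither
property form a closed countable set, and Baire's theorem gives it an isolated point
(`exists_isolated_exceptional_point`). Hence its essential boundary contains a whole slice of the
cylinder (`exists_slice_subset_essBoundary`), whose area is fixed, and the finite perimeter of the
partition leaves only finitely many such pieces. These stay away from `x`, as `x` is in the closure
of none of them.

Strictness comes from a laminate with one layer `a ≤ x_d < a + δ_n` of the second phase whose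
thickness satisfies `δ_n → 0` and `δ_n / ε_n → ∞`, smoothed on two transition zones of width `ε_n²`.
Only `∂²_{dd} y` is nonzero, so the last term of the energy vanishes, and the two others are of
order one: the transition zones have volume of order `ε²`, the second gradient there is of order
`ε⁻²` (`exists_energy_layered_profile_le`). In the limit the layer disappears, so `y` is the
identity up to a constant and `J_{∇y}` is empty. But the layer shifts the upper part of `Ω` against
the lower part by `κ δ_n ≫ ε_n`, so the selection principle allows the two parts to remain separate
pieces of the limit partition, with the horizontal slice at height `a` as interface
(`isAdmissibleTriple_smoothLaminate`). The pieces have to be ordered by volume, with the lower part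
first and the layer last; the height `a` is therefore chosen near the top of `Ω`
(`exists_height`, `exists_thickness`).
-/

noncomputable section

/-! ### Splitting off the last coordinate -/

/-- The point `(v, t)` of `ℝ^{m+1}` with first coordinates `v ∈ ℝ^m` and last coordinate `t`. -/
def joinCoords {m : ℕ} (v : Euc m) (t : ℝ) : Euc (m + 1) :=
  WithLp.toLp 2 (Fin.snoc (α := fun _ => ℝ) (WithLp.ofLp v) t)

@[simp] lemma joinCoords_last {m : ℕ} (v : Euc m) (t : ℝ) : joinCoords v t (Fin.last m) = t := by
  simp [joinCoords]

@[simp] lemma joinCoords_castSucc {m : ℕ} (v : Euc m) (t : ℝ) (i : Fin m) :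
    joinCoords v t i.castSucc = v i := by
  simp [joinCoords]

@[simp] lemma headCoords_apply {m : ℕ} (z : Euc (m + 1)) (i : Fin m) :
    headCoords z i = z i.castSucc := rfl

@[simp] lemma headCoords_joinCoords {m : ℕ} (v : Euc m) (t : ℝ) :
    headCoords (joinCoords v t) = v := by
  ext i; simp

@[simp] lemma joinCoords_headCoords {m : ℕ} (z : Euc (m + 1)) :
    joinCoords (headCoords z) (z (Fin.last m)) = z := by
  ext i
  refine Fin.lastCases ?_ (fun j => ?_) i <;> simp

lemma norm_sq_eq_head_last {m : ℕ} (z : Euc (m + 1)) :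
    ‖z‖ ^ 2 = ‖headCoords z‖ ^ 2 + z (Fin.last m) ^ 2 := by
  simp [EuclideanSpace.norm_sq_eq, Fin.sum_univ_castSucc]

lemma headCoords_sub {m : ℕ} (z w : Euc (m + 1)) :
    headCoords (z - w) = headCoords z - headCoords w := by
  ext i; simp

lemma joinCoords_sub {m : ℕ} (v w : Euc m) (s t : ℝ) :
    joinCoords v s - joinCoords w t = joinCoords (v - w) (s - t) := by
  ext i
  refine Fin.lastCases ?_ (fun j => ?_) i <;> simp

lemma norm_headCoords_le {m : ℕ} (z : Euc (m + 1)) : ‖headCoords z‖ ≤ ‖z‖ := by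
  have := norm_sq_eq_head_last z
  exact le_of_sq_le_sq (by nlinarith [sq_nonneg (z (Fin.last m))]) (norm_nonneg _)

lemma abs_last_le_norm {m : ℕ} (z : Euc (m + 1)) : |z (Fin.last m)| ≤ ‖z‖ := by
  simpa using PiLp.norm_apply_le z (Fin.last m)

lemma norm_le_head_add_last {m : ℕ} (z : Euc (m + 1)) :
    ‖z‖ ≤ ‖headCoords z‖ + |z (Fin.last m)| := by
  have := norm_sq_eq_head_last z
  refine le_of_sq_le_sq ?_ (by positivity)
  nlinarith [sq_abs (z (Fin.last m)), mul_nonneg (norm_nonneg (headCoords z))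
    (abs_nonneg (z (Fin.last m)))]

lemma lipschitzWith_headCoords {m : ℕ} : LipschitzWith 1 (headCoords (m := m)) := by
  refine LipschitzWith.of_dist_le_mul fun z w => ?_
  rw [dist_eq_norm, dist_eq_norm, ← headCoords_sub]
  simpa using norm_headCoords_le (z - w)

lemma continuous_joinCoords {m : ℕ} :
    Continuous fun q : Euc m × ℝ => joinCoords q.1 q.2 := by
  refine (PiLp.continuous_toLp 2 _).comp (continuous_pi fun i => ?_)
  refine Fin.lastCases ?_ (fun j => ?_) i <;> simp <;> fun_prop

lemma continuous_last {m : ℕ} : Continuous fun z : Euc (m + 1) => z (Fin.last m) := by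
  fun_prop

lemma isometry_joinCoords {m : ℕ} (t : ℝ) : Isometry fun v : Euc m => joinCoords v t := by
  refine Isometry.of_dist_eq fun v w => ?_
  rw [dist_eq_norm, dist_eq_norm, joinCoords_sub, ← sq_eq_sq₀ (norm_nonneg _) (norm_nonneg _),
    norm_sq_eq_head_last]
  simp

/-- Fubini: Lebesgue measure on `ℝ^{m+1}` is the product of the Lebesgue measures on `ℝ^m` and
`ℝ`. -/
lemma measurePreserving_joinCoords {m : ℕ} :
    MeasurePreserving (fun q : Euc m × ℝ => joinCoords q.1 q.2)
      ((volume : Measure (Euc m)).prod (volume : Measure ℝ)) volume := by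
  have h1 := (volume_preserving_piFinSuccAbove (fun _ : Fin (m + 1) => ℝ) (Fin.last m)).symm
  have h2 := EuclideanSpace.volume_preserving_symm_measurableEquiv_toLp (Fin m)
  have h3 := (EuclideanSpace.volume_preserving_symm_measurableEquiv_toLp (Fin (m + 1))).symm
  have h4 := (MeasurePreserving.id (volume : Measure ℝ)).prod h2
  have h5 : MeasurePreserving (Prod.swap : Euc m × ℝ → ℝ × Euc m)
    ((volume : Measure (Euc m)).prod (volume : Measure ℝ))
    ((volume : Measure ℝ).prod (volume : Measure (Euc m))) := Measure.measurePreserving_swap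
  have h := h3.comp (h1.comp (h4.comp h5))
  refine (funext fun q => ?_ : (fun q : Euc m × ℝ => joinCoords q.1 q.2) = _) ▸ h
  ext i
  refine Fin.lastCases ?_ (fun j => ?_) i
  · simp [joinCoords, MeasurableEquiv.piFinSuccAbove, Fin.insertNthEquiv]
  · simp [joinCoords, MeasurableEquiv.piFinSuccAbove, Fin.insertNthEquiv]

/-- A layer of a bounded set has volume at most proportional to its thickness. -/
lemma exists_volume_layer_le {m : ℕ} {Ω : Set (Euc (m + 1))} (hΩ : Bornology.IsBounded Ω) :
    ∃ C : ℝ≥0, ∀ S : Set ℝ, MeasurableSet S →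
      volume (Ω ∩ {z | z (Fin.last m) ∈ S}) ≤ C * volume S := by
  obtain ⟨r, hr⟩ := hΩ.subset_closedBall 0
  have hfin : volume (Metric.closedBall (0 : Euc m) r) ≠ ⊤ := measure_closedBall_lt_top.ne
  refine ⟨(volume (Metric.closedBall (0 : Euc m) r)).toNNReal, fun S hS => ?_⟩
  rw [ENNReal.coe_toNNReal hfin, ← Measure.prod_prod]
  have hmeas : MeasurableSet (Metric.closedBall (0 : Euc (m + 1)) r ∩ {z | z (Fin.last m) ∈ S}) :=
    Metric.isClosed_closedBall.measurableSet.inter (continuous_last.measurable hS)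
  refine (measure_mono (inter_subset_inter_left _ hr)).trans ?_
  rw [← measurePreserving_joinCoords.measure_preimage hmeas.nullMeasurableSet]
  refine measure_mono fun q hq => ⟨?_, by simpa using hq.2⟩
  have := norm_headCoords_le (joinCoords q.1 q.2)
  have h2 := hq.1
  simp only [Metric.mem_closedBall, dist_zero_right, headCoords_joinCoords] at *
  exact this.trans h2

lemma volume_hyperplane {m : ℕ} (t : ℝ) : volume {z : Euc (m + 1) | z (Fin.last m) = t} = 0 := by
  have hmeas : MeasurableSet {z : Euc (m + 1) | z (Fin.last m) = t} :=
    (isClosed_singleton.preimage continuous_last).measurableSet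
  rw [← measurePreserving_joinCoords.measure_preimage hmeas.nullMeasurableSet]
  have : ((fun q : Euc m × ℝ => joinCoords q.1 q.2) ⁻¹' {z | z (Fin.last m) = t})
      = univ ×ˢ {t} := by
    ext q; simp
  rw [this, Measure.prod_prod]
  simp

/-! ### Hausdorff measure of pieces of hyperplanes -/

lemma hausdorffMeasure_ball_pos {m : ℕ} (v : Euc m) {r : ℝ} (hr : 0 < r) :
    0 < Measure.hausdorffMeasure (m : ℝ) (Metric.ball v r) := by
  have h := isAddHaarMeasure_hausdorffMeasure (E := Euc m)
  rw [finrank_euclideanSpace_fin] at h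
  exact Metric.measure_ball_pos _ v hr

lemma hausdorffMeasure_closedBall_lt_top {m : ℕ} (v : Euc m) (r : ℝ) :
    Measure.hausdorffMeasure (m : ℝ) (Metric.closedBall v r) < ⊤ := by
  have h := isAddHaarMeasure_hausdorffMeasure (E := Euc m)
  rw [finrank_euclideanSpace_fin] at h
  exact (isCompact_closedBall v r).measure_lt_top

/-- A set which projects onto a ball of `ℝ^m` has at least its Hausdorff measure. -/
lemma hausdorffMeasure_ge_of_disc_subset {m : ℕ} {S : Set (Euc (m + 1))} {v : Euc m} {r t : ℝ}
    (h : ∀ w ∈ Metric.ball v r, joinCoords w t ∈ S) :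
    Measure.hausdorffMeasure (m : ℝ) (Metric.ball v r) ≤ Measure.hausdorffMeasure (m : ℝ) S := by
  have h1 := lipschitzWith_headCoords (m := m).hausdorffMeasure_image_le (d := m) (by positivity) S
  simp only [ENNReal.coe_one, ENNReal.one_rpow, one_mul] at h1
  refine le_trans (measure_mono (μ := Measure.hausdorffMeasure (m : ℝ)) ?_) h1
  exact fun w hw => ⟨_, h w hw, by simp⟩

lemma hausdorffMeasure_hyperplane_le {m : ℕ} (r t : ℝ) :
    Measure.hausdorffMeasure (m : ℝ)
        (Metric.closedBall (0 : Euc (m + 1)) r ∩ {z | z (Fin.last m) = t})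
      ≤ Measure.hausdorffMeasure (m : ℝ) (Metric.closedBall (0 : Euc m) r) := by
  rw [← (isometry_joinCoords t).hausdorffMeasure_image (Or.inl (by positivity))
    (Metric.closedBall (0 : Euc m) r)]
  refine measure_mono ?_
  rintro z ⟨hz, rfl⟩
  refine ⟨headCoords z, ?_, by simp⟩
  simp only [Metric.mem_closedBall, dist_zero_right] at *
  exact (norm_headCoords_le z).trans hz

/-- The boundary of a bounded Lipschitz domain has finite surface measure: it is covered by
finitely many Lipschitz graphs over bounded sets. -/
lemma hausdorffMeasure_frontier_lt_top {m : ℕ} {Ω : Set (Euc (m + 1))}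
    (hΩ : IsBoundedLipschitzDomain Ω) :
    Measure.hausdorffMeasure (m : ℝ) (frontier Ω) < ⊤ := by
  have hcomp : IsCompact (frontier Ω) :=
    Metric.isCompact_of_isClosed_isBounded isClosed_frontier
      (hΩ.isBounded.closure.subset frontier_subset_closure)
  refine hcomp.measure_lt_top_of_nhdsWithin fun x hx => ?_
  obtain ⟨U, Φ, γ, K, hU, hxU, hγ, heq⟩ := hΩ.lipschitz_boundary x hx
  refine ⟨frontier Ω ∩ U, inter_mem_nhdsWithin _ (hU.mem_nhds hxU), ?_⟩
  obtain ⟨r, hr⟩ := hΩ.isBounded.closure.subset_closedBall 0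
  -- the graph map over `ℝ^m`, transported by the inverse of the change of coordinates
  have hgraph : LipschitzWith (1 + K) fun v : Euc m => Φ.symm (joinCoords v (γ v)) := by
    refine LipschitzWith.of_dist_le_mul fun v w => ?_
    rw [Φ.symm.dist_map, dist_eq_norm, joinCoords_sub]
    refine (norm_le_head_add_last _).trans ?_
    have := hγ.dist_le_mul v w
    rw [Real.dist_eq] at this
    simp only [headCoords_joinCoords, joinCoords_last]
    rw [← dist_eq_norm]
    push_cast
    linarith
  have himg := hgraph.hausdorffMeasure_image_le (d := m) (by positivity)
    (Metric.closedBall (headCoords (Φ 0)) r)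
  refine lt_of_le_of_lt ((measure_mono ?_).trans himg) ?_
  · rintro z ⟨hz, hzU⟩
    have hc1 : Continuous fun z => γ (headCoords (Φ z)) :=
      hγ.continuous.comp (lipschitzWith_headCoords.continuous.comp Φ.continuous)
    have hc2 : Continuous fun z => Φ z (Fin.last m) := continuous_last.comp Φ.continuous
    have hzγ : γ (headCoords (Φ z)) = Φ z (Fin.last m) := by
      rcases lt_trichotomy (γ (headCoords (Φ z))) (Φ z (Fin.last m)) with h | h | h
      · have : z ∈ Ω ∩ U := by rw [heq]; exact ⟨h, hzU⟩
        rw [hΩ.isOpen.frontier_eq] at hz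
        exact absurd this.1 hz.2
      · exact h
      · have hopen : IsOpen ({z | Φ z (Fin.last m) < γ (headCoords (Φ z))} ∩ U) :=
          (isOpen_lt hc2 hc1).inter hU
        have hcl : z ∈ closure Ω := frontier_subset_closure hz
        obtain ⟨w, ⟨hw1, hw2⟩, hw3⟩ := mem_closure_iff.1 hcl _ hopen ⟨h, hzU⟩
        have : w ∈ Ω ∩ U := ⟨hw3, hw2⟩
        rw [heq] at this
        exact (lt_asymm (show Φ w (Fin.last m) < γ (headCoords (Φ w)) from hw1) this.1).elim
    refine ⟨headCoords (Φ z), ?_, ?_⟩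
    · have h0 := hr (frontier_subset_closure hz)
      rw [Metric.mem_closedBall] at h0 ⊢
      have h1 := lipschitzWith_headCoords.dist_le_mul (Φ z) (Φ 0)
      rw [Φ.dist_map] at h1
      simpa using h1.trans (by simpa using h0)
    · simp [hzγ]
  · exact ENNReal.mul_lt_top (ENNReal.rpow_lt_top_of_nonneg (by positivity) ENNReal.coe_ne_top)
      (hausdorffMeasure_closedBall_lt_top _ _)

/-! ### Essential boundaries and jump sets -/

lemma essBoundary_empty {d : ℕ} : essBoundary (∅ : Set (Euc d)) = ∅ := by
  ext x
  simp [essBoundary, HasDensity]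

lemma notMem_essBoundary_of_mem_interior {d : ℕ} {P : Set (Euc d)} {x : Euc d}
    (h : x ∈ interior P) : x ∉ essBoundary P := by
  intro hx
  refine hx.2 (Tendsto.congr' ?_ tendsto_const_nhds)
  obtain ⟨r, hr, hP⟩ := Metric.mem_nhds_iff.1 (mem_interior_iff_mem_nhds.1 h)
  filter_upwards [Ioo_mem_nhdsGT hr] with ρ hρ
  rw [inter_eq_right.2 ((Metric.ball_subset_ball hρ.2.le).trans hP), ENNReal.div_self]
  · exact (Metric.measure_ball_pos _ _ hρ.1).ne'
  · exact measure_ball_lt_top.ne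

lemma notMem_essBoundary_of_notMem_closure {d : ℕ} {P : Set (Euc d)} {x : Euc d}
    (h : x ∉ closure P) : x ∉ essBoundary P := by
  intro hx
  refine hx.1 (Tendsto.congr' ?_ tendsto_const_nhds)
  obtain ⟨r, hr, hP⟩ := Metric.mem_nhds_iff.1 (isClosed_closure.isOpen_compl.mem_nhds h)
  filter_upwards [Ioo_mem_nhdsGT hr] with ρ hρ
  have : P ∩ Metric.ball x ρ = ∅ := by
    ext z
    simp only [mem_inter_iff, mem_empty_iff_false, iff_false, not_and]
    intro hz hzb
    exact hP (Metric.ball_subset_ball hρ.2.le hzb) (subset_closure hz)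
  simp [this]

lemma essBoundary_subset_frontier {d : ℕ} (P : Set (Euc d)) : essBoundary P ⊆ frontier P :=
  fun _ hx => ⟨by_contra fun h => notMem_essBoundary_of_notMem_closure h hx,
    fun h => notMem_essBoundary_of_mem_interior h hx⟩

/-- A half ball contains a ball of half the radius. -/
lemma ball_subset_halfBall {d : ℕ} (x ν : Euc d) (hν : ‖ν‖ = 1) {ρ : ℝ} (hρ : 0 < ρ) :
    Metric.ball (x + (ρ / 2) • ν) (ρ / 2) ⊆ Metric.ball x ρ ∩ {z | 0 < inner ℝ (z - x) ν} := by
  intro z hz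
  rw [Metric.mem_ball, dist_eq_norm] at hz
  have hd : z - x = (z - (x + (ρ / 2) • ν)) + (ρ / 2) • ν := by abel
  refine ⟨?_, ?_⟩
  · rw [Metric.mem_ball, dist_eq_norm, hd]
    refine (norm_add_le _ _).trans_lt ?_
    rw [norm_smul, hν, Real.norm_of_nonneg (by positivity)]
    linarith
  · rw [mem_ofPred_eq, hd, inner_add_left, inner_smul_left, real_inner_self_eq_norm_sq, hν]
    have := (abs_le.1 (abs_real_inner_le_norm (z - (x + (ρ / 2) • ν)) ν)).1
    rw [hν] at this
    simp only [conj_trivial]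
    linarith

lemma volume_halfBall_ge {d : ℕ} (x ν : Euc d) (hν : ‖ν‖ = 1) {ρ : ℝ} (hρ : 0 < ρ) :
    ENNReal.ofReal ((1 / 2) ^ d) * volume (Metric.ball x ρ)
      ≤ volume (Metric.ball x ρ ∩ {z | 0 < inner ℝ (z - x) ν}) := by
  refine le_trans (le_of_eq ?_) (measure_mono (ball_subset_halfBall x ν hν hρ))
  rw [Measure.addHaar_ball_of_pos _ _ hρ, Measure.addHaar_ball_of_pos _ _ (half_pos hρ),
    finrank_euclideanSpace_fin, ← mul_assoc, ← ENNReal.ofReal_mul (by positivity), ← mul_pow]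
  ring_nf

lemma volume_halfBall_pos {d : ℕ} (x ν : Euc d) (hν : ‖ν‖ = 1) {ρ : ℝ} (hρ : 0 < ρ) :
    0 < volume (Metric.ball x ρ ∩ {z | 0 < inner ℝ (z - x) ν}) :=
  (Metric.measure_ball_pos volume _ (half_pos hρ)).trans_le
    (measure_mono (ball_subset_halfBall x ν hν hρ))

lemma measurableSet_halfSpace {d : ℕ} (x ν : Euc d) :
    MeasurableSet {z : Euc d | 0 < inner ℝ (z - x) ν} :=
  (isOpen_lt continuous_const (by fun_prop)).measurableSet

/-- A point near which `P` agrees, up to null sets, with a half space through that point lies in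
the essential boundary of `P`. -/
lemma mem_essBoundary_of_halfSpace {d : ℕ} {P : Set (Euc d)} {x ν : Euc d} {r : ℝ} (hr : 0 < r)
    (hν : ‖ν‖ = 1)
    (hin : volume ((Metric.ball x r ∩ {z | 0 < inner ℝ (z - x) ν}) \ P) = 0)
    (hout : volume (P ∩ (Metric.ball x r ∩ {z | inner ℝ (z - x) ν < 0})) = 0) :
    x ∈ essBoundary P := by
  set c : ℝ≥0∞ := ENNReal.ofReal ((1 / 2) ^ d) with hc
  have hc0 : 0 < c := ENNReal.ofReal_pos.2 (by positivity)
  have hlow : ∀ᶠ ρ in 𝓝[>] (0 : ℝ),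
      c ≤ volume (P ∩ Metric.ball x ρ) / volume (Metric.ball x ρ) := by
    filter_upwards [Ioo_mem_nhdsGT hr] with ρ hρ
    rw [ENNReal.le_div_iff_mul_le (Or.inl (Metric.measure_ball_pos _ _ hρ.1).ne')
      (Or.inl measure_ball_lt_top.ne)]
    refine (volume_halfBall_ge x ν hν hρ.1).trans ?_
    have hz : volume ((Metric.ball x ρ ∩ {z | 0 < inner ℝ (z - x) ν}) \ P) = 0 :=
      measure_mono_null (sdiff_subset_sdiff_left
        (inter_subset_inter_left _ (Metric.ball_subset_ball hρ.2.le))) hin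
    calc _ ≤ volume ((P ∩ Metric.ball x ρ) ∪
          ((Metric.ball x ρ ∩ {z | 0 < inner ℝ (z - x) ν}) \ P)) := by
            refine measure_mono fun z hz => ?_
            by_cases hP : z ∈ P
            · exact Or.inl ⟨hP, hz.1⟩
            · exact Or.inr ⟨hz, hP⟩
      _ ≤ _ := by
        refine (measure_union_le _ _).trans ?_
        rw [hz, add_zero]
  have hupp : ∀ᶠ ρ in 𝓝[>] (0 : ℝ),
      volume (P ∩ Metric.ball x ρ) / volume (Metric.ball x ρ) ≤ 1 - c := by
    filter_upwards [Ioo_mem_nhdsGT hr] with ρ hρ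
    have hb0 := (Metric.measure_ball_pos volume x hρ.1).ne'
    have hbt : volume (Metric.ball x ρ) ≠ ⊤ := measure_ball_lt_top.ne
    have h1 := volume_halfBall_ge x (-ν) (by simpa using hν) hρ.1
    have hset : {z : Euc d | 0 < inner ℝ (z - x) (-ν)} = {z | inner ℝ (z - x) ν < 0} := by
      ext z; simp
    rw [hset] at h1
    have hz : volume (P ∩ (Metric.ball x ρ ∩ {z | inner ℝ (z - x) ν < 0})) = 0 :=
      measure_mono_null (inter_subset_inter_right _
        (inter_subset_inter_left _ (Metric.ball_subset_ball hρ.2.le))) hout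
    have hmeas : MeasurableSet {z : Euc d | inner ℝ (z - x) ν < 0} := by
      rw [← hset]; exact measurableSet_halfSpace _ _
    have h2 : volume (P ∩ Metric.ball x ρ)
        ≤ volume (Metric.ball x ρ \ {z | inner ℝ (z - x) ν < 0}) := by
      calc _ ≤ volume ((Metric.ball x ρ \ {z | inner ℝ (z - x) ν < 0}) ∪
            (P ∩ (Metric.ball x ρ ∩ {z | inner ℝ (z - x) ν < 0}))) := by
              refine measure_mono fun z hz => ?_
              by_cases hzz : z ∈ {z : Euc d | inner ℝ (z - x) ν < 0}
              · exact Or.inr ⟨hz.1, hz.2, hzz⟩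
              · exact Or.inl ⟨hz.2, hzz⟩
        _ ≤ _ := by
          refine (measure_union_le _ _).trans ?_
          rw [hz, add_zero]
    have h3 := measure_inter_add_sdiff (μ := volume) (Metric.ball x ρ) hmeas
    rw [ENNReal.div_le_iff hb0 hbt]
    refine h2.trans ?_
    rw [ENNReal.sub_mul (fun _ _ => hbt), one_mul]
    refine ENNReal.le_sub_of_add_le_left (ENNReal.mul_ne_top ENNReal.ofReal_ne_top hbt) ?_
    calc _ ≤ c * volume (Metric.ball x ρ) + volume (Metric.ball x ρ \
          {z | inner ℝ (z - x) ν < 0}) := by gcongr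
      _ ≤ _ := by
        rw [← h3] at h1 ⊢
        gcongr
  refine ⟨fun h => ?_, fun h => ?_⟩
  · exact absurd (ge_of_tendsto h hlow) (not_le.2 hc0)
  · have := le_of_tendsto h hupp
    exact absurd this (not_le.2 (ENNReal.sub_lt_self ENNReal.one_ne_top one_ne_zero hc0.ne'))

lemma eq_of_meanTendsto_of_ae_eq {d : ℕ} {F : Type*} [NormedAddCommGroup F] {u : Euc d → F}
    {x ν : Euc d} {r : ℝ} (hr : 0 < r) (hν : ‖ν‖ = 1) {c a : F}
    (hc : ∀ᵐ z ∂(volume.restrict (Metric.ball x r)), u z = c)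
    (ha : MeanTendsto u x {z | 0 < inner ℝ (z - x) ν} a) : c = a := by
  have hev : (fun ρ : ℝ => (∫⁻ z in Metric.ball x ρ ∩ {z | 0 < inner ℝ (z - x) ν}, ‖u z - a‖ₑ)
      / volume (Metric.ball x ρ ∩ {z | 0 < inner ℝ (z - x) ν})) =ᶠ[𝓝[>] 0] fun _ => ‖c - a‖ₑ := by
    filter_upwards [Ioo_mem_nhdsGT hr] with ρ hρ
    have hsub : Metric.ball x ρ ∩ {z | 0 < inner ℝ (z - x) ν} ⊆ Metric.ball x r :=
      inter_subset_left.trans (Metric.ball_subset_ball hρ.2.le)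
    have hle : ∀ᵐ z ∂(volume.restrict (Metric.ball x ρ ∩ {z | 0 < inner ℝ (z - x) ν})), u z = c :=
      ae_mono (Measure.restrict_mono hsub le_rfl) hc
    rw [lintegral_congr_ae (g := fun _ => ‖c - a‖ₑ) (hle.mono fun z hz => by simp only [hz]),
      setLIntegral_const, ENNReal.mul_div_cancel_right]
    · exact (volume_halfBall_pos x ν hν hρ.1).ne'
    · exact ((measure_mono inter_subset_left).trans_lt measure_ball_lt_top).ne
  have := tendsto_nhds_unique (Tendsto.congr' hev ha) tendsto_const_nhds
  have h0 : c - a = 0 := enorm_eq_zero.1 this.symm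
  exact sub_eq_zero.1 h0

/-- A map which is a.e. constant near `x` does not jump at `x`. -/
lemma notMem_jumpSet_of_ae_eq {d : ℕ} {F : Type*} [NormedAddCommGroup F] {Ω : Set (Euc d)}
    {u : Euc d → F} {x : Euc d} {r : ℝ} (hr : 0 < r) {c : F}
    (hc : ∀ᵐ z ∂(volume.restrict (Metric.ball x r)), u z = c) : x ∉ jumpSet Ω u := by
  rintro ⟨-, a, b, ν, hab, hν, ha, hb⟩
  refine hab ?_
  rw [← eq_of_meanTendsto_of_ae_eq hr hν hc ha]
  refine eq_of_meanTendsto_of_ae_eq (ν := -ν) hr (by simpa using hν) hc ?_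
  convert hb using 2
  ext z; simp

/-! ### Layered sets and their essential boundary -/

/-- Two disjoint open sets which meet an interval and cover it up to countably many points are
separated by an exceptional point which is isolated among the exceptional points: the exceptional
set is closed, countable and nonempty, so by Baire's theorem it has an isolated point. -/
lemma exists_isolated_exceptional_point {U V : Set ℝ} (hU : IsOpen U) (hV : IsOpen V)
    (hUV : Disjoint U V) {a b : ℝ} (hc : (Ioo a b \ (U ∪ V)).Countable)
    (hIU : (Ioo a b ∩ U).Nonempty) (hIV : (Ioo a b ∩ V).Nonempty) :
    ∃ t ∈ Ioo a b \ (U ∪ V), ∃ ρ > 0, Ioo (t - ρ) (t + ρ) ⊆ Ioo a b ∧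
      Ioo (t - ρ) (t + ρ) \ {t} ⊆ U ∪ V := by
  set K : Set ℝ := Ioo a b \ (U ∪ V) with hK
  have hne : K.Nonempty := by
    by_contra h
    rw [not_nonempty_iff_eq_empty, sdiff_eq_empty] at h
    obtain ⟨z, -, hz⟩ := isPreconnected_Ioo U V hU hV h hIU hIV
    exact (hUV.le_bot hz)
  have hloc : IsLocallyClosed K :=
    isOpen_Ioo.isLocallyClosed.inter (hU.union hV).isClosed_compl.isLocallyClosed
  have : LocallyCompactSpace K := hloc.locallyCompactSpace
  have : Nonempty K := hne.to_subtype
  have : Countable K := hc.to_subtype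
  obtain ⟨t, ht⟩ := nonempty_interior_of_iUnion_of_closed (f := fun t : K => ({t} : Set K))
    (fun t => isClosed_singleton) (iUnion_of_singleton K)
  have hopen : IsOpen ({t} : Set K) := by
    have : interior ({t} : Set K) = {t} := by
      obtain ⟨s, hs⟩ := ht
      have hst : s ∈ ({t} : Set K) := interior_subset hs
      rw [mem_singleton_iff] at hst
      subst hst
      exact subset_antisymm interior_subset (singleton_subset_iff.2 hs)
    rw [← this]; exact isOpen_interior
  obtain ⟨O, hO, hOt⟩ := isOpen_induced_iff.1 hopen
  have htO : (t : ℝ) ∈ O := by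
    have : t ∈ (Subtype.val ⁻¹' O : Set K) := by rw [hOt]; rfl
    exact this
  obtain ⟨ρ, hρ, hball⟩ := Metric.isOpen_iff.1 (hO.inter isOpen_Ioo) t ⟨htO, t.2.1⟩
  rw [Real.ball_eq_Ioo] at hball
  refine ⟨t, t.2, ρ, hρ, hball.trans inter_subset_right, ?_⟩
  rintro s ⟨hs, hst⟩
  by_contra h
  have hsK : s ∈ K := ⟨(hball hs).2, h⟩
  have : (⟨s, hsK⟩ : K) ∈ (Subtype.val ⁻¹' O : Set K) := (hball hs).1
  rw [hOt] at this
  exact hst (congrArg Subtype.val this)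

/-- The cylinder of radius `r` and height `2h` around `x`. -/
def cylinder {m : ℕ} (x : Euc (m + 1)) (r h : ℝ) : Set (Euc (m + 1)) :=
  {z | headCoords z ∈ Metric.ball (headCoords x) r ∧ z (Fin.last m) ∈ Ioo (x (Fin.last m) - h)
    (x (Fin.last m) + h)}

lemma isOpen_cylinder {m : ℕ} (x : Euc (m + 1)) (r h : ℝ) : IsOpen (cylinder x r h) :=
  (Metric.isOpen_ball.preimage lipschitzWith_headCoords.continuous).inter
    (isOpen_Ioo.preimage continuous_last)

lemma cylinder_subset_ball {m : ℕ} (x : Euc (m + 1)) (r : ℝ) :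
    cylinder x (r / 2) (r / 2) ⊆ Metric.ball x r := by
  rintro z ⟨h1, h2⟩
  rw [Metric.mem_ball, dist_eq_norm] at *
  refine (norm_le_head_add_last _).trans_lt ?_
  rw [headCoords_sub]
  have : |(z - x) (Fin.last m)| < r / 2 := by
    rw [abs_lt]; constructor <;> simp <;> linarith [h2.1, h2.2]
  linarith

/-- The slices of a cylinder are discs, hence connected. -/
lemma isPreconnected_disc {m : ℕ} (v : Euc m) (r t : ℝ) :
    IsPreconnected ((fun w => joinCoords w t) '' Metric.ball v r) :=
  (convex_ball v r).isPreconnected.image _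
    (isometry_joinCoords t).continuous.continuousOn

lemma subset_interior_or_disjoint_closure {X : Type*} [TopologicalSpace X] {S P : Set X}
    (hS : IsPreconnected S) (h : ∀ z ∈ S, z ∉ frontier P) :
    S ⊆ interior P ∨ Disjoint S (closure P) := by
  have hcov : S ⊆ interior P ∪ (closure P)ᶜ := by
    intro z hz
    by_cases hzc : z ∈ closure P
    · exact Or.inl (by_contra fun hi => h z hz ⟨hzc, hi⟩)
    · exact Or.inr hzc
  rcases hS.subset_or_subset isOpen_interior isClosed_closure.isOpen_compl
    (disjoint_compl_right.mono_left interior_subset_closure) hcov with h1 | h1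
  · exact Or.inl h1
  · exact Or.inr (disjoint_left.2 h1)

/-- Let the boundary of `P` in a cylinder lie in countably many horizontal hyperplanes, and let `P`
be neither null nor of full measure in the cylinder. Then the essential boundary of `P` contains a
whole slice of the cylinder. -/
lemma exists_slice_subset_essBoundary {m : ℕ} {P : Set (Euc (m + 1))} {x : Euc (m + 1)} {r h : ℝ}
    (hr : 0 < r) {s : ℕ → ℝ}
    (hs : frontier P ∩ cylinder x r h ⊆ ⋃ i, {z | z (Fin.last m) = s i})
    (hin : 0 < volume (cylinder x r h ∩ P)) (hout : 0 < volume (cylinder x r h \ P)) :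
    ∃ t, ∀ w ∈ Metric.ball (headCoords x) r, joinCoords w t ∈ essBoundary P := by
  set Q := cylinder x r h with hQ
  set a := x (Fin.last m) - h with ha
  set b := x (Fin.last m) + h with hb
  set v := headCoords x with hv
  have hnull : volume (⋃ i, {z : Euc (m + 1) | z (Fin.last m) = s i}) = 0 :=
    measure_iUnion_null fun i => volume_hyperplane (s i)
  -- heights around which, inside the cylinder, the set `P` has full or zero measure
  set U : Set ℝ := {t | ∃ ρ > 0, volume ((Q ∩ {z | z (Fin.last m) ∈ Ioo (t - ρ) (t + ρ)}) \ P) = 0}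
    with hU
  set V : Set ℝ := {t | ∃ ρ > 0, volume ((Q ∩ {z | z (Fin.last m) ∈ Ioo (t - ρ) (t + ρ)}) ∩ P) = 0}
    with hV
  have hIoo : ∀ {t t' ρ : ℝ}, t' ∈ Ioo (t - ρ) (t + ρ) → ∃ ρ' > 0,
      Ioo (t' - ρ') (t' + ρ') ⊆ Ioo (t - ρ) (t + ρ) := by
    intro t t' ρ ht'
    obtain ⟨ρ', h1, h2⟩ := Metric.isOpen_iff.1 isOpen_Ioo t' ht'
    exact ⟨ρ', h1, by rwa [Real.ball_eq_Ioo] at h2⟩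
  have hUo : IsOpen U := by
    rw [Metric.isOpen_iff]
    rintro t ⟨ρ, hρ, h0⟩
    refine ⟨ρ, hρ, fun t' ht' => ?_⟩
    rw [Real.ball_eq_Ioo] at ht'
    obtain ⟨ρ', h1, h2⟩ := hIoo ht'
    refine ⟨ρ', h1, measure_mono_null ?_ h0⟩
    rintro z ⟨⟨hz1, hz2⟩, hz3⟩
    exact ⟨⟨hz1, h2 hz2⟩, hz3⟩
  have hVo : IsOpen V := by
    rw [Metric.isOpen_iff]
    rintro t ⟨ρ, hρ, h0⟩
    refine ⟨ρ, hρ, fun t' ht' => ?_⟩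
    rw [Real.ball_eq_Ioo] at ht'
    obtain ⟨ρ', h1, h2⟩ := hIoo ht'
    refine ⟨ρ', h1, measure_mono_null ?_ h0⟩
    rintro z ⟨⟨hz1, hz2⟩, hz3⟩
    exact ⟨⟨hz1, h2 hz2⟩, hz3⟩
  have hdisc : ∀ t ∈ Ioo a b, t ∉ range s →
      ((fun w => joinCoords w t) '' Metric.ball v r) ⊆ interior P ∨
      Disjoint ((fun w => joinCoords w t) '' Metric.ball v r) (closure P) := by
    intro t ht hts
    refine subset_interior_or_disjoint_closure (isPreconnected_disc v r t) ?_
    rintro _ ⟨w, hw, rfl⟩ hf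
    obtain ⟨i, hi⟩ := mem_iUnion.1 (hs ⟨hf, ⟨by simpa using hw, by simpa using ht⟩⟩)
    exact hts ⟨i, by simpa using hi.symm⟩
  have hline : Continuous fun t => joinCoords v t :=
    continuous_joinCoords.comp (Continuous.prodMk_right v)
  have hvr : v ∈ Metric.ball v r := Metric.mem_ball_self hr
  have hmemQ : ∀ z ∈ Q, z ∈ (fun w => joinCoords w (z (Fin.last m))) '' Metric.ball v r :=
    fun z hz => ⟨headCoords z, hz.1, by simp⟩
  have hUmem : ∀ t ∈ Ioo a b, joinCoords v t ∈ interior P → t ∈ U := by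
    intro t ht hi
    obtain ⟨ρ, hρ, hsub⟩ := Metric.isOpen_iff.1 (isOpen_interior.preimage hline) t hi
    rw [Real.ball_eq_Ioo] at hsub
    refine ⟨ρ, hρ, measure_mono_null ?_ hnull⟩
    rintro z ⟨⟨hzQ, hzt⟩, hzP⟩
    by_contra hzs
    have hzr : z (Fin.last m) ∉ range s := fun ⟨i, hi⟩ => hzs (mem_iUnion.2 ⟨i, hi.symm⟩)
    rcases hdisc _ hzQ.2 hzr with h1 | h1
    · exact hzP (interior_subset (h1 (hmemQ z hzQ)))
    · exact disjoint_left.1 h1 ⟨v, hvr, rfl⟩ (interior_subset_closure (hsub hzt))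
  have hVmem : ∀ t ∈ Ioo a b, joinCoords v t ∉ closure P → t ∈ V := by
    intro t ht hi
    obtain ⟨ρ, hρ, hsub⟩ :=
      Metric.isOpen_iff.1 (isClosed_closure.isOpen_compl.preimage hline) t hi
    rw [Real.ball_eq_Ioo] at hsub
    refine ⟨ρ, hρ, measure_mono_null ?_ hnull⟩
    rintro z ⟨⟨hzQ, hzt⟩, hzP⟩
    by_contra hzs
    have hzr : z (Fin.last m) ∉ range s := fun ⟨i, hi⟩ => hzs (mem_iUnion.2 ⟨i, hi.symm⟩)
    rcases hdisc _ hzQ.2 hzr with h1 | h1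
    · exact hsub hzt (interior_subset_closure (h1 ⟨v, hvr, rfl⟩))
    · exact disjoint_left.1 h1 (hmemQ z hzQ) (subset_closure hzP)
  have hpos : ∀ t ∈ Ioo a b, ∀ ρ > 0,
      0 < volume (Q ∩ {z : Euc (m + 1) | z (Fin.last m) ∈ Ioo (t - ρ) (t + ρ)}) := by
    intro t ht ρ hρ
    refine (((isOpen_cylinder x r h).inter
      (isOpen_Ioo.preimage continuous_last)).measure_pos _ ⟨joinCoords v t, ⟨?_, ?_⟩, ?_⟩)
    · rw [headCoords_joinCoords]; exact hvr
    · simpa using ht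
    · simp [hρ]
  have hUVI : ∀ t ∈ Ioo a b, t ∈ U → t ∉ V := by
    rintro t ht ⟨ρ, hρ, h0⟩ ⟨ρ', hρ', h0'⟩
    have := hpos t ht (min ρ ρ') (lt_min hρ hρ')
    refine this.ne' (measure_mono_null ?_ (measure_union_null h0 h0'))
    rintro z ⟨hz, hzt⟩
    have h1 : z (Fin.last m) ∈ Ioo (t - ρ) (t + ρ) :=
      Ioo_subset_Ioo (by linarith [min_le_left ρ ρ']) (by linarith [min_le_left ρ ρ']) hzt
    have h2 : z (Fin.last m) ∈ Ioo (t - ρ') (t + ρ') :=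
      Ioo_subset_Ioo (by linarith [min_le_right ρ ρ']) (by linarith [min_le_right ρ ρ']) hzt
    by_cases hP : z ∈ P
    · exact Or.inr ⟨⟨hz, h2⟩, hP⟩
    · exact Or.inl ⟨⟨hz, h1⟩, hP⟩
  have hexc : Ioo a b \ (U ∩ Ioo a b ∪ V ∩ Ioo a b) ⊆ range s := by
    rintro t ⟨ht, htUV⟩
    by_contra hts
    rcases hdisc t ht hts with h1 | h1
    · exact htUV (Or.inl ⟨hUmem t ht (h1 ⟨v, hvr, rfl⟩), ht⟩)
    · exact htUV (Or.inr ⟨hVmem t ht (disjoint_left.1 h1 ⟨v, hvr, rfl⟩), ht⟩)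
  have hUne : (Ioo a b ∩ (U ∩ Ioo a b)).Nonempty := by
    by_contra hne
    refine hin.ne' (measure_mono_null ?_ hnull)
    rintro z ⟨hzQ, hzP⟩
    by_contra hzs
    have hzr : z (Fin.last m) ∉ range s := fun ⟨i, hi⟩ => hzs (mem_iUnion.2 ⟨i, hi.symm⟩)
    rcases hdisc _ hzQ.2 hzr with h1 | h1
    · exact hne ⟨_, hzQ.2, hUmem _ hzQ.2 (h1 ⟨v, hvr, rfl⟩), hzQ.2⟩
    · exact disjoint_left.1 h1 (hmemQ z hzQ) (subset_closure hzP)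
  have hVne : (Ioo a b ∩ (V ∩ Ioo a b)).Nonempty := by
    by_contra hne
    refine hout.ne' (measure_mono_null ?_ hnull)
    rintro z ⟨hzQ, hzP⟩
    by_contra hzs
    have hzr : z (Fin.last m) ∉ range s := fun ⟨i, hi⟩ => hzs (mem_iUnion.2 ⟨i, hi.symm⟩)
    rcases hdisc _ hzQ.2 hzr with h1 | h1
    · exact hzP (interior_subset (h1 (hmemQ z hzQ)))
    · exact hne ⟨_, hzQ.2, hVmem _ hzQ.2 (disjoint_left.1 h1 ⟨v, hvr, rfl⟩), hzQ.2⟩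
  have hdisj : Disjoint (U ∩ Ioo a b) (V ∩ Ioo a b) :=
    disjoint_left.2 fun t h1 h2 => hUVI t h1.2 h1.1 h2.1
  obtain ⟨t, ⟨htI, htUV⟩, ρ, hρ, hρI, hρUV⟩ := exists_isolated_exceptional_point
    (hUo.inter isOpen_Ioo) (hVo.inter isOpen_Ioo) hdisj ((countable_range s).mono hexc) hUne hVne
  -- local nullity gives nullity
  have hUnull : ∀ S : Set ℝ, S ⊆ U → volume ((Q ∩ {z | z (Fin.last m) ∈ S}) \ P) = 0 := by
    intro S hS
    refine measure_null_of_locally_null _ fun z hz => ?_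
    obtain ⟨ρ', hρ', h0⟩ := hS hz.1.2
    refine ⟨_, ?_, h0⟩
    have hn : {y : Euc (m + 1) | y (Fin.last m) ∈
        Ioo (z (Fin.last m) - ρ') (z (Fin.last m) + ρ')} ∈ 𝓝 z :=
      (isOpen_Ioo.preimage continuous_last).mem_nhds (by simp [hρ'])
    filter_upwards [self_mem_nhdsWithin, mem_nhdsWithin_of_mem_nhds hn] with y hy1 hy2
    exact ⟨⟨hy1.1.1, hy2⟩, hy1.2⟩
  have hVnull : ∀ S : Set ℝ, S ⊆ V → volume ((Q ∩ {z | z (Fin.last m) ∈ S}) ∩ P) = 0 := by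
    intro S hS
    refine measure_null_of_locally_null _ fun z hz => ?_
    obtain ⟨ρ', hρ', h0⟩ := hS hz.1.2
    refine ⟨_, ?_, h0⟩
    have hn : {y : Euc (m + 1) | y (Fin.last m) ∈
        Ioo (z (Fin.last m) - ρ') (z (Fin.last m) + ρ')} ∈ 𝓝 z :=
      (isOpen_Ioo.preimage continuous_last).mem_nhds (by simp [hρ'])
    filter_upwards [self_mem_nhdsWithin, mem_nhdsWithin_of_mem_nhds hn] with y hy1 hy2
    exact ⟨⟨hy1.1.1, hy2⟩, hy1.2⟩
  have hside : ∀ S : Set ℝ, IsPreconnected S → S ⊆ Ioo (t - ρ) (t + ρ) \ {t} → S ⊆ U ∨ S ⊆ V := by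
    intro S hS hsub
    rcases hS.subset_or_subset (hUo.inter isOpen_Ioo) (hVo.inter isOpen_Ioo) hdisj
      (hsub.trans hρUV) with h1 | h1
    · exact Or.inl (h1.trans inter_subset_left)
    · exact Or.inr (h1.trans inter_subset_left)
  have hL := hside (Ioo (t - ρ) t) isPreconnected_Ioo
    fun y hy => ⟨⟨hy.1, by linarith [hy.2]⟩, hy.2.ne⟩
  have hR := hside (Ioo t (t + ρ)) isPreconnected_Ioo
    fun y hy => ⟨⟨by linarith [hy.1], hy.2⟩, hy.1.ne'⟩
  have htU : t ∉ U := fun h => htUV (Or.inl ⟨h, htI⟩)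
  have htV : t ∉ V := fun h => htUV (Or.inr ⟨h, htI⟩)
  have hsplit : ∀ {y : ℝ}, y ∈ Ioo (t - ρ) (t + ρ) → y = t ∨ y ∈ Ioo (t - ρ) t ∪ Ioo t (t + ρ) := by
    intro y hy
    rcases lt_trichotomy y t with h | h | h
    · exact Or.inr (Or.inl ⟨hy.1, h⟩)
    · exact Or.inl h
    · exact Or.inr (Or.inr ⟨h, hy.2⟩)
  refine ⟨t, fun w hw => ?_⟩
  set p := joinCoords w t with hp
  have hpO : p ∈ Q ∩ {z | z (Fin.last m) ∈ Ioo (t - ρ) (t + ρ)} :=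
    ⟨⟨by simpa [hp] using hw, by simpa [hp] using htI⟩, by simp [hp, hρ]⟩
  obtain ⟨r', hr', hball⟩ := Metric.isOpen_iff.1
    ((isOpen_cylinder x r h).inter (isOpen_Ioo.preimage continuous_last)) p hpO
  have hinner : ∀ z : Euc (m + 1),
      inner ℝ (z - p) (EuclideanSpace.single (Fin.last m) (1 : ℝ)) = z (Fin.last m) - t := by
    intro z
    rw [EuclideanSpace.inner_single_right]
    simp [hp]
  rcases hL with hL | hL <;> rcases hR with hR | hR
  · refine absurd ⟨ρ, hρ, measure_mono_null ?_ (measure_union_null (hUnull _ (union_subset hL hR))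
      (volume_hyperplane t))⟩ htU
    rintro z ⟨⟨hzQ, hzt⟩, hzP⟩
    rcases hsplit hzt with h1 | h1
    · exact Or.inr h1
    · exact Or.inl ⟨⟨hzQ, h1⟩, hzP⟩
  · refine mem_essBoundary_of_halfSpace (ν := -EuclideanSpace.single (Fin.last m) (1 : ℝ)) hr'
      (by simp) (measure_mono_null ?_ (hUnull _ hL)) (measure_mono_null ?_ (hVnull _ hR))
    · rintro z ⟨⟨hz1, hz2⟩, hzP⟩
      simp only [inner_neg_right, hinner, mem_ofPred_eq] at hz2
      exact ⟨⟨(hball hz1).1, (hball hz1).2.1, by linarith⟩, hzP⟩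
    · rintro z ⟨hzP, hz1, hz2⟩
      simp only [inner_neg_right, hinner, mem_ofPred_eq] at hz2
      exact ⟨⟨(hball hz1).1, by linarith, (hball hz1).2.2⟩, hzP⟩
  · refine mem_essBoundary_of_halfSpace (ν := EuclideanSpace.single (Fin.last m) (1 : ℝ)) hr'
      (by simp) (measure_mono_null ?_ (hUnull _ hR)) (measure_mono_null ?_ (hVnull _ hL))
    · rintro z ⟨⟨hz1, hz2⟩, hzP⟩
      simp only [hinner, mem_ofPred_eq] at hz2
      exact ⟨⟨(hball hz1).1, by linarith, (hball hz1).2.2⟩, hzP⟩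
    · rintro z ⟨hzP, hz1, hz2⟩
      simp only [hinner, mem_ofPred_eq] at hz2
      exact ⟨⟨(hball hz1).1, (hball hz1).2.1, by linarith⟩, hzP⟩
  · refine absurd ⟨ρ, hρ, measure_mono_null ?_ (measure_union_null (hVnull _ (union_subset hL hR))
      (volume_hyperplane t))⟩ htV
    rintro z ⟨⟨hzQ, hzt⟩, hzP⟩
    rcases hsplit hzt with h1 | h1
    · exact Or.inr h1
    · exact Or.inl ⟨⟨hzQ, h1⟩, hzP⟩

/-- For a partition in `𝓟(Ω)` each point of `Ω` off all boundaries is interior to some piece: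
pieces accumulating at the point would each contribute at least the area of a fixed disc to the
perimeter. -/
lemma MemLimitPartition.exists_mem_interior {m : ℕ} {Ω : Set (Euc (m + 1))}
    {P : ℕ → Set (Euc (m + 1))} (hP : MemLimitPartition Ω P) (hΩ : IsOpen Ω) {x : Euc (m + 1)}
    (hx : x ∈ Ω) (hxP : ∀ j, x ∉ frontier (P j)) : ∃ j, x ∈ interior (P j) := by
  by_contra! hint
  have hcl : ∀ j, x ∉ closure (P j) := fun j h => hxP j ⟨h, hint j⟩
  obtain ⟨hcac, s, hs⟩ := hP
  obtain ⟨r, hr, hball⟩ := Metric.isOpen_iff.1 hΩ x hx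
  set Q := cylinder x (r / 2) (r / 2) with hQ
  have hQΩ : Q ⊆ Ω := (cylinder_subset_ball x r).trans hball
  have hxQ : x ∈ Q := ⟨Metric.mem_ball_self (half_pos hr), by constructor <;> linarith⟩
  have hQo : IsOpen Q := isOpen_cylinder _ _ _
  set c := Measure.hausdorffMeasure (m : ℝ) (Metric.ball (headCoords x) (r / 2)) with hc
  have hc0 : 0 < c := hausdorffMeasure_ball_pos _ (half_pos hr)
  have hbig : ∀ j, 0 < volume (Q ∩ P j) →
      c ≤ Measure.hausdorffMeasure (m : ℝ) (essBoundary (P j)) := by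
    intro j hj
    have hout : 0 < volume (Q \ P j) := by
      refine ((hQo.inter isClosed_closure.isOpen_compl).measure_pos volume
        ⟨x, hxQ, hcl j⟩).trans_le 
        (measure_mono fun z hz => ⟨hz.1, fun h => hz.2 (subset_closure h)⟩)
    obtain ⟨t, ht⟩ := exists_slice_subset_essBoundary (half_pos hr) (s := s)
      (fun z hz => hs ⟨mem_iUnion.2 ⟨j, hz.1⟩, hQΩ hz.2⟩) hj hout
    exact hausdorffMeasure_ge_of_disc_subset ht
  have hfin : {j | 0 < volume (Q ∩ P j)}.Finite :=
    (ENNReal.finite_const_le_of_tsum_ne_top hcac.perimeter.ne hc0.ne').subset hbig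
  -- a neighbourhood of `x` in the cylinder avoiding the finitely many relevant pieces
  have hO : IsOpen (Q ∩ ⋂ j ∈ {j | 0 < volume (Q ∩ P j)}, (closure (P j))ᶜ) :=
    hQo.inter (hfin.isOpen_biInter fun j _ => isClosed_closure.isOpen_compl)
  refine (hO.measure_pos volume ⟨x, hxQ, mem_iInter₂.2 fun j _ => hcl j⟩).ne' ?_
  refine measure_mono_null (t := (Ω \ ⋃ j, P j) ∪ ⋃ j ∈ {j | volume (Q ∩ P j) = 0}, (Q ∩ P j)) ?_
    (measure_union_null hcac.cover ((measure_biUnion_null_iff (to_countable _)).2 fun j hj => hj))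
  rintro z ⟨hzQ, hz⟩
  by_cases hzP : z ∈ ⋃ j, P j
  · obtain ⟨j, hj⟩ := mem_iUnion.1 hzP
    refine Or.inr (mem_iUnion₂.2 ⟨j, ?_, hzQ, hj⟩)
    by_contra h0
    exact mem_iInter₂.1 hz j (pos_iff_ne_zero.2 h0) (subset_closure hj)
  · exact Or.inl ⟨hQΩ hzQ, hzP⟩

/-! ### Limit gradients are constant inside the pieces of the partition -/

lemma continuous_frob {d : ℕ} : Continuous (frob (d := d)) := by
  refine (PiLp.continuous_toLp 2 _).comp (continuous_pi fun i => ?_)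
  fun_prop

lemma aestronglyMeasurable_frob {d : ℕ} {μ : Measure (Euc d)} {G : Euc d → Mat d}
    (hG : ∀ i j, AEStronglyMeasurable (fun x => G x i j) μ) :
    AEStronglyMeasurable (fun x => frob (G x)) μ := by
  refine AEMeasurable.aestronglyMeasurable ?_
  refine (WithLp.measurable_toLp 2 _).comp_aemeasurable (aemeasurable_pi_lambda _ fun ij => ?_)
  exact (hG ij.1 ij.2).aemeasurable

lemma HasMatBVDeriv.aestronglyMeasurable_frob {d : ℕ} {Ω : Set (Euc d)} {G : Euc d → Mat d}
    {μ : Fin d → Fin d → Fin d → SignedMeasure (Euc d)} (h : HasMatBVDeriv Ω G μ) :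
    AEStronglyMeasurable (fun x => frob (G x)) (volume.restrict Ω) :=
  _root_.aestronglyMeasurable_frob fun i j => (h i j).1.aestronglyMeasurable

lemma phaseMap_eq_of_mem {d : ℕ} {R : Mat d} {P : ℕ → Set (Euc d)} {M : ℕ → Mat d} {x : Euc d}
    {j : ℕ} (hj : x ∈ P j) (hne : ∀ i, i ≠ j → x ∉ P i) : phaseMap R P M x = R * M j := by
  rw [phaseMap, tsum_eq_single j fun i hi => indicator_of_notMem (hne i hi) _,
    indicator_of_mem hj]

lemma IsCaccioppoliPartition.ae_notMem_of_ne {m : ℕ} {Ω : Set (Euc (m + 1))}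
    {P : ℕ → Set (Euc (m + 1))} (hP : IsCaccioppoliPartition Ω P) (j : ℕ) :
    ∀ᵐ x : Euc (m + 1), x ∈ P j → ∀ i, i ≠ j → x ∉ P i := by
  have : ∀ᵐ x : Euc (m + 1), ∀ i, i ≠ j → ¬ (x ∈ P i ∧ x ∈ P j) := by
    rw [ae_all_iff]
    intro i
    by_cases hij : i = j
    · simp [hij]
    · filter_upwards [measure_eq_zero_iff_ae_notMem.1 (hP.disjoint i j hij)] with x hx _ using hx
  filter_upwards [this] with x hx hxj i hi hxi using hx i hi ⟨hxi, hxj⟩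

/-- On each piece of the limit partition the limit gradient is a.e. constant: there the piecewise
constant maps converge in measure to a constant along a subsequence on which the phase is fixed. -/
lemma IsAdmissibleQuadruple.grad_ae_const {m : ℕ} {Ω : Set (Euc (m + 1))} {κ p : ℝ} {ε : ℕ → ℝ}
    {yn : ℕ → Euc (m + 1) → Euc (m + 1)} {Rn : ℕ → Mat (m + 1)} {Pn : ℕ → ℕ → Set (Euc (m + 1))}
    {Mn : ℕ → ℕ → Mat (m + 1)} {tn : ℕ → ℕ → Euc (m + 1)} {y u : Euc (m + 1) → Euc (m + 1)}
    {P : ℕ → Set (Euc (m + 1))} (hq : IsAdmissibleQuadruple Ω κ p ε yn Rn Pn Mn tn y u P)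
    {j : ℕ} {S : Set (Euc (m + 1))} (hS : NullMeasurableSet S) (hSΩ : S ⊆ Ω) (hSP : S ⊆ P j) :
    ∃ c, ∀ᵐ z ∂(volume.restrict S), frob (weakGrad Ω y z) = c := by
  obtain ⟨R, -, -, hR⟩ := hq.limit_deformation
  -- along a subsequence the phase of the `j`-th piece is constant
  obtain ⟨L, φ, hφ, hML⟩ : ∃ L, ∃ φ : ℕ → ℕ, StrictMono φ ∧ ∀ n, Mn (φ n) j = L := by
    have hf : ∃ᶠ n in atTop, Mn n j = 1 ∨ Mn n j = wellB m κ :=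
      (Eventually.of_forall fun n => hq.phases n j).frequently
    rcases frequently_or_distrib.1 hf with h | h
    · obtain ⟨φ, h1, h2⟩ := extraction_of_frequently_atTop h
      exact ⟨1, φ, h1, h2⟩
    · obtain ⟨φ, h1, h2⟩ := extraction_of_frequently_atTop h
      exact ⟨_, φ, h1, h2⟩
  refine ⟨frob (R * L), ?_⟩
  obtain ⟨hL1, μn, μ₀, hμn, hμ₀, -⟩ := hq.tendsto_phases
  have hle : volume.restrict S ≤ volume.restrict Ω := Measure.restrict_mono hSΩ le_rfl
  have h1 : TendstoInMeasure (volume.restrict S)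
      (fun n z => frob (phaseMap (Rn (φ n)) (Pn (φ n)) (Mn (φ n)) z)) atTop
      (fun z => frob (weakGrad Ω y z)) := by
    refine tendstoInMeasure_of_tendsto_eLpNorm one_ne_zero
      (fun n => (hμn (φ n)).aestronglyMeasurable_frob.mono_measure hle)
      (hμ₀.aestronglyMeasurable_frob.mono_measure hle) ?_
    refine tendsto_of_tendsto_of_tendsto_of_le_of_le tendsto_const_nhds
      (hL1.comp hφ.tendsto_atTop) (fun _ => zero_le) fun n => ?_
    refine (eLpNorm_mono_measure _ hle).trans (le_of_eq ?_)
    congr 1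
  have h2 : TendstoInMeasure (volume.restrict S)
      (fun n z => frob (phaseMap (Rn (φ n)) (Pn (φ n)) (Mn (φ n)) z)) atTop
      (fun _ => frob (R * L)) := by
    intro δ hδ
    have hlim : Tendsto (fun n => frob (Rn (φ n) * L)) atTop (𝓝 (frob (R * L))) :=
      (continuous_frob.tendsto _).comp
        (((continuous_id.matrix_mul continuous_const).tendsto R).comp (hR.comp hφ.tendsto_atTop))
    have hev : ∀ᶠ n in atTop, edist (frob (Rn (φ n) * L)) (frob (R * L)) < δ :=
      hlim (Metric.eball_mem_nhds _ hδ)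
    refine tendsto_of_tendsto_of_tendsto_of_le_of_le' tendsto_const_nhds
      ((hq.tendsto_sets j).comp hφ.tendsto_atTop) (Eventually.of_forall fun _ => zero_le) ?_
    filter_upwards [hev] with n hn
    refine (measure_mono_ae (t := symmDiff (Pn (φ n) j) (P j)) ?_).trans
      (Measure.restrict_apply_le _ _)
    filter_upwards [ae_restrict_of_ae ((hq.partitions (φ n)).ae_notMem_of_ne j),
      (ae_restrict_mem₀ hS : ∀ᵐ z ∂(volume.restrict S), z ∈ S)] with z hz hzS hzδ
    refine Or.inr ⟨hSP hzS, fun hzj => ?_⟩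
    have hzδ' : δ ≤ edist (frob (phaseMap (Rn (φ n)) (Pn (φ n)) (Mn (φ n)) z))
      (frob (R * L)) := hzδ
    rw [phaseMap_eq_of_mem hzj (hz hzj), hML] at hzδ'
    exact absurd hzδ' (not_le.2 hn)
  exact tendstoInMeasure_ae_unique h1 h2

/-- The gradient of the limit deformation jumps only on the boundaries of the limit partition. -/
theorem gradJumpSet_subset_of_isAdmissibleTriple {m : ℕ} {Ω : Set (Euc (m + 1))} (hΩ : IsOpen Ω)
    {κ p : ℝ} {ε : ℕ → ℝ} {yn : ℕ → Euc (m + 1) → Euc (m + 1)} {y u : Euc (m + 1) → Euc (m + 1)}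
    {P : ℕ → Set (Euc (m + 1))} (h : IsAdmissibleTriple Ω κ p ε yn y u P) :
    gradJumpSet Ω y ⊆ (⋃ j, frontier (P j)) ∩ Ω := by
  obtain ⟨Rn, Pn, Mn, tn, hq⟩ := h
  intro x hx
  refine ⟨?_, hx.1⟩
  by_contra hxP
  obtain ⟨j, hj⟩ := hq.limit_partition.exists_mem_interior hΩ hx.1
    fun j hj => hxP (mem_iUnion.2 ⟨j, hj⟩)
  obtain ⟨r, hr, hball⟩ := Metric.isOpen_iff.1 (isOpen_interior.inter hΩ) x ⟨hj, hx.1⟩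
  obtain ⟨c, hc⟩ := hq.grad_ae_const (S := Metric.ball x r)
    Metric.isOpen_ball.measurableSet.nullMeasurableSet (hball.trans inter_subset_right)
    ((hball.trans inter_subset_left).trans interior_subset)
  exact notMem_jumpSet_of_ae_eq hr hc hx

/-! ### Weak derivatives -/

lemma continuous_partialDeriv {d : ℕ} (k : Fin d) {f : Euc d → ℝ} (hf : ContDiff ℝ 1 f) :
    Continuous (partialDeriv k f) :=
  (hf.continuous_fderiv one_ne_zero).clm_apply continuous_const

lemma IsTestFunction.contDiff_one {d : ℕ} {Ω : Set (Euc d)} {φ : Euc d → ℝ}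
    (hφ : IsTestFunction Ω φ) : ContDiff ℝ 1 φ :=
  hφ.smooth.of_le (by exact_mod_cast le_top)

lemma IsTestFunction.apply_eq_zero {d : ℕ} {Ω : Set (Euc d)} {φ : Euc d → ℝ}
    (hφ : IsTestFunction Ω φ) {x : Euc d} (hx : x ∉ Ω) : φ x = 0 :=
  image_eq_zero_of_notMem_tsupport fun h => hx (hφ.support h)

lemma IsTestFunction.partialDeriv_eq_zero {d : ℕ} {Ω : Set (Euc d)} {φ : Euc d → ℝ}
    (hφ : IsTestFunction Ω φ) (k : Fin d) {x : Euc d} (hx : x ∉ Ω) : partialDeriv k φ x = 0 := by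
  rw [partialDeriv, fderiv_of_notMem_tsupport (𝕜 := ℝ) fun h => hx (hφ.support h)]
  rfl

lemma IsTestFunction.hasCompactSupport_partialDeriv {d : ℕ} {Ω : Set (Euc d)} {φ : Euc d → ℝ}
    (hφ : IsTestFunction Ω φ) (k : Fin d) : HasCompactSupport (partialDeriv k φ) :=
  (hφ.compact.fderiv (𝕜 := ℝ)).comp_left (g := fun L : Euc d →L[ℝ] ℝ =>
    L (EuclideanSpace.single k 1)) rfl

lemma IsTestFunction.integrable_partialDeriv {d : ℕ} {Ω : Set (Euc d)} {φ : Euc d → ℝ}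
    (hφ : IsTestFunction Ω φ) (k : Fin d) : Integrable (partialDeriv k φ) :=
  (continuous_partialDeriv k hφ.contDiff_one).integrable_of_hasCompactSupport
    (hφ.hasCompactSupport_partialDeriv k)

lemma HasWeakPartial.of_contDiff {d : ℕ} (Ω : Set (Euc d)) (k : Fin d) {f : Euc d → ℝ}
    (hf : ContDiff ℝ 1 f) : HasWeakPartial Ω k f (partialDeriv k f) := by
  refine ⟨hf.continuous.locallyIntegrable.locallyIntegrableOn _,
    (continuous_partialDeriv k hf).locallyIntegrable.locallyIntegrableOn _, fun φ hφ => ?_⟩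
  have hφ1 := hφ.contDiff_one
  rw [setIntegral_eq_integral_of_forall_compl_eq_zero
      fun x hx => by rw [hφ.partialDeriv_eq_zero k hx, mul_zero],
    setIntegral_eq_integral_of_forall_compl_eq_zero
      fun x hx => by rw [hφ.apply_eq_zero hx, mul_zero]]
  refine integral_mul_fderiv_eq_neg_fderiv_mul_of_integrable ?_ ?_ ?_
    (fun x _ => hf.differentiable one_ne_zero x) (fun x _ => hφ1.differentiable one_ne_zero x)
  · exact ((continuous_partialDeriv k hf).mul
      hφ1.continuous).integrable_of_hasCompactSupport hφ.compact.mul_left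
  · exact (hf.continuous.mul (continuous_partialDeriv k hφ1)).integrable_of_hasCompactSupport
      (hφ.hasCompactSupport_partialDeriv k).mul_left
  · exact (hf.continuous.mul hφ1.continuous).integrable_of_hasCompactSupport hφ.compact.mul_left

lemma locallyIntegrableOn_congr_ae {d : ℕ} {Ω : Set (Euc d)} {f g : Euc d → ℝ}
    (hf : LocallyIntegrableOn f Ω) (hfg : f =ᵐ[volume.restrict Ω] g) :
    LocallyIntegrableOn g Ω := by
  intro x hx
  obtain ⟨s, hs, hfs⟩ := hf x hx
  refine ⟨s ∩ Ω, inter_mem hs self_mem_nhdsWithin, ?_⟩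
  exact (hfs.mono_set inter_subset_left).congr_fun_ae
    (ae_mono (Measure.restrict_mono inter_subset_right le_rfl) hfg)

lemma HasWeakPartial.congr_left {d : ℕ} {Ω : Set (Euc d)} {k : Fin d} {f f' g : Euc d → ℝ}
    (h : HasWeakPartial Ω k f g) (hf : f =ᵐ[volume.restrict Ω] f') : HasWeakPartial Ω k f' g := by
  refine ⟨locallyIntegrableOn_congr_ae h.1 hf, h.2.1, fun φ hφ => ?_⟩
  rw [← h.2.2 φ hφ]
  refine integral_congr_ae ?_
  filter_upwards [hf] with x hx
  rw [hx]

/-- Weak derivatives are unique up to null sets. -/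
lemma HasWeakPartial.ae_eq {d : ℕ} {Ω : Set (Euc d)} (hΩ : IsOpen Ω) {k : Fin d}
    {f g g' : Euc d → ℝ} (h : HasWeakPartial Ω k f g) (h' : HasWeakPartial Ω k f g') :
    g =ᵐ[volume.restrict Ω] g' := by
  rw [EventuallyEq, ae_restrict_iff' hΩ.measurableSet]
  have hli : LocallyIntegrableOn (g - g') Ω := h.2.1.sub h'.2.1
  have := hΩ.ae_eq_zero_of_integral_contDiff_smul_eq_zero hli fun φ h1 h2 h3 => ?_
  · filter_upwards [this] with x hx hxΩ
    exact sub_eq_zero.1 (hx hxΩ)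
  have hφ : IsTestFunction Ω φ := ⟨h1, h2, h3⟩
  have hint : ∀ G : Euc d → ℝ, LocallyIntegrableOn G Ω →
      IntegrableOn (fun x => G x * φ x) Ω := by
    intro G hG
    have := (hG.integrableOn_compact_subset h3 h2).mul_continuousOn
      h1.continuous.continuousOn h2
    exact ((integrableOn_iff_integrable_of_support_subset (f := fun x => G x * φ x)
      (fun x hx => subset_tsupport _ (right_ne_zero_of_mul hx))).1 this).integrableOn
  have e1 := h.2.2 φ hφ
  have e2 := h'.2.2 φ hφ
  rw [← setIntegral_eq_integral_of_forall_compl_eq_zero (s := Ω)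
    fun x hx => by rw [hφ.apply_eq_zero hx, zero_smul]]
  calc ∫ x in Ω, φ x • (g - g') x = ∫ x in Ω, (g x * φ x - g' x * φ x) := by
        refine integral_congr_ae (ae_of_all _ fun x => ?_)
        simp only [Pi.sub_apply, smul_eq_mul]; ring
    _ = 0 := by
        rw [integral_sub (hint g h.2.1) (hint g' h'.2.1)]
        linarith

lemma HasWeakPartial.weakPartial_ae_eq {d : ℕ} {Ω : Set (Euc d)} (hΩ : IsOpen Ω) {k : Fin d}
    {f g : Euc d → ℝ} (h : HasWeakPartial Ω k f g) :
    weakPartial Ω k f =ᵐ[volume.restrict Ω] g := by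
  have hex : ∃ g, HasWeakPartial Ω k f g := ⟨g, h⟩
  rw [weakPartial, dif_pos hex]
  exact hex.choose_spec.ae_eq hΩ h

/-! ### Uniqueness of the approximate gradient -/

lemma matAct_sub_left {d : ℕ} (L L' : Mat d) (x : Euc d) :
    matAct (L - L') x = matAct L x - matAct L' x := by
  ext i; simp [matAct, Matrix.sub_mulVec]

lemma matAct_single {d : ℕ} (L : Mat d) (i j : Fin d) :
    matAct L (EuclideanSpace.single j 1) i = L i j := by
  simp [matAct]

/-- The linear map given by a matrix. -/
def matCLM {d : ℕ} (L : Mat d) : Euc d →L[ℝ] Euc d :=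
  LinearMap.toContinuousLinearMap
    { toFun := matAct L
      map_add' := fun x y => by ext i; simp [matAct, Matrix.mulVec_add]
      map_smul' := fun c x => by ext i; simp [matAct, Matrix.mulVec_smul] }

@[simp] lemma matCLM_apply {d : ℕ} (L : Mat d) (x : Euc d) : matCLM L x = matAct L x := rfl

lemma HasApproxGrad.unique {d : ℕ} {u : Euc d → Euc d} {x a a' : Euc d} {L L' : Mat d}
    (h : HasApproxGrad u x a L) (h' : HasApproxGrad u x a' L') : L = L' := by
  by_contra hne
  set Λ := matCLM (L - L') with hΛ
  -- a unit vector not annihilated by `L - L'`, with the sign which excludes cancellation with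
  -- the constant term
  obtain ⟨w, hw, hΛw, hsign⟩ : ∃ w : Euc d, ‖w‖ = 1 ∧ Λ w ≠ 0 ∧ 0 ≤ inner ℝ (a - a') (Λ w) := by
    obtain ⟨i, j, hij⟩ : ∃ i j, (L - L') i j ≠ 0 := by
      by_contra! hall
      exact hne (sub_eq_zero.1 (Matrix.ext hall))
    have h0 : Λ (EuclideanSpace.single j 1) ≠ 0 := by
      intro h0
      refine hij ((matAct_single (L - L') i j).symm.trans ?_)
      change (Λ (EuclideanSpace.single j 1)) i = 0
      rw [h0]; rfl
    rcases le_total 0 (inner ℝ (a - a') (Λ (EuclideanSpace.single j 1))) with hs | hs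
    · exact ⟨_, by simp, h0, hs⟩
    · exact ⟨-EuclideanSpace.single j 1, by simp, by simpa using h0, by simpa using hs⟩
  have hN : 0 < ‖Λ w‖ := norm_pos_iff.2 hΛw
  have hNΛ : ‖Λ w‖ ≤ ‖Λ‖ := by simpa [hw] using Λ.le_opNorm w
  have hΛ0 : 0 < ‖Λ‖ := hN.trans_le hNΛ
  set c := ‖Λ w‖ / (4 * ‖Λ‖) with hc
  have hc0 : 0 < c := by positivity
  have hc1 : c ≤ 1 / 4 := by
    rw [hc, div_le_iff₀ (by positivity)]; linarith
  have hcΛ : c * ‖Λ‖ = ‖Λ w‖ / 4 := by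
    rw [hc]; field_simp
  set δ := ‖Λ w‖ / 8 with hδ
  have hlim := (h δ (by positivity)).add (h' δ (by positivity))
  rw [add_zero] at hlim
  have hlow : ∀ᶠ ρ in 𝓝[>] (0 : ℝ), ENNReal.ofReal (c ^ d) ≤
      volume (Metric.ball x ρ ∩ {z | δ * ‖z - x‖ < ‖u z - a - matAct L (z - x)‖})
        / volume (Metric.ball x ρ) +
      volume (Metric.ball x ρ ∩ {z | δ * ‖z - x‖ < ‖u z - a' - matAct L' (z - x)‖})
        / volume (Metric.ball x ρ) := by
    filter_upwards [self_mem_nhdsWithin] with ρ hρ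
    have hρ : 0 < ρ := hρ
    rw [← ENNReal.add_div, ENNReal.le_div_iff_mul_le
      (Or.inl (Metric.measure_ball_pos _ _ hρ).ne') (Or.inl measure_ball_lt_top.ne)]
    refine le_trans (le_of_eq ?_) ((measure_mono
      (?_ : Metric.ball (x + (ρ / 2) • w) (c * ρ) ⊆ _)).trans (measure_union_le _ _))
    · rw [Measure.addHaar_ball_of_pos _ x hρ,
        Measure.addHaar_ball_of_pos _ (x + (ρ / 2) • w) (mul_pos hc0 hρ),
        finrank_euclideanSpace_fin, ← mul_assoc, ← ENNReal.ofReal_mul (by positivity), ← mul_pow]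
    · intro z hz
      rw [Metric.mem_ball, dist_eq_norm] at hz
      set e := z - (x + (ρ / 2) • w) with he
      have hd : z - x = e + (ρ / 2) • w := by rw [he]; abel
      have hzx : ‖z - x‖ < ρ := by
        rw [hd]
        refine (norm_add_le _ _).trans_lt ?_
        rw [norm_smul, hw, Real.norm_of_nonneg (by positivity)]
        nlinarith
      have hzb : z ∈ Metric.ball x ρ := by rwa [Metric.mem_ball, dist_eq_norm]
      have hbig : ρ / 4 * ‖Λ w‖ < ‖(a - a') + Λ (z - x)‖ := by
        have e1 : (a - a') + Λ (z - x) = ((a - a') + (ρ / 2) • Λ w) + Λ e := by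
          rw [hd, map_add, map_smul]; abel
        have e2 : ρ / 2 * ‖Λ w‖ ≤ ‖(a - a') + (ρ / 2) • Λ w‖ := by
          refine le_of_sq_le_sq ?_ (norm_nonneg _)
          rw [norm_add_sq_real, norm_smul, Real.norm_of_nonneg (by positivity), inner_smul_right]
          nlinarith [sq_nonneg ‖a - a'‖, mul_nonneg (half_pos hρ).le hsign]
        have e3 : ‖Λ e‖ < ‖Λ w‖ / 4 * ρ := by
          calc ‖Λ e‖ ≤ ‖Λ‖ * ‖e‖ := Λ.le_opNorm e
            _ < ‖Λ‖ * (c * ρ) := by gcongr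
            _ = ‖Λ w‖ / 4 * ρ := by rw [← hcΛ]; ring
        have e4 := norm_sub_le_norm_add ((a - a') + (ρ / 2) • Λ w) (Λ e)
        rw [e1]
        linarith
      by_contra hnot
      simp only [mem_union, mem_inter_iff, hzb, true_and, mem_ofPred_eq, not_or, not_lt] at hnot
      have e5 : (a - a') + Λ (z - x) =
          (u z - a' - matAct L' (z - x)) - (u z - a - matAct L (z - x)) := by
        rw [hΛ, matCLM_apply, matAct_sub_left]; abel
      have e6 := norm_sub_le (u z - a' - matAct L' (z - x)) (u z - a - matAct L (z - x))
      rw [← e5] at e6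
      have e7 : δ * ‖z - x‖ ≤ δ * ρ := by gcongr
      have e8 : δ * ρ = ρ / 8 * ‖Λ w‖ := by rw [hδ]; ring
      linarith [hnot.1, hnot.2]
  have := ge_of_tendsto hlim hlow
  rw [nonpos_iff_eq_zero, ENNReal.ofReal_eq_zero] at this
  exact absurd this (not_le.2 (by positivity))

lemma HasApproxGrad.of_hasFDerivAt {d : ℕ} {u v : Euc d → Euc d} {x : Euc d} {L : Mat d}
    (huv : u =ᶠ[𝓝 x] v) (hv : HasFDerivAt v (matCLM L) x) : HasApproxGrad u x (v x) L := by
  intro δ hδ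
  have hsmall := hv.isLittleO.def hδ
  obtain ⟨r, hr, hball⟩ := Metric.eventually_nhds_iff_ball.1 (huv.and hsmall)
  refine Tendsto.congr' ?_ tendsto_const_nhds
  filter_upwards [Ioo_mem_nhdsGT hr] with ρ hρ
  have : Metric.ball x ρ ∩ {z | δ * ‖z - x‖ < ‖u z - v x - matAct L (z - x)‖} = ∅ := by
    ext z
    simp only [mem_inter_iff, mem_ofPred_eq, mem_empty_iff_false, iff_false, not_and, not_lt]
    intro hz
    obtain ⟨h1, h2⟩ := hball z (Metric.ball_subset_ball hρ.2.le hz)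
    rw [h1]
    exact h2
  simp [this]

/-- Where a map coincides locally with a differentiable map, the approximate gradient is the
classical one. -/
lemma approxGrad_eq_of_hasFDerivAt {d : ℕ} {u v : Euc d → Euc d} {x : Euc d} {L : Mat d}
    (huv : u =ᶠ[𝓝 x] v) (hv : HasFDerivAt v (matCLM L) x) : approxGrad u x = L := by
  have h := HasApproxGrad.of_hasFDerivAt huv hv
  have hex : ∃ L, ∃ a, HasApproxGrad u x a L := ⟨L, _, h⟩
  rw [approxGrad, dif_pos hex]
  obtain ⟨a, ha⟩ := hex.choose_spec
  exact ha.unique h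

lemma approxGrad_zero {d : ℕ} (x : Euc d) : approxGrad (0 : Euc d → Euc d) x = 0 := by
  refine approxGrad_eq_of_hasFDerivAt (v := 0) EventuallyEq.rfl ?_
  have : matCLM (0 : Mat d) = 0 := by ext; simp [matAct]
  rw [this]
  exact hasFDerivAt_zero x

/-! ### The derivative of the indicator function of a layer -/

lemma continuous_joinCoords_left {m : ℕ} (t : ℝ) : Continuous fun v : Euc m => joinCoords v t :=
  (isometry_joinCoords t).continuous

/-- The `m`-dimensional Lebesgue measure on the slice of `Ω` at height `t`. -/
def sliceMeasure {m : ℕ} (Ω : Set (Euc (m + 1))) (t : ℝ) : Measure (Euc (m + 1)) :=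
  ((volume : Measure (Euc m)).map fun v => joinCoords v t).restrict Ω

lemma isFiniteMeasure_sliceMeasure {m : ℕ} {Ω : Set (Euc (m + 1))} (hΩ : Bornology.IsBounded Ω)
    (t : ℝ) : IsFiniteMeasure (sliceMeasure Ω t) := by
  obtain ⟨r, hr⟩ := hΩ.subset_closedBall 0
  refine ⟨?_⟩
  rw [sliceMeasure, Measure.restrict_apply_univ]
  refine (measure_mono hr).trans_lt ?_
  rw [Measure.map_apply (continuous_joinCoords_left t).measurable
    Metric.isClosed_closedBall.measurableSet]
  refine (measure_mono (t := Metric.closedBall (0 : Euc m) r) fun v hv => ?_).trans_lt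
    measure_closedBall_lt_top
  have := norm_headCoords_le (joinCoords v t)
  have h2 : joinCoords v t ∈ Metric.closedBall 0 r := hv
  simp only [Metric.mem_closedBall, dist_zero_right, headCoords_joinCoords] at *
  exact this.trans h2

/-- The slice measure as a signed measure. -/
def sliceSigned {m : ℕ} {Ω : Set (Euc (m + 1))} (hΩ : Bornology.IsBounded Ω) (t : ℝ) :
    SignedMeasure (Euc (m + 1)) :=
  haveI := isFiniteMeasure_sliceMeasure hΩ t
  (sliceMeasure Ω t).toSignedMeasure

lemma integrable_sliceMeasure {m : ℕ} {Ω : Set (Euc (m + 1))} (hΩo : IsOpen Ω)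
    (hΩ : Bornology.IsBounded Ω)
    (t : ℝ) {φ : Euc (m + 1) → ℝ} (hφ : Continuous φ) : Integrable φ (sliceMeasure Ω t) := by
  have := isFiniteMeasure_sliceMeasure hΩ t
  have hfin : ((volume : Measure (Euc m)).map fun v => joinCoords v t) Ω < ⊤ := by
    have h := measure_lt_top (sliceMeasure Ω t) univ
    rwa [sliceMeasure, Measure.restrict_apply_univ] at h
  obtain ⟨C, hC⟩ := hΩ.isCompact_closure.exists_bound_of_continuousOn hφ.continuousOn
  refine IntegrableOn.of_bound hfin hφ.aestronglyMeasurable C ?_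
  exact ae_restrict_of_forall_mem hΩo.measurableSet fun x hx => hC x (subset_closure hx)

lemma integral_sliceMeasure {m : ℕ} {Ω : Set (Euc (m + 1))} (t : ℝ)
    {φ : Euc (m + 1) → ℝ} (hφ : Continuous φ) (h0 : ∀ x ∉ Ω, φ x = 0) :
    ∫ x, φ x ∂(sliceMeasure Ω t) = ∫ v : Euc m, φ (joinCoords v t) := by
  rw [sliceMeasure, setIntegral_eq_integral_of_forall_compl_eq_zero h0,
    integral_map (continuous_joinCoords_left t).aemeasurable hφ.aestronglyMeasurable]

/-- The `e_d`-derivative of `s` times the indicator function of the layer `{a ≤ x_d < b}`. -/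
def layerDeriv {m : ℕ} {Ω : Set (Euc (m + 1))} (hΩ : Bornology.IsBounded Ω) (s a b : ℝ) :
    SignedMeasure (Euc (m + 1)) :=
  s • (sliceSigned hΩ a - sliceSigned hΩ b)

lemma totalVariation_eq_zero_of_forall {α : Type*} [MeasurableSpace α] {μ : SignedMeasure α}
    {S : Set α} (hS : MeasurableSet S) (h : ∀ T ⊆ S, MeasurableSet T → μ T = 0) :
    μ.totalVariation S = 0 := by
  obtain ⟨i, hi₁, hi₂, hi₃, hpos, hneg⟩ := μ.toJordanDecomposition_spec
  rw [SignedMeasure.totalVariation, Measure.add_apply, hpos, hneg,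
    SignedMeasure.toMeasureOfZeroLE_apply _ _ _ hS, SignedMeasure.toMeasureOfLEZero_apply _ _ _ hS]
  simp [h _ inter_subset_right (hi₁.inter hS), h _ inter_subset_right (hi₁.compl.inter hS)]

lemma sliceSigned_apply_eq_zero {m : ℕ} {Ω : Set (Euc (m + 1))} (hΩ : Bornology.IsBounded Ω)
    (t : ℝ) {T : Set (Euc (m + 1))} (hT : MeasurableSet T) (h : T ⊆ Ωᶜ) :
    sliceSigned hΩ t T = 0 := by
  have := isFiniteMeasure_sliceMeasure hΩ t
  rw [sliceSigned, Measure.toSignedMeasure_apply_measurable hT, Measure.real, sliceMeasure,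
    Measure.restrict_apply hT]
  have : T ∩ Ω = ∅ := by
    ext z; simp only [mem_inter_iff, mem_empty_iff_false, iff_false, not_and]
    exact fun hz hzΩ => h hz hzΩ
  simp [this]

lemma layerDeriv_totalVariation_compl {m : ℕ} {Ω : Set (Euc (m + 1))} (hΩo : IsOpen Ω)
    (hΩ : Bornology.IsBounded Ω) (s a b : ℝ) : (layerDeriv hΩ s a b).totalVariation Ωᶜ = 0 := by
  refine totalVariation_eq_zero_of_forall hΩo.measurableSet.compl fun T hT hTm => ?_
  simp [layerDeriv, sliceSigned_apply_eq_zero hΩ _ hTm hT]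

lemma integral_layerDeriv {m : ℕ} {Ω : Set (Euc (m + 1))} (hΩo : IsOpen Ω)
    (hΩ : Bornology.IsBounded Ω) (s a b : ℝ) {φ : Euc (m + 1) → ℝ} (hφ : Continuous φ)
    (h0 : ∀ x ∉ Ω, φ x = 0) :
    ∫ᵛ x, φ x ∂<•(layerDeriv hΩ s a b) =
      s * ((∫ v : Euc m, φ (joinCoords v a)) - ∫ v : Euc m, φ (joinCoords v b)) := by
  have ha := isFiniteMeasure_sliceMeasure hΩ a
  have hb := isFiniteMeasure_sliceMeasure hΩ b
  rw [layerDeriv, VectorMeasure.integral_smul_vectorMeasure,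
    VectorMeasure.integral_sub_vectorMeasure, sliceSigned, sliceSigned,
    VectorMeasure.integral_toSignedMeasure, VectorMeasure.integral_toSignedMeasure,
    integral_sliceMeasure a hφ h0, integral_sliceMeasure b hφ h0, smul_eq_mul]
  · rw [VectorMeasure.Integrable, sliceSigned, Measure.variation_toSignedMeasure]
    exact integrable_sliceMeasure hΩo hΩ a hφ
  · rw [VectorMeasure.Integrable, sliceSigned, Measure.variation_toSignedMeasure]
    exact integrable_sliceMeasure hΩo hΩ b hφ

lemma joinCoords_eq_add {m : ℕ} (v : Euc m) (t : ℝ) :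
    joinCoords v t = joinCoords v 0 + t • EuclideanSpace.single (Fin.last m) (1 : ℝ) := by
  ext i
  refine Fin.lastCases ?_ (fun j => ?_) i <;> simp

lemma hasDerivAt_comp_joinCoords {m : ℕ} {φ : Euc (m + 1) → ℝ} (hφ : Differentiable ℝ φ)
    (v : Euc m) (t : ℝ) :
    HasDerivAt (fun s => φ (joinCoords v s)) (partialDeriv (Fin.last m) φ (joinCoords v t)) t := by
  have h1 : HasDerivAt (fun s => joinCoords v s)
      (EuclideanSpace.single (Fin.last m) (1 : ℝ)) t := by
    rw [show (fun s => joinCoords v s) = fun s => joinCoords v 0 +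
      s • EuclideanSpace.single (Fin.last m) (1 : ℝ) from funext (joinCoords_eq_add v)]
    simpa using ((hasDerivAt_id t).smul_const
      (EuclideanSpace.single (Fin.last m) (1 : ℝ))).const_add (joinCoords v 0)
  exact (hφ (joinCoords v t)).hasFDerivAt.comp_hasDerivAt t h1

/-- The indicator function of `{a ≤ x_d < b}`. -/
def layerInd {m : ℕ} (a b : ℝ) (x : Euc (m + 1)) : ℝ :=
  (Ico a b).indicator 1 (x (Fin.last m))

lemma measurable_layerInd {m : ℕ} (a b : ℝ) : Measurable (layerInd (m := m) a b) :=
  (measurable_one.indicator measurableSet_Ico).comp continuous_last.measurable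

lemma norm_layerInd_le {m : ℕ} (a b : ℝ) (x : Euc (m + 1)) : ‖layerInd a b x‖ ≤ 1 := by
  unfold layerInd indicator
  split_ifs <;> simp

/-- The derivative of the indicator function of a layer in the direction `e_d`: on each vertical
line this is the fundamental theorem of calculus. -/
lemma integral_layerInd_partialDeriv_last {m : ℕ} {Ω : Set (Euc (m + 1))} {a b : ℝ} (hab : a ≤ b)
    {φ : Euc (m + 1) → ℝ} (hφ : IsTestFunction Ω φ) :
    ∫ x in Ω, layerInd a b x * partialDeriv (Fin.last m) φ x =
      (∫ v : Euc m, φ (joinCoords v b)) - ∫ v : Euc m, φ (joinCoords v a) := by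
  have hφ1 := hφ.contDiff_one
  have hint : Integrable fun x => layerInd a b x * partialDeriv (Fin.last m) φ x :=
    (hφ.integrable_partialDeriv _).bdd_mul (measurable_layerInd a b).aestronglyMeasurable
      (ae_of_all _ (norm_layerInd_le a b))
  have hslice : ∀ t, Integrable fun v : Euc m => φ (joinCoords v t) := fun t =>
    (hφ1.continuous.comp (continuous_joinCoords_left t)).integrable_of_hasCompactSupport
      (hφ.compact.comp_isClosedEmbedding (isometry_joinCoords t).isClosedEmbedding)
  rw [setIntegral_eq_integral_of_forall_compl_eq_zero
    fun x hx => by rw [hφ.partialDeriv_eq_zero _ hx, mul_zero]]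
  have hmap := measurePreserving_joinCoords (m := m)
  rw [← hmap.map_eq] at hint ⊢
  rw [integral_map hmap.aemeasurable hint.aestronglyMeasurable]
  rw [integrable_map_measure hint.aestronglyMeasurable hmap.aemeasurable] at hint
  have hint' : Integrable (fun q : Euc m × ℝ => layerInd a b (joinCoords q.1 q.2) *
      partialDeriv (Fin.last m) φ (joinCoords q.1 q.2)) (volume.prod volume) := hint
  rw [integral_prod _ hint', ← integral_sub (hslice b) (hslice a)]
  refine integral_congr_ae (ae_of_all _ fun v => ?_)
  have hcont : Continuous fun t => partialDeriv (Fin.last m) φ (joinCoords v t) :=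
    (continuous_partialDeriv _ hφ1).comp
      (continuous_joinCoords.comp (Continuous.prodMk_right v))
  have hftc := intervalIntegral.integral_eq_sub_of_hasDerivAt (a := a) (b := b)
    (fun t _ => hasDerivAt_comp_joinCoords (hφ1.differentiable one_ne_zero) v t)
    (hcont.intervalIntegrable a b)
  rw [intervalIntegral.integral_of_le hab, ← integral_Ico_eq_integral_Ioc,
    ← integral_indicator measurableSet_Ico] at hftc
  simp only
  rw [← hftc]
  refine integral_congr_ae (ae_of_all _ fun t => ?_)
  simp only [layerInd, joinCoords_last, indicator]
  split_ifs <;> simp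

lemma integral_layerInd_partialDeriv_of_ne {m : ℕ} {Ω : Set (Euc (m + 1))} {a b : ℝ}
    {k : Fin (m + 1)} (hk : k ≠ Fin.last m) {φ : Euc (m + 1) → ℝ} (hφ : IsTestFunction Ω φ) :
    ∫ x in Ω, layerInd a b x * partialDeriv k φ x = 0 := by
  have hφ1 := hφ.contDiff_one
  rw [setIntegral_eq_integral_of_forall_compl_eq_zero
    fun x hx => by rw [hφ.partialDeriv_eq_zero _ hx, mul_zero]]
  have h := integral_bilinear_hasLineDerivAt_right_eq_neg_left_of_integrable
    (μ := (volume : Measure (Euc (m + 1)))) (B := ContinuousLinearMap.mul ℝ ℝ)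
    (f := layerInd a b) (f' := 0) (g := φ) (g' := partialDeriv k φ)
    (v := EuclideanSpace.single k (1 : ℝ)) (by simp)
    ((hφ.integrable_partialDeriv k).bdd_mul (measurable_layerInd a b).aestronglyMeasurable
      (ae_of_all _ (norm_layerInd_le a b)))
    ((hφ1.continuous.integrable_of_hasCompactSupport hφ.compact).bdd_mul
      (measurable_layerInd a b).aestronglyMeasurable (ae_of_all _ (norm_layerInd_le a b)))
    (fun x _ => ?_) (fun x _ => ?_)
  · simpa using h
  · have : (fun t : ℝ => layerInd a b (x + t • EuclideanSpace.single k (1 : ℝ)))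
        = fun _ => layerInd a b x := by
      ext t; simp [layerInd, hk.symm]
    rw [HasLineDerivAt, this]
    exact hasDerivAt_const _ _
  · exact (hφ1.differentiable one_ne_zero x).hasFDerivAt.hasLineDerivAt _

lemma integral_const_mul_partialDeriv {d : ℕ} {Ω : Set (Euc d)} (c : ℝ) (k : Fin d)
    {φ : Euc d → ℝ} (hφ : IsTestFunction Ω φ) : ∫ x in Ω, c * partialDeriv k φ x = 0 := by
  have h := (HasWeakPartial.of_contDiff Ω k (f := fun _ => c) contDiff_const).2.2 φ hφ
  rw [h]
  simp [partialDeriv]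

/-! ### Laminate gradients as functions of bounded variation -/

/-- The uniaxial stretch `diag(1, …, 1, 1 + s)`; the wells are the stretches `0` and `κ`. -/
def stretch (m : ℕ) (s : ℝ) : Mat (m + 1) :=
  Matrix.diagonal fun i => if i = Fin.last m then 1 + s else 1

lemma stretch_apply {m : ℕ} (s : ℝ) (i j : Fin (m + 1)) : stretch m s i j =
    (if i = j then 1 else 0) + if i = Fin.last m ∧ j = Fin.last m then s else 0 := by
  unfold stretch
  rw [Matrix.diagonal_apply]
  split_ifs <;> simp_all

lemma stretch_zero (m : ℕ) : stretch m 0 = 1 := by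
  ext i j
  simp [stretch_apply, Matrix.one_apply]

lemma stretch_kappa (m : ℕ) (κ : ℝ) : stretch m κ = wellB m κ := rfl

/-- The derivative of the laminate gradient which is `diag(1, …, 1, 1 + s)` in the layer
`{a ≤ x_d < b}` and the identity elsewhere: only the last entry varies, and only in direction
`e_d`. -/
def laminateDeriv {m : ℕ} {Ω : Set (Euc (m + 1))} (hΩ : Bornology.IsBounded Ω) (s a b : ℝ)
    (i j k : Fin (m + 1)) : SignedMeasure (Euc (m + 1)) :=
  if (i = Fin.last m ∧ j = Fin.last m) ∧ k = Fin.last m then layerDeriv hΩ s a b else 0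

lemma integral_laminateDeriv {m : ℕ} {Ω : Set (Euc (m + 1))} (hΩo : IsOpen Ω)
    (hΩ : Bornology.IsBounded Ω) (s a b : ℝ) {φ : Euc (m + 1) → ℝ} (hφ : Continuous φ)
    (h0 : ∀ x ∉ Ω, φ x = 0) (i j k : Fin (m + 1)) :
    ∫ᵛ x, φ x ∂<•(laminateDeriv hΩ s a b i j k) =
      if (i = Fin.last m ∧ j = Fin.last m) ∧ k = Fin.last m then
        s * ((∫ v : Euc m, φ (joinCoords v a)) - ∫ v : Euc m, φ (joinCoords v b)) else 0 := by
  unfold laminateDeriv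
  split_ifs
  · exact integral_layerDeriv hΩo hΩ s a b hφ h0
  · exact VectorMeasure.integral_zero_vectorMeasure

lemma hasMatBVDeriv_laminate {m : ℕ} {Ω : Set (Euc (m + 1))} (hΩo : IsOpen Ω)
    (hΩ : Bornology.IsBounded Ω) (s : ℝ) {a b : ℝ} (hab : a ≤ b) {G : Euc (m + 1) → Mat (m + 1)}
    (hG : ∀ᵐ x ∂(volume.restrict Ω), G x = stretch m (s * layerInd a b x)) :
    HasMatBVDeriv Ω G (laminateDeriv hΩ s a b) := by
  have hfin : volume Ω ≠ ⊤ := hΩ.measure_lt_top.ne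
  intro i j
  have hGij : (fun x => G x i j) =ᵐ[volume.restrict Ω] fun x => (if i = j then 1 else 0) +
      if i = Fin.last m ∧ j = Fin.last m then s * layerInd a b x else 0 := by
    filter_upwards [hG] with x hx
    rw [hx, stretch_apply]
  have hI : IntegrableOn (layerInd a b) Ω :=
    IntegrableOn.of_bound hΩ.measure_lt_top (measurable_layerInd a b).aestronglyMeasurable 1
      (ae_of_all _ (norm_layerInd_le a b))
  refine ⟨?_, fun k => ⟨?_, fun φ hφ => ?_⟩⟩
  · refine Integrable.congr ?_ hGij.symm
    refine (integrableOn_const hfin).add ?_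
    split_ifs
    · exact hI.const_mul s
    · exact integrable_zero _ _ _
  · unfold laminateDeriv
    split_ifs
    · exact layerDeriv_totalVariation_compl hΩo hΩ s a b
    · simp [SignedMeasure.totalVariation_zero]
  · rw [integral_laminateDeriv hΩo hΩ s a b hφ.smooth.continuous fun x hx => hφ.apply_eq_zero hx]
    have e : ∫ x in Ω, G x i j * partialDeriv k φ x = ∫ x in Ω,
        ((if i = j then 1 else 0) * partialDeriv k φ x +
          (if i = Fin.last m ∧ j = Fin.last m then s else 0) *
            (layerInd a b x * partialDeriv k φ x)) := by
      refine integral_congr_ae ?_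
      filter_upwards [hGij] with x hx
      rw [hx]
      split_ifs <;> ring
    have i1 : IntegrableOn (partialDeriv k φ) Ω := (hφ.integrable_partialDeriv k).integrableOn
    have i2 : IntegrableOn (fun x => layerInd a b x * partialDeriv k φ x) Ω :=
      i1.bdd_mul (measurable_layerInd a b).aestronglyMeasurable (ae_of_all _ (norm_layerInd_le a b))
    rw [e, integral_add (i1.const_mul _) (i2.const_mul _), integral_const_mul_partialDeriv _ k hφ,
      zero_add, integral_const_mul]
    by_cases hk : k = Fin.last m
    · subst hk
      rw [integral_layerInd_partialDeriv_last hab hφ]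
      split_ifs <;> (simp_all <;> ring)
    · rw [integral_layerInd_partialDeriv_of_ne hk hφ]
      simp [hk]

/-- The derivatives of layers whose thickness tends to zero converge weakly* to zero. -/
lemma tendsto_integral_laminateDeriv {m : ℕ} {Ω : Set (Euc (m + 1))} (hΩo : IsOpen Ω)
    (hΩ : Bornology.IsBounded Ω) (s a : ℝ) {b : ℕ → ℝ} (hb : Tendsto b atTop (𝓝 a))
    {φ : Euc (m + 1) → ℝ} (hφ : Continuous φ) (h0 : ∀ x ∉ Ω, φ x = 0) (i j k : Fin (m + 1)) :
    Tendsto (fun n => ∫ᵛ x, φ x ∂<•(laminateDeriv hΩ s a (b n) i j k)) atTop (𝓝 0) := by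
  simp_rw [integral_laminateDeriv hΩo hΩ _ _ _ hφ h0]
  split_ifs
  swap
  · exact tendsto_const_nhds
  obtain ⟨r, hr⟩ := hΩ.subset_closedBall 0
  have hball : ∀ t, ∫ v : Euc m, φ (joinCoords v t) =
      ∫ v in Metric.closedBall (0 : Euc m) r, φ (joinCoords v t) := by
    intro t
    rw [setIntegral_eq_integral_of_forall_compl_eq_zero]
    intro v hv
    refine h0 _ fun hmem => hv ?_
    have := norm_headCoords_le (joinCoords v t)
    have h2 := hr hmem
    simp only [Metric.mem_closedBall, dist_zero_right, headCoords_joinCoords] at *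
    exact this.trans h2
  have hcont : Continuous fun t : ℝ => ∫ v : Euc m, φ (joinCoords v t) := by
    simp_rw [hball]
    exact continuous_parametric_integral_of_continuous
      (f := fun (t : ℝ) (v : Euc m) => φ (joinCoords v t))
      (hφ.comp (continuous_joinCoords.comp continuous_swap)) (isCompact_closedBall _ _)
  have := ((tendsto_const_nhds (x := ∫ v : Euc m, φ (joinCoords v a))).sub
    ((hcont.tendsto a).comp hb)).const_mul s
  simpa using this

/-! ### The smoothed profile of a thin layer -/

/-- A primitive of the smooth transition from `0` to `1` on `[0, 1]`: a smoothing of the positive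
part. -/
def smoothPos (s : ℝ) : ℝ := ∫ r in (0 : ℝ)..s, Real.smoothTransition r

lemma hasDerivAt_smoothPos (s : ℝ) : HasDerivAt smoothPos (Real.smoothTransition s) s :=
  intervalIntegral.integral_hasDerivAt_right
    (Real.smoothTransition.continuous.intervalIntegrable _ _)
    (Real.smoothTransition.continuous.stronglyMeasurableAtFilter _ _)
    Real.smoothTransition.continuous.continuousAt

lemma abs_smoothPos_sub_le (s : ℝ) : |smoothPos s - max s 0| ≤ 1 := by
  have hc := Real.smoothTransition.continuous
  rcases le_total s 0 with hs | hs
  · have : smoothPos s = 0 := by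
      rw [smoothPos, intervalIntegral.integral_congr (g := fun _ => (0 : ℝ)),
        intervalIntegral.integral_zero]
      intro r hr
      rw [uIcc_of_ge hs] at hr
      exact Real.smoothTransition.zero_of_nonpos hr.2
    simp [this, hs]
  · have h1 : smoothPos s ≤ s := by
      have := intervalIntegral.integral_mono_on hs (hc.intervalIntegrable 0 s)
        (continuous_const.intervalIntegrable (μ := volume) 0 s) (g := fun _ => (1 : ℝ))
        fun r _ => Real.smoothTransition.le_one r
      simpa [smoothPos] using this
    have h2 : s - 1 ≤ smoothPos s := by
      rcases le_total s 1 with h | h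
      · have : 0 ≤ smoothPos s :=
          intervalIntegral.integral_nonneg hs fun r _ => Real.smoothTransition.nonneg r
        linarith
      · have e1 : smoothPos s = smoothPos 1 + ∫ r in (1 : ℝ)..s, Real.smoothTransition r :=
          (intervalIntegral.integral_add_adjacent_intervals (hc.intervalIntegrable _ _)
            (hc.intervalIntegrable _ _)).symm
        have e2 : 0 ≤ smoothPos 1 :=
          intervalIntegral.integral_nonneg zero_le_one fun r _ => Real.smoothTransition.nonneg r
        have e3 : ∫ r in (1 : ℝ)..s, Real.smoothTransition r = s - 1 := by
          rw [intervalIntegral.integral_congr (g := fun _ => (1 : ℝ))]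
          · simp
          · intro r hr
            rw [uIcc_of_le h] at hr
            exact Real.smoothTransition.one_of_one_le hr.1
        linarith
    rw [max_eq_left hs, abs_le]
    constructor <;> linarith

lemma deriv_smoothTransition_eq_zero {s : ℝ} (hs : s ∉ Icc (0 : ℝ) 1) :
    deriv Real.smoothTransition s = 0 := by
  rw [mem_Icc, not_and_or, not_le, not_le] at hs
  rcases hs with hs | hs
  · have : Real.smoothTransition =ᶠ[𝓝 s] fun _ => 0 := by
      filter_upwards [Iio_mem_nhds hs] with r hr
      exact Real.smoothTransition.zero_of_nonpos (le_of_lt hr)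
    rw [this.deriv_eq, deriv_const]
  · have : Real.smoothTransition =ᶠ[𝓝 s] fun _ => 1 := by
      filter_upwards [Ioi_mem_nhds hs] with r hr
      exact Real.smoothTransition.one_of_one_le (le_of_lt hr)
    rw [this.deriv_eq, deriv_const]

lemma exists_abs_deriv_smoothTransition_le :
    ∃ C : ℝ, 0 ≤ C ∧ ∀ s, |deriv Real.smoothTransition s| ≤ C := by
  have hcont : Continuous (deriv Real.smoothTransition) :=
    (Real.smoothTransition.contDiff (n := 1)).continuous_deriv le_rfl
  obtain ⟨C, hC⟩ := (isCompact_Icc (a := (0 : ℝ)) (b := 1)).exists_bound_of_continuousOn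
    hcont.continuousOn
  have hC0 : 0 ≤ C := (norm_nonneg _).trans (hC 0 ⟨le_rfl, zero_le_one⟩)
  refine ⟨C, hC0, fun s => ?_⟩
  by_cases hs : s ∈ Icc (0 : ℝ) 1
  · exact hC s hs
  · rw [deriv_smoothTransition_eq_zero hs, abs_zero]; exact hC0

/-- The primitive of a smoothed indicator function of `[a, a + δ)`, with transition zones of width
`η`. -/
def profile (a δ η t : ℝ) : ℝ :=
  η * smoothPos ((t - a) / η) - η * smoothPos ((t - (a + δ)) / η)

/-- The first derivative of `profile`. -/
def profileDeriv (a δ η t : ℝ) : ℝ :=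
  Real.smoothTransition ((t - a) / η) - Real.smoothTransition ((t - (a + δ)) / η)

/-- The second derivative of `profile`. -/
def profileDeriv2 (a δ η t : ℝ) : ℝ :=
  deriv Real.smoothTransition ((t - a) / η) / η -
    deriv Real.smoothTransition ((t - (a + δ)) / η) / η

/-- The transition zones of `profile`. -/
def transitionZone (a δ η : ℝ) : Set ℝ := Icc a (a + η) ∪ Icc (a + δ) (a + δ + η)

/-- The primitive of the indicator function of `[a, a + δ)`. -/
def clampLayer (a δ t : ℝ) : ℝ := max (t - a) 0 - max (t - (a + δ)) 0

section Profile

variable {a δ η : ℝ}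

lemma hasDerivAt_shift (a : ℝ) (η t : ℝ) : HasDerivAt (fun t => (t - a) / η) (1 / η) t :=
  ((hasDerivAt_id t).sub_const a).div_const η

lemma hasDerivAt_profile (hη : 0 < η) (t : ℝ) :
    HasDerivAt (profile a δ η) (profileDeriv a δ η t) t := by
  have h : ∀ b, HasDerivAt (fun t => η * smoothPos ((t - b) / η))
      (Real.smoothTransition ((t - b) / η)) t := by
    intro b
    have := ((hasDerivAt_smoothPos ((t - b) / η)).comp t (hasDerivAt_shift b η t)).const_mul η
    refine this.congr_deriv ?_
    field_simp
  exact (h a).sub (h (a + δ))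

lemma hasDerivAt_profileDeriv (t : ℝ) :
    HasDerivAt (profileDeriv a δ η) (profileDeriv2 a δ η t) t := by
  have h : ∀ b, HasDerivAt (fun t => Real.smoothTransition ((t - b) / η))
      (deriv Real.smoothTransition ((t - b) / η) / η) t := by
    intro b
    have h0 : HasDerivAt Real.smoothTransition (deriv Real.smoothTransition ((t - b) / η))
        ((t - b) / η) :=
      ((Real.smoothTransition.contDiff (n := 1)).differentiable one_ne_zero _).hasDerivAt
    refine (h0.comp t (hasDerivAt_shift b η t)).congr_deriv ?_
    ring
  exact (h a).sub (h (a + δ))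

lemma continuous_profileDeriv : Continuous (profileDeriv a δ η) :=
  continuous_iff_continuousAt.2 fun t => (hasDerivAt_profileDeriv t).continuousAt

lemma continuous_profileDeriv2 : Continuous (profileDeriv2 a δ η) := by
  have hcont : Continuous (deriv Real.smoothTransition) :=
    (Real.smoothTransition.contDiff (n := 1)).continuous_deriv le_rfl
  unfold profileDeriv2
  fun_prop

lemma contDiff_profile (hη : 0 < η) : ContDiff ℝ 1 (profile a δ η) := by
  rw [contDiff_one_iff_deriv]
  refine ⟨fun t => (hasDerivAt_profile hη t).differentiableAt, ?_⟩
  rw [show deriv (profile a δ η) = profileDeriv a δ η from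
    funext fun t => (hasDerivAt_profile hη t).deriv]
  exact continuous_profileDeriv

lemma contDiff_profileDeriv : ContDiff ℝ 1 (profileDeriv a δ η) := by
  rw [contDiff_one_iff_deriv]
  refine ⟨fun t => (hasDerivAt_profileDeriv t).differentiableAt, ?_⟩
  rw [show deriv (profileDeriv a δ η) = profileDeriv2 a δ η from
    funext fun t => (hasDerivAt_profileDeriv t).deriv]
  exact continuous_profileDeriv2

lemma smoothTransition_shift_le (hη : 0 < η) {t b : ℝ} (h : t ≤ b) :
    Real.smoothTransition ((t - b) / η) = 0 :=
  Real.smoothTransition.zero_of_nonpos (div_nonpos_of_nonpos_of_nonneg (by linarith) hη.le)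

lemma smoothTransition_shift_ge (hη : 0 < η) {t b : ℝ} (h : b + η ≤ t) :
    Real.smoothTransition ((t - b) / η) = 1 :=
  Real.smoothTransition.one_of_one_le ((one_le_div hη).2 (by linarith))

lemma profileDeriv_nonneg (hη : 0 < η) (hδ : 0 ≤ δ) (t : ℝ) : 0 ≤ profileDeriv a δ η t := by
  refine sub_nonneg.2 (Real.smoothTransition.monotone ?_)
  gcongr
  linarith

lemma profileDeriv_le_one (t : ℝ) : profileDeriv a δ η t ≤ 1 := by
  have h1 := Real.smoothTransition.le_one ((t - a) / η)
  have h2 := Real.smoothTransition.nonneg ((t - (a + δ)) / η)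
  unfold profileDeriv
  linarith

lemma profileDeriv_eq_indicator (hη : 0 < η) (hδ : 0 ≤ δ) {t : ℝ} (ht : t ∉ transitionZone a δ η) :
    profileDeriv a δ η t = (Ico a (a + δ)).indicator 1 t := by
  simp only [transitionZone, mem_union, mem_Icc, not_or, not_and_or, not_le] at ht
  unfold profileDeriv
  rcases lt_or_ge t a with h | h
  · rw [smoothTransition_shift_le hη h.le, smoothTransition_shift_le hη (by linarith),
      indicator_of_notMem fun h' => absurd h'.1 (not_le.2 h), sub_zero]
  · have h1 : a + η < t := ht.1.resolve_left (not_lt.2 h)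
    rw [smoothTransition_shift_ge hη h1.le]
    rcases lt_or_ge t (a + δ) with h2 | h2
    · rw [smoothTransition_shift_le hη h2.le,
        indicator_of_mem (show t ∈ Ico a (a + δ) from ⟨h, h2⟩)]
      simp
    · have h3 : a + δ + η < t := ht.2.resolve_left (not_lt.2 h2)
      rw [smoothTransition_shift_ge hη h3.le,
        indicator_of_notMem fun h' => absurd h'.2 (not_lt.2 h2),
        sub_self]

lemma profileDeriv2_eq_zero (hη : 0 < η) {t : ℝ} (ht : t ∉ transitionZone a δ η) :
    profileDeriv2 a δ η t = 0 := by
  have h : ∀ b, t ∉ Icc b (b + η) → deriv Real.smoothTransition ((t - b) / η) = 0 := by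
    intro b hb
    refine deriv_smoothTransition_eq_zero fun h => hb ⟨?_, ?_⟩
    · have := (le_div_iff₀ hη).1 h.1; linarith
    · have := (div_le_one hη).1 h.2; linarith
  simp only [transitionZone, mem_union, not_or] at ht
  rw [profileDeriv2, h a ht.1, h (a + δ) ht.2]
  simp

lemma abs_profile_sub_clampLayer_le (hη : 0 < η) (t : ℝ) :
    |profile a δ η t - clampLayer a δ t| ≤ 2 * η := by
  have h : ∀ b, |η * smoothPos ((t - b) / η) - max (t - b) 0| ≤ η := by
    intro b
    have e : max (t - b) 0 = η * max ((t - b) / η) 0 := by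
      rw [mul_max_of_nonneg _ _ hη.le, mul_zero, mul_div_cancel₀ _ hη.ne']
    rw [e, ← mul_sub, abs_mul, abs_of_pos hη]
    exact mul_le_of_le_one_right hη.le (abs_smoothPos_sub_le _)
  have e : profile a δ η t - clampLayer a δ t =
      (η * smoothPos ((t - a) / η) - max (t - a) 0) -
        (η * smoothPos ((t - (a + δ)) / η) - max (t - (a + δ)) 0) := by
    unfold profile clampLayer; ring
  rw [e]
  refine (abs_sub _ _).trans ?_
  linarith [h a, h (a + δ)]

lemma clampLayer_of_le (hδ : 0 ≤ δ) {t : ℝ} (h : t ≤ a) : clampLayer a δ t = 0 := by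
  rw [clampLayer, max_eq_right (by linarith), max_eq_right (by linarith), sub_zero]

lemma clampLayer_of_mem {t : ℝ} (h : t ∈ Ico a (a + δ)) : clampLayer a δ t = t - a := by
  rw [clampLayer, max_eq_left (by linarith [h.1]), max_eq_right (by linarith [h.2]), sub_zero]

lemma clampLayer_of_ge (hδ : 0 ≤ δ) {t : ℝ} (h : a + δ ≤ t) : clampLayer a δ t = δ := by
  rw [clampLayer, max_eq_left (by linarith), max_eq_left (by linarith)]; ring

lemma abs_clampLayer_le (hδ : 0 ≤ δ) (t : ℝ) : |clampLayer a δ t| ≤ δ := by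
  rcases lt_or_ge t a with h | h
  · rw [clampLayer_of_le hδ h.le]; simpa
  · rcases lt_or_ge t (a + δ) with h2 | h2
    · rw [clampLayer_of_mem ⟨h, h2⟩, abs_le]; constructor <;> linarith
    · rw [clampLayer_of_ge hδ h2, abs_of_nonneg hδ]

lemma hasDerivAt_clampLayer (hδ : 0 ≤ δ) {t : ℝ} (h1 : t ≠ a) (h2 : t ≠ a + δ) :
    HasDerivAt (clampLayer a δ) ((Ico a (a + δ)).indicator 1 t) t := by
  rcases lt_or_gt_of_ne h1 with h | h
  · rw [indicator_of_notMem fun h' => absurd h'.1 (not_le.2 h)]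
    refine (hasDerivAt_const t (0 : ℝ)).congr_of_eventuallyEq ?_
    filter_upwards [Iio_mem_nhds h] with s hs using clampLayer_of_le hδ (le_of_lt hs)
  · rcases lt_or_gt_of_ne h2 with h' | h'
    · rw [indicator_of_mem (show t ∈ Ico a (a + δ) from ⟨h.le, h'⟩)]
      refine ((hasDerivAt_id t).sub_const a).congr_of_eventuallyEq ?_
      filter_upwards [Ioo_mem_nhds h h'] with s hs using clampLayer_of_mem ⟨hs.1.le, hs.2⟩
    · rw [indicator_of_notMem fun h'' => absurd h''.2 (not_lt.2 h'.le)]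
      refine (hasDerivAt_const t δ).congr_of_eventuallyEq ?_
      filter_upwards [Ioi_mem_nhds h'] with s hs using clampLayer_of_ge hδ (le_of_lt hs)

lemma measurableSet_transitionZone : MeasurableSet (transitionZone a δ η) :=
  measurableSet_Icc.union measurableSet_Icc

lemma volume_transitionZone_le (hη : 0 < η) :
    volume (transitionZone a δ η) ≤ ENNReal.ofReal (2 * η) := by
  refine (measure_union_le _ _).trans (le_of_eq ?_)
  rw [Real.volume_Icc, Real.volume_Icc, ← ENNReal.ofReal_add (by linarith) (by linarith)]
  ring_nf

end Profile

/-- The second derivative of the profile is of the order of the inverse transition width. -/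
lemma exists_abs_profileDeriv2_le :
    ∃ C : ℝ, 0 ≤ C ∧ ∀ a δ η t : ℝ, 0 < η → |profileDeriv2 a δ η t| ≤ C / η := by
  obtain ⟨C, hC0, hC⟩ := exists_abs_deriv_smoothTransition_le
  refine ⟨2 * C, by positivity, fun a δ η t hη => ?_⟩
  rw [profileDeriv2, ← sub_div, abs_div, abs_of_pos hη]
  gcongr
  refine (abs_sub _ _).trans ?_
  linarith [hC ((t - a) / η), hC ((t - (a + δ)) / η)]

/-! ### Deformations depending only on the height -/

/-- The unit vector `e_d`. -/
abbrev eLast (m : ℕ) : Euc (m + 1) := EuclideanSpace.single (Fin.last m) (1 : ℝ)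

/-- The coordinate functional `z ↦ z_j`. -/
def coordCLM {d : ℕ} (j : Fin d) : Euc d →L[ℝ] ℝ := EuclideanSpace.proj j

@[simp] lemma coordCLM_apply {d : ℕ} (j : Fin d) (z : Euc d) : coordCLM j z = z j := rfl

/-- The matrix `s e_d ⊗ e_d`. -/
def vert (m : ℕ) (s : ℝ) : Mat (m + 1) := Matrix.single (Fin.last m) (Fin.last m) s

lemma vert_apply {m : ℕ} (s : ℝ) (i j : Fin (m + 1)) :
    vert m s i j = if i = Fin.last m ∧ j = Fin.last m then s else 0 := by
  rw [vert, Matrix.single_apply]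
  simp only [eq_comm]

lemma stretch_sub_stretch {m : ℕ} (s t : ℝ) : stretch m s - stretch m t = vert m (s - t) := by
  ext i j
  rw [Matrix.sub_apply, stretch_apply, stretch_apply, vert_apply]
  split_ifs <;> ring

lemma norm_frob_vert {m : ℕ} (s : ℝ) : ‖frob (vert m s)‖ = |s| := by
  have : frob (vert m s) = EuclideanSpace.single (Fin.last m, Fin.last m) s := by
    ext ⟨i, j⟩
    simp [frob, vert_apply, Prod.ext_iff]
  rw [this]
  simp

lemma matAct_vert {m : ℕ} (s : ℝ) (w : Euc (m + 1)) :
    matAct (vert m s) w = (s * w (Fin.last m)) • eLast m := by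
  ext i
  simp only [matAct, Matrix.mulVec, dotProduct, vert_apply, PiLp.smul_apply]
  by_cases hi : i = Fin.last m
  · subst hi; simp
  · simp [hi]

lemma matAct_stretch {m : ℕ} (s : ℝ) (w : Euc (m + 1)) :
    matAct (stretch m s) w = w + (s * w (Fin.last m)) • eLast m := by
  have h : stretch m s = stretch m s - stretch m 0 + 1 := by rw [stretch_zero]; abel
  rw [h, stretch_sub_stretch, sub_zero, ← matAct_vert]
  ext i
  simp [matAct, Matrix.add_mulVec, add_comm]

lemma hasFDerivAt_vertical {m : ℕ} {h : ℝ → ℝ} {x : Euc (m + 1)} {s : ℝ}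
    (hh : HasDerivAt h s (x (Fin.last m))) :
    HasFDerivAt (fun z : Euc (m + 1) => h (z (Fin.last m)) • eLast m) (matCLM (vert m s)) x := by
  have h1 : HasFDerivAt (fun z : Euc (m + 1) => z (Fin.last m))
      (coordCLM (Fin.last m)) x :=
    (coordCLM (Fin.last m)).hasFDerivAt
  have h2 := (hh.comp_hasFDerivAt x h1).smul_const (eLast m)
  refine h2.congr_fderiv ?_
  ext1 w
  rw [matCLM_apply, matAct_vert]
  simp

/-- The deformation `z ↦ z + g(z_d) e_d + c`. -/
def layered {m : ℕ} (g : ℝ → ℝ) (c : Euc (m + 1)) (z : Euc (m + 1)) : Euc (m + 1) :=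
  z + g (z (Fin.last m)) • eLast m + c

lemma layered_apply {m : ℕ} (g : ℝ → ℝ) (c z : Euc (m + 1)) (i : Fin (m + 1)) :
    layered g c z i = z i + (if i = Fin.last m then g (z (Fin.last m)) else 0) + c i := by
  simp [layered]

lemma continuous_layered {m : ℕ} {g : ℝ → ℝ} (hg : Continuous g) (c : Euc (m + 1)) :
    Continuous (layered g c) := by
  unfold layered
  fun_prop

lemma contDiff_layered_apply {m : ℕ} {g : ℝ → ℝ} (hg : ContDiff ℝ 1 g) (c : Euc (m + 1))
    (i : Fin (m + 1)) : ContDiff ℝ 1 fun z => layered g c z i := by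
  simp only [layered_apply]
  have h : ∀ j : Fin (m + 1), ContDiff ℝ 1 fun z : Euc (m + 1) => z j := fun j =>
    (coordCLM j).contDiff
  refine ((h i).add ?_).add contDiff_const
  split_ifs
  · exact hg.comp (h _)
  · exact contDiff_const

lemma contDiff_stretch_apply {m : ℕ} {dg : ℝ → ℝ} (hg : ContDiff ℝ 1 dg) (i j : Fin (m + 1)) :
    ContDiff ℝ 1 fun z : Euc (m + 1) => stretch m (dg (z (Fin.last m))) i j := by
  simp only [stretch_apply]
  have h : ContDiff ℝ 1 fun z : Euc (m + 1) => z (Fin.last m) :=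
    (coordCLM (Fin.last m)).contDiff
  refine contDiff_const.add ?_
  split_ifs
  · exact hg.comp h
  · exact contDiff_const

lemma hasFDerivAt_layered {m : ℕ} {g : ℝ → ℝ} {x : Euc (m + 1)} {s : ℝ} (c : Euc (m + 1))
    (hg : HasDerivAt g s (x (Fin.last m))) :
    HasFDerivAt (layered g c) (matCLM (stretch m s)) x := by
  have h := ((hasFDerivAt_id x).add (hasFDerivAt_vertical hg)).add_const c
  refine h.congr_fderiv ?_
  ext1 w
  simp [matAct_stretch, matAct_vert]

lemma partialDeriv_layered {m : ℕ} {g : ℝ → ℝ} {x : Euc (m + 1)} {s : ℝ} (c : Euc (m + 1))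
    (hg : HasDerivAt g s (x (Fin.last m))) (i k : Fin (m + 1)) :
    partialDeriv k (fun z => layered g c z i) x = stretch m s i k := by
  have h := ((coordCLM i).hasFDerivAt
    (x := layered g c x)).comp x (hasFDerivAt_layered c hg)
  have h' : HasFDerivAt (fun z => layered g c z i)
    ((coordCLM i).comp
      (matCLM (stretch m s))) x := h
  rw [partialDeriv, h'.fderiv]
  simpa using matAct_single (stretch m s) i k

lemma partialDeriv_stretch {m : ℕ} {dg : ℝ → ℝ} {x : Euc (m + 1)} {s : ℝ}
    (hg : HasDerivAt dg s (x (Fin.last m))) (i j k : Fin (m + 1)) :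
    partialDeriv k (fun z => stretch m (dg (z (Fin.last m))) i j) x =
      if (i = Fin.last m ∧ j = Fin.last m) ∧ k = Fin.last m then s else 0 := by
  by_cases hij : i = Fin.last m ∧ j = Fin.last m
  · have h1 : HasFDerivAt (fun z : Euc (m + 1) => z (Fin.last m))
        (coordCLM (Fin.last m)) x :=
      (coordCLM (Fin.last m)).hasFDerivAt
    have h2 : HasFDerivAt (fun z : Euc (m + 1) => stretch m (dg (z (Fin.last m))) i j)
        (s • coordCLM (Fin.last m)) x := by
      simp only [stretch_apply, hij, and_self, if_true]
      exact (hg.comp_hasFDerivAt x h1).const_add _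
    rw [partialDeriv, h2.fderiv]
    simp [hij, eq_comm]
  · have : (fun z : Euc (m + 1) => stretch m (dg (z (Fin.last m))) i j) =
        fun _ => if i = j then 1 else 0 := by
      ext z; simp [stretch_apply, hij]
    rw [this]
    simp [partialDeriv, hij]

lemma memLp_of_continuous {d : ℕ} {Ω : Set (Euc d)} (hΩ : Bornology.IsBounded Ω)
    {F : Type*} [NormedAddCommGroup F] [SecondCountableTopology F]
    {f : Euc d → F} (hf : Continuous f) (q : ℝ≥0∞) : MemLp f q (volume.restrict Ω) := by
  obtain ⟨C, hC⟩ := hΩ.isCompact_closure.exists_bound_of_continuousOn hf.continuousOn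
  have : IsFiniteMeasure (volume.restrict (closure Ω)) :=
    ⟨by rw [Measure.restrict_apply_univ]; exact hΩ.closure.measure_lt_top⟩
  refine MemLp.mono_measure (Measure.restrict_mono subset_closure le_rfl) (MemLp.of_bound
    (μ := volume.restrict (closure Ω)) hf.aestronglyMeasurable C ?_)
  exact ae_restrict_of_forall_mem isClosed_closure.measurableSet hC

section Layered

variable {m : ℕ} {Ω : Set (Euc (m + 1))} {g dg ddg : ℝ → ℝ}

lemma hasWeakPartial_layered (Ω : Set (Euc (m + 1))) (hgc : ContDiff ℝ 1 g)
    (hg : ∀ t, HasDerivAt g (dg t) t) (c : Euc (m + 1)) (i k : Fin (m + 1)) :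
    HasWeakPartial Ω k (fun z => layered g c z i)
      fun z => stretch m (dg (z (Fin.last m))) i k := by
  have h := HasWeakPartial.of_contDiff Ω k (contDiff_layered_apply hgc c i)
  rwa [show partialDeriv k (fun z => layered g c z i) =
    fun z => stretch m (dg (z (Fin.last m))) i k from
    funext fun x => partialDeriv_layered c (hg _) i k] at h

lemma weakGrad_layered (hΩ : IsOpen Ω) (hgc : ContDiff ℝ 1 g) (hg : ∀ t, HasDerivAt g (dg t) t)
    (c : Euc (m + 1)) :
    weakGrad Ω (layered g c) =ᵐ[volume.restrict Ω] fun z => stretch m (dg (z (Fin.last m))) := by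
  have h : ∀ᵐ z ∂(volume.restrict Ω), ∀ i k, weakPartial Ω k (fun z => layered g c z i) z =
      stretch m (dg (z (Fin.last m))) i k :=
    ae_all_iff.2 fun i => ae_all_iff.2 fun k =>
      (hasWeakPartial_layered Ω hgc hg c i k).weakPartial_ae_eq hΩ
  filter_upwards [h] with z hz
  ext i k
  exact hz i k

lemma hasWeakPartial_weakPartial_layered (hΩ : IsOpen Ω) (hgc : ContDiff ℝ 1 g)
    (hg : ∀ t, HasDerivAt g (dg t) t) (hdgc : ContDiff ℝ 1 dg)
    (hdg : ∀ t, HasDerivAt dg (ddg t) t) (c : Euc (m + 1)) (i j k : Fin (m + 1)) :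
    HasWeakPartial Ω k (weakPartial Ω j fun z => layered g c z i) fun z =>
      if (i = Fin.last m ∧ j = Fin.last m) ∧ k = Fin.last m then ddg (z (Fin.last m)) else 0 := by
  have h := HasWeakPartial.of_contDiff Ω k (contDiff_stretch_apply (m := m) hdgc i j)
  rw [show partialDeriv k (fun z : Euc (m + 1) => stretch m (dg (z (Fin.last m))) i j) =
    fun z => if (i = Fin.last m ∧ j = Fin.last m) ∧ k = Fin.last m then ddg (z (Fin.last m)) else 0
    from funext fun x => partialDeriv_stretch (hdg _) i j k] at h
  exact h.congr_left ((hasWeakPartial_layered Ω hgc hg c i j).weakPartial_ae_eq hΩ).symm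

lemma weakHess_layered (hΩ : IsOpen Ω) (hgc : ContDiff ℝ 1 g)
    (hg : ∀ t, HasDerivAt g (dg t) t) (hdgc : ContDiff ℝ 1 dg)
    (hdg : ∀ t, HasDerivAt dg (ddg t) t) (c : Euc (m + 1)) :
    ∀ᵐ z ∂(volume.restrict Ω), ∀ i j k, weakHess Ω (layered g c) i j k z =
      if (i = Fin.last m ∧ j = Fin.last m) ∧ k = Fin.last m then ddg (z (Fin.last m)) else 0 :=
  ae_all_iff.2 fun i => ae_all_iff.2 fun j => ae_all_iff.2 fun k =>
    (hasWeakPartial_weakPartial_layered hΩ hgc hg hdgc hdg c i j k).weakPartial_ae_eq hΩ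

lemma hessSq_layered (hΩ : IsOpen Ω) (hgc : ContDiff ℝ 1 g)
    (hg : ∀ t, HasDerivAt g (dg t) t) (hdgc : ContDiff ℝ 1 dg)
    (hdg : ∀ t, HasDerivAt dg (ddg t) t) (c : Euc (m + 1)) :
    ∀ᵐ z ∂(volume.restrict Ω), hessSq Ω (layered g c) z = ddg (z (Fin.last m)) ^ 2 ∧
      hessLastSq Ω (layered g c) z = ddg (z (Fin.last m)) ^ 2 := by
  filter_upwards [weakHess_layered hΩ hgc hg hdgc hdg c] with z hz
  unfold hessSq hessLastSq
  simp only [hz]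
  constructor
  · rw [Finset.sum_eq_single (Fin.last m), Finset.sum_eq_single (Fin.last m),
      Finset.sum_eq_single (Fin.last m)]
    all_goals simp +contextual
  · rw [Finset.sum_eq_single (Fin.last m)]
    all_goals simp +contextual

lemma memH1_layered (hΩb : Bornology.IsBounded Ω) (hgc : ContDiff ℝ 1 g)
    (hg : ∀ t, HasDerivAt g (dg t) t) (hdgc : ContDiff ℝ 1 dg) (c : Euc (m + 1)) :
    MemH1 Ω (layered g c) :=
  ⟨memLp_of_continuous hΩb (continuous_layered hgc.continuous c) 2, fun i k =>
    ⟨_, hasWeakPartial_layered Ω hgc hg c i k,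
      memLp_of_continuous hΩb (contDiff_stretch_apply hdgc i k).continuous 2⟩⟩

lemma memH2_layered (hΩ : IsOpen Ω) (hΩb : Bornology.IsBounded Ω) (hgc : ContDiff ℝ 1 g)
    (hg : ∀ t, HasDerivAt g (dg t) t) (hdgc : ContDiff ℝ 1 dg)
    (hdg : ∀ t, HasDerivAt dg (ddg t) t) (hddg : Continuous ddg) (c : Euc (m + 1)) :
    MemH2 Ω (layered g c) := by
  refine ⟨memH1_layered hΩb hgc hg hdgc c, fun i j k =>
    ⟨_, hasWeakPartial_weakPartial_layered hΩ hgc hg hdgc hdg c i j k,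
      memLp_of_continuous hΩb ?_ 2⟩⟩
  split_ifs
  · exact hddg.comp continuous_last
  · exact continuous_const

end Layered

lemma continuous_stretch (m : ℕ) : Continuous (stretch m) := by
  refine continuous_pi fun i => continuous_pi fun j => ?_
  simp only [stretch_apply]
  split_ifs <;> fun_prop

/-- A laminate with one layer of the second phase and transition zones of width `ε²` has bounded
energy: each transition costs `ε⁻² · ε²` for the wells and `ε² · ε⁻⁴ · ε²` for the second
gradient, and only `∂²_{dd} y` is nonzero. -/
lemma exists_energy_layered_profile_le {m : ℕ} {Ω : Set (Euc (m + 1))} (hΩ : IsOpen Ω)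
    (hΩb : Bornology.IsBounded Ω) {κ : ℝ} {W : Mat (m + 1) → ℝ} (hW : IsTwoWellDensity κ W) :
    ∃ C₀ : ℝ≥0, ∀ a δ ε : ℝ, 0 ≤ δ → 0 < ε →
      energy Ω W ε (layered (fun t => κ * profile a δ (ε ^ 2) t) 0) ≤ C₀ := by
  obtain ⟨C, hC⟩ := exists_volume_layer_le hΩb
  obtain ⟨D, hD0, hD⟩ := exists_abs_profileDeriv2_le
  have hcW : Continuous fun s => W (stretch m (κ * s)) :=
    hW.continuous.comp ((continuous_stretch m).comp (continuous_const.mul continuous_id))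
  obtain ⟨K, hK⟩ := (isCompact_Icc (a := (0 : ℝ)) (b := 1)).exists_bound_of_continuousOn
    hcW.continuousOn
  have hK0 : 0 ≤ K := (norm_nonneg _).trans (hK 0 ⟨le_rfl, zero_le_one⟩)
  refine ⟨Real.toNNReal (K * 2) * C + Real.toNNReal ((κ * D) ^ 2 * 2) * C, fun a δ ε hδ hε => ?_⟩
  have hη : 0 < ε ^ 2 := by positivity
  set g : ℝ → ℝ := fun t => κ * profile a δ (ε ^ 2) t with hg
  have h1 : ContDiff ℝ 1 g := contDiff_const.mul (contDiff_profile hη)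
  have h2 : ∀ t, HasDerivAt g (κ * profileDeriv a δ (ε ^ 2) t) t := fun t =>
    (hasDerivAt_profile hη t).const_mul κ
  have h3 : ContDiff ℝ 1 fun t => κ * profileDeriv a δ (ε ^ 2) t :=
    contDiff_const.mul contDiff_profileDeriv
  have h4 : ∀ t, HasDerivAt (fun t => κ * profileDeriv a δ (ε ^ 2) t)
      (κ * profileDeriv2 a δ (ε ^ 2) t) t := fun t => (hasDerivAt_profileDeriv t).const_mul κ
  set T := transitionZone a δ (ε ^ 2) with hT
  have hTm : MeasurableSet T := measurableSet_transitionZone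
  have hTm' : MeasurableSet {z : Euc (m + 1) | z (Fin.last m) ∈ T} :=
    continuous_last.measurable hTm
  have hvol : volume (Ω ∩ {z | z (Fin.last m) ∈ T}) ≤ C * ENNReal.ofReal (2 * ε ^ 2) :=
    (hC T hTm).trans (by gcongr; exact volume_transitionZone_le hη)
  -- integrals of functions concentrated in the transition zones
  have hzone : ∀ (F : Euc (m + 1) → ℝ) (B : ℝ), (∀ᵐ z ∂(volume.restrict Ω),
      F z ≤ {z : Euc (m + 1) | z (Fin.last m) ∈ T}.indicator (fun _ => B) z) →
      ∫⁻ z in Ω, ENNReal.ofReal (F z) ≤ ENNReal.ofReal B * (C * ENNReal.ofReal (2 * ε ^ 2)) := by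
    intro F B hF
    calc ∫⁻ z in Ω, ENNReal.ofReal (F z) ≤ ∫⁻ z in Ω,
          {z : Euc (m + 1) | z (Fin.last m) ∈ T}.indicator (fun _ => ENNReal.ofReal B) z := by
            refine lintegral_mono_ae (hF.mono fun z hz => ?_)
            refine (ENNReal.ofReal_le_ofReal hz).trans (le_of_eq ?_)
            unfold indicator
            split_ifs <;> simp
      _ ≤ _ := by
        rw [lintegral_indicator_const hTm', Measure.restrict_apply hTm', inter_comm]
        gcongr
  have hWint : ∫⁻ z in Ω, ENNReal.ofReal (W (weakGrad Ω (layered g 0) z)) ≤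
      ENNReal.ofReal K * (C * ENNReal.ofReal (2 * ε ^ 2)) := by
    refine hzone _ _ ?_
    filter_upwards [weakGrad_layered hΩ h1 h2 0] with z hz
    rw [hz]
    by_cases hzT : z (Fin.last m) ∈ T
    · rw [indicator_of_mem (show z ∈ {z : Euc (m + 1) | z (Fin.last m) ∈ T} from hzT)]
      exact (le_abs_self _).trans (hK _ ⟨profileDeriv_nonneg hη hδ _, profileDeriv_le_one _⟩)
    · rw [indicator_of_notMem (show z ∉ {z : Euc (m + 1) | z (Fin.last m) ∈ T} from hzT),
        profileDeriv_eq_indicator hη hδ hzT]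
      unfold indicator
      split_ifs
      · rw [Pi.one_apply, mul_one, stretch_kappa, hW.well_B]
      · rw [mul_zero, stretch_zero, hW.well_A]
  have hHint : ∫⁻ z in Ω, ENNReal.ofReal (hessSq Ω (layered g 0) z) ≤
      ENNReal.ofReal ((κ * (D / ε ^ 2)) ^ 2) * (C * ENNReal.ofReal (2 * ε ^ 2)) := by
    refine hzone _ _ ?_
    filter_upwards [hessSq_layered hΩ h1 h2 h3 h4 0] with z hz
    rw [hz.1]
    by_cases hzT : z (Fin.last m) ∈ T
    · rw [indicator_of_mem (show z ∈ {z : Euc (m + 1) | z (Fin.last m) ∈ T} from hzT), mul_pow,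
        mul_pow]
      refine mul_le_mul_of_nonneg_left ?_ (sq_nonneg κ)
      obtain ⟨hD1, hD2⟩ := abs_le.1 (hD a δ (ε ^ 2) (z (Fin.last m)) hη)
      exact sq_le_sq' hD1 hD2
    · rw [indicator_of_notMem (show z ∉ {z : Euc (m + 1) | z (Fin.last m) ∈ T} from hzT),
        profileDeriv2_eq_zero hη hzT]
      simp
  have hLint : ∫⁻ z in Ω, ENNReal.ofReal (hessSq Ω (layered g 0) z - hessLastSq Ω (layered g 0) z)
      = 0 := by
    rw [lintegral_congr_ae (g := fun _ => 0)]
    · simp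
    · filter_upwards [hessSq_layered hΩ h1 h2 h3 h4 0] with z hz
      rw [hz.1, hz.2, sub_self, ENNReal.ofReal_zero]
  rw [energy, hLint, mul_zero, add_zero]
  push_cast
  refine add_le_add ?_ ?_
  · refine (mul_le_mul_right hWint _).trans (le_of_eq ?_)
    rw [mul_comm (C : ℝ≥0∞), ← mul_assoc, ← mul_assoc, ← ENNReal.ofReal_mul (by positivity),
      ← ENNReal.ofReal_mul (by positivity), ENNReal.ofNNReal_toNNReal]
    congr 2
    field_simp
  · refine (mul_le_mul_right hHint _).trans (le_of_eq ?_)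
    rw [mul_comm (C : ℝ≥0∞), ← mul_assoc, ← mul_assoc, ← ENNReal.ofReal_mul (by positivity),
      ← ENNReal.ofReal_mul (by positivity), ENNReal.ofNNReal_toNNReal]
    congr 2
    field_simp

/-! ### The partition into a lower part, an upper part and a layer in between -/

/-- The heights of the three parts: below `a`, above `b`, and the layer `[a, b)`; completed by
empty sets. -/
def threeHeights (a b : ℝ) : ℕ → Set ℝ
  | 0 => Iio a
  | 1 => Ici b
  | 2 => Ico a b
  | _ => ∅

/-- The parts of `Ω` with heights in `threeHeights a b`. -/
def threeParts {m : ℕ} (Ω : Set (Euc (m + 1))) (a b : ℝ) (j : ℕ) : Set (Euc (m + 1)) :=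
  Ω ∩ {z | z (Fin.last m) ∈ threeHeights a b j}

/-- The phases of the three parts: the second well in the layer, the first one elsewhere. -/
def threePhases (m : ℕ) (κ : ℝ) : ℕ → Mat (m + 1)
  | 2 => wellB m κ
  | _ => 1

/-- The translations of the three parts which make the piecewise affine map continuous. -/
def threeShifts (m : ℕ) (κ a δ : ℝ) : ℕ → Euc (m + 1)
  | 1 => (κ * δ) • eLast m
  | 2 => (-(κ * a)) • eLast m
  | _ => 0

lemma threeHeights_of_three_le (a b : ℝ) {j : ℕ} (hj : 3 ≤ j) : threeHeights a b j = ∅ := by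
  obtain ⟨k, rfl⟩ := Nat.exists_eq_add_of_le hj
  rw [add_comm]; rfl

lemma measurableSet_threeHeights (a b : ℝ) (j : ℕ) : MeasurableSet (threeHeights a b j) := by
  unfold threeHeights
  split
  · exact measurableSet_Iio
  · exact measurableSet_Ici
  · exact measurableSet_Ico
  · exact MeasurableSet.empty

lemma frontier_threeHeights_subset (a b : ℝ) (j : ℕ) :
    frontier (threeHeights a b j) ⊆ {a, b} := by
  unfold threeHeights
  split
  · rw [frontier_Iio]; simp
  · rw [frontier_Ici]; simp
  · rcases lt_or_ge a b with h | h
    · rw [frontier_Ico h]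
    · simp [h]
  · simp

lemma disjoint_threeHeights {a b : ℝ} (hab : a ≤ b) {i j : ℕ} (hij : i ≠ j) {t : ℝ}
    (hi : t ∈ threeHeights a b i) : t ∉ threeHeights a b j := by
  intro hj
  have hi3 : i < 3 := by
    by_contra h
    rw [threeHeights_of_three_le a b (not_lt.1 h)] at hi
    exact hi
  have hj3 : j < 3 := by
    by_contra h
    rw [threeHeights_of_three_le a b (not_lt.1 h)] at hj
    exact hj
  interval_cases i <;> interval_cases j <;>
    simp only [threeHeights, mem_Iio, mem_Ici, mem_Ico] at hi hj <;>
    first | exact hij rfl | linarith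

lemma exists_mem_threeHeights (a b t : ℝ) : ∃ j, t ∈ threeHeights a b j := by
  rcases lt_or_ge t a with h | h
  · exact ⟨0, h⟩
  · rcases lt_or_ge t b with h' | h'
    · exact ⟨2, h, h'⟩
    · exact ⟨1, h'⟩

section Parts

variable {m : ℕ} {Ω : Set (Euc (m + 1))} {a b : ℝ}

lemma threeParts_of_three_le {j : ℕ} (hj : 3 ≤ j) : threeParts Ω a b j = ∅ := by
  simp [threeParts, threeHeights_of_three_le a b hj]

lemma layerSet_threeParts {Ω' : Set (Euc (m + 1))} (hΩ' : Ω' ⊆ Ω) (j : ℕ) :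
    layerSet Ω' (threeParts Ω a b j) \ threeParts Ω a b j = ∅ := by
  ext z
  simp only [Set.mem_sdiff, mem_empty_iff_false, iff_false, not_and, not_not]
  rintro ⟨hz, w, hw, hwz⟩
  refine ⟨hΩ' hz, ?_⟩
  have h : w (Fin.last m) ∈ threeHeights a b j := hw.2
  rw [hwz] at h
  exact h

lemma frontier_threeParts_subset (j : ℕ) : frontier (threeParts Ω a b j) ⊆
    frontier Ω ∪ closure Ω ∩ ({z | z (Fin.last m) = a} ∪ {z | z (Fin.last m) = b}) := by
  refine (frontier_inter_subset _ _).trans ?_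
  refine union_subset_union inter_subset_left (inter_subset_inter_right _ ?_)
  exact (continuous_last.frontier_preimage_subset _).trans
    (preimage_mono (frontier_threeHeights_subset a b j))

lemma frontier_threeParts_inter_subset (hΩ : IsOpen Ω) (j : ℕ) :
    frontier (threeParts Ω a b j) ∩ Ω ⊆ {z | z (Fin.last m) = a} ∪ {z | z (Fin.last m) = b} := by
  rintro z ⟨hz, hzΩ⟩
  rcases frontier_threeParts_subset j hz with h | h
  · rw [hΩ.frontier_eq] at h
    exact absurd hzΩ h.2
  · exact h.2

/-- The surfaces of all the parts have finite measure, uniformly in the heights. -/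
lemma exists_hausdorffMeasure_essBoundary_le (hΩ : IsBoundedLipschitzDomain Ω) :
    ∃ C : ℝ≥0, ∀ a b, Measure.hausdorffMeasure (m : ℝ)
      (⋃ j, essBoundary (threeParts Ω a b j)) ≤ C := by
  obtain ⟨r, hr⟩ := hΩ.isBounded.closure.subset_closedBall 0
  set B := Measure.hausdorffMeasure (m : ℝ) (Metric.closedBall (0 : Euc m) r) with hB
  have hfin : Measure.hausdorffMeasure (m : ℝ) (frontier Ω) + (B + B) ≠ ⊤ :=
    ENNReal.add_ne_top.2 ⟨(hausdorffMeasure_frontier_lt_top hΩ).ne, ENNReal.add_ne_top.2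
      ⟨(hausdorffMeasure_closedBall_lt_top _ _).ne, (hausdorffMeasure_closedBall_lt_top _ _).ne⟩⟩
  refine ⟨(Measure.hausdorffMeasure (m : ℝ) (frontier Ω) + (B + B)).toNNReal, fun a b => ?_⟩
  rw [ENNReal.coe_toNNReal hfin]
  have hsub : (⋃ j, essBoundary (threeParts Ω a b j)) ⊆ frontier Ω ∪
      (Metric.closedBall 0 r ∩ {z | z (Fin.last m) = a} ∪
        Metric.closedBall 0 r ∩ {z | z (Fin.last m) = b}) := by
    refine iUnion_subset fun j => (essBoundary_subset_frontier _).trans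
      ((frontier_threeParts_subset j).trans (union_subset_union_right _ ?_))
    rw [← inter_union_distrib_left]
    exact inter_subset_inter_left _ hr
  refine (measure_mono hsub).trans ((measure_union_le _ _).trans
    (add_le_add_right ((measure_union_le _ _).trans (add_le_add ?_ ?_)) _))
  · exact hausdorffMeasure_hyperplane_le r a
  · exact hausdorffMeasure_hyperplane_le r b

lemma measurableSet_threeParts (hΩ : IsOpen Ω) (j : ℕ) : MeasurableSet (threeParts Ω a b j) :=
  hΩ.measurableSet.inter (continuous_last.measurable (measurableSet_threeHeights a b j))

lemma isCaccioppoliPartition_threeParts (hΩ : IsBoundedLipschitzDomain Ω) (hab : a ≤ b)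
    (h01 : volume (threeParts Ω a b 1) ≤ volume (threeParts Ω a b 0))
    (h12 : volume (threeParts Ω a b 2) ≤ volume (threeParts Ω a b 1)) :
    IsCaccioppoliPartition Ω (threeParts Ω a b) where
  measurable j := (measurableSet_threeParts hΩ.isOpen j).nullMeasurableSet
  subset j := inter_subset_left
  disjoint i j hij := by
    have : threeParts Ω a b i ∩ threeParts Ω a b j = ∅ := by
      ext z
      simp only [mem_inter_iff, mem_empty_iff_false, iff_false, not_and]
      exact fun hi hj => disjoint_threeHeights hab hij hi.2 hj.2
    simp [this]
  cover := by
    have : Ω \ ⋃ j, threeParts Ω a b j = ∅ := by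
      rw [sdiff_eq_empty]
      intro z hz
      obtain ⟨j, hj⟩ := exists_mem_threeHeights a b (z (Fin.last m))
      exact mem_iUnion.2 ⟨j, hz, hj⟩
    simp [this]
  ordered := by
    refine antitone_nat_of_succ_le (f := fun j => volume (threeParts Ω a b j)) fun j => ?_
    match j with
    | 0 => exact h01
    | 1 => exact h12
    | j + 2 => simp [threeParts_of_three_le (show 3 ≤ j + 2 + 1 by omega)]
  perimeter := by
    obtain ⟨C, hC⟩ := exists_hausdorffMeasure_essBoundary_le hΩ
    rw [tsum_eq_sum (s := Finset.range 3)]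
    · refine ENNReal.sum_lt_top.2 fun j _ => ?_
      exact (measure_mono (subset_iUnion (fun j => essBoundary (threeParts Ω a b j)) j)).trans_lt
        ((hC a b).trans_lt ENNReal.coe_lt_top)
    · intro j hj
      rw [Finset.mem_range, not_lt] at hj
      rw [threeParts_of_three_le hj, essBoundary_empty, measure_empty]

/-- On a part, a piecewise defined sum reduces to its term. -/
lemma tsum_indicator_threeParts {E : Type*} [AddCommMonoid E] [TopologicalSpace E] [T2Space E]
    (hab : a ≤ b) (F : ℕ → Euc (m + 1) → E) {z : Euc (m + 1)} {j : ℕ}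
    (hz : z ∈ threeParts Ω a b j) : ∑' i, (threeParts Ω a b i).indicator (F i) z = F j z := by
  rw [tsum_eq_single j fun i hi => indicator_of_notMem
    (fun h => disjoint_threeHeights hab hi h.2 hz.2) _, indicator_of_mem hz]

lemma mem_threeParts_cases {z : Euc (m + 1)} (hz : z ∈ Ω) (a b : ℝ) :
    z ∈ threeParts Ω a b 0 ∨ z ∈ threeParts Ω a b 1 ∨ z ∈ threeParts Ω a b 2 := by
  rcases lt_or_ge (z (Fin.last m)) a with h | h
  · exact Or.inl ⟨hz, h⟩
  · rcases lt_or_ge (z (Fin.last m)) b with h' | h'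
    · exact Or.inr (Or.inr ⟨hz, h, h'⟩)
    · exact Or.inr (Or.inl ⟨hz, h'⟩)

lemma phaseMap_threeParts (hab : a ≤ b) (κ : ℝ) {z : Euc (m + 1)} (hz : z ∈ Ω) :
    phaseMap 1 (threeParts Ω a b) (threePhases m κ) z = stretch m (κ * layerInd a b z) := by
  unfold phaseMap layerInd
  rcases mem_threeParts_cases hz a b with h | h | h
  · rw [tsum_indicator_threeParts hab (fun j _ => 1 * threePhases m κ j) h,
      indicator_of_notMem (show z (Fin.last m) ∉ Ico a b from
        disjoint_threeHeights (i := 0) (j := 2) hab (by decide) h.2), mul_zero,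
      stretch_zero, one_mul]
    rfl
  · rw [tsum_indicator_threeParts hab (fun j _ => 1 * threePhases m κ j) h,
      indicator_of_notMem (show z (Fin.last m) ∉ Ico a b from
        disjoint_threeHeights (i := 1) (j := 2) hab (by decide) h.2), mul_zero,
      stretch_zero, one_mul]
    rfl
  · rw [tsum_indicator_threeParts hab (fun j _ => 1 * threePhases m κ j) h,
      indicator_of_mem (show z (Fin.last m) ∈ Ico a b from h.2), one_mul, Pi.one_apply, mul_one]
    rfl

/-- The piecewise affine map subtracted in the rescaled displacement is the laminate with sharp
interfaces. -/
lemma tsum_affine_threeParts {δ : ℝ} (hδ : 0 ≤ δ) (κ : ℝ) {z : Euc (m + 1)} (hz : z ∈ Ω) :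
    ∑' j, (threeParts Ω a (a + δ) j).indicator
      (fun z => matAct (1 * threePhases m κ j) z + threeShifts m κ a δ j) z =
      z + (κ * clampLayer a δ (z (Fin.last m))) • eLast m := by
  have hab : a ≤ a + δ := by linarith
  have hone : ∀ z : Euc (m + 1), matAct 1 z = z := fun z => by
    ext i; simp [matAct]
  rcases mem_threeParts_cases hz a (a + δ) with h | h | h
  · rw [tsum_indicator_threeParts hab
      (fun j z => matAct (1 * threePhases m κ j) z + threeShifts m κ a δ j) h,
      clampLayer_of_le hδ (le_of_lt h.2)]
    simp [threePhases, threeShifts, hone]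
  · rw [tsum_indicator_threeParts hab
      (fun j z => matAct (1 * threePhases m κ j) z + threeShifts m κ a δ j) h,
      clampLayer_of_ge hδ h.2]
    simp [threePhases, threeShifts, hone]
  · rw [tsum_indicator_threeParts hab
      (fun j z => matAct (1 * threePhases m κ j) z + threeShifts m κ a δ j) h,
      clampLayer_of_mem h.2]
    simp only [threePhases, threeShifts, one_mul, ← stretch_kappa, matAct_stretch]
    rw [add_assoc, ← add_smul]
    congr 2
    ring

end Parts

/-- A horizontal slice of `Ω` which splits off an upper part of positive volume not exceeding that
of the lower part. -/
lemma exists_height {m : ℕ} {Ω : Set (Euc (m + 1))} (hΩ : IsBoundedLipschitzDomain Ω) :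
    ∃ a, (∃ x ∈ Ω, x (Fin.last m) = a) ∧
      volume (threeParts Ω a a 1) ≤ volume (threeParts Ω a a 0) ∧
      0 < volume (threeParts Ω a a 1) ∧ 0 < volume (threeParts Ω a a 0) := by
  have hpos : ∀ x ∈ Ω, ∀ s : ℝ, s = 1 ∨ s = -1 →
      0 < volume (Ω ∩ {z | 0 < s * (z (Fin.last m) - x (Fin.last m))}) := by
    intro x hx s hs
    have hss : s * s = 1 := by rcases hs with rfl | rfl <;> norm_num
    refine (hΩ.isOpen.inter (isOpen_lt continuous_const (by fun_prop))).measure_pos _ ?_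
    have hcont : Continuous fun t : ℝ => x + (s * t) • eLast m := by fun_prop
    have h0 : ∀ᶠ t in 𝓝 (0 : ℝ), x + (s * t) • eLast m ∈ Ω :=
      hcont.continuousAt.eventually_mem (hΩ.isOpen.mem_nhds (by simpa using hx))
    obtain ⟨t, ht1, ht2⟩ := ((h0.filter_mono nhdsWithin_le_nhds).and
      (self_mem_nhdsWithin (s := Ioi (0 : ℝ)))).exists
    refine ⟨_, ht1, ?_⟩
    have ht2 : 0 < t := ht2
    simp [← mul_assoc, hss, ht2]
  obtain ⟨C, hC⟩ := exists_volume_layer_le hΩ.isBounded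
  set h : Set ℝ := (fun z : Euc (m + 1) => z (Fin.last m)) '' Ω with hh
  have hne : h.Nonempty := hΩ.isConnected.nonempty.image _
  have hbdd : BddAbove h := by
    obtain ⟨r, hr⟩ := hΩ.isBounded.subset_closedBall 0
    refine ⟨r, ?_⟩
    rintro _ ⟨z, hz, rfl⟩
    have := hr hz
    rw [Metric.mem_closedBall, dist_zero_right] at this
    exact (le_abs_self _).trans ((abs_last_le_norm z).trans this)
  have hV0 : 0 < volume Ω := hΩ.isOpen.measure_pos _ hΩ.isConnected.nonempty
  have hVt : volume Ω ≠ ⊤ := hΩ.isBounded.measure_lt_top.ne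
  set V := (volume Ω).toReal with hV
  have hVpos : 0 < V := ENNReal.toReal_pos hV0.ne' hVt
  -- choose the slice so close to the top that the part above has at most half the volume
  set τ : ℝ := V / (2 * (C + 1)) with hτ
  have hτ0 : 0 < τ := by positivity
  obtain ⟨_, ⟨x, hx, rfl⟩, hxs⟩ := exists_lt_of_lt_csSup hne
    (show sSup h - τ < sSup h by linarith)
  set a := x (Fin.last m) with ha
  have hxs' : sSup h - τ < a := hxs
  have hup : volume (threeParts Ω a a 1) ≤ ENNReal.ofReal (V / 2) := by
    calc volume (threeParts Ω a a 1) ≤ volume (Ω ∩ {z | z (Fin.last m) ∈ Icc a (sSup h)}) := by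
          refine measure_mono fun z hz => ⟨hz.1, hz.2, le_csSup hbdd ⟨z, hz.1, rfl⟩⟩
      _ ≤ C * volume (Icc a (sSup h)) := hC _ measurableSet_Icc
      _ ≤ ENNReal.ofReal C * ENNReal.ofReal τ := by
          rw [Real.volume_Icc, ENNReal.ofReal_coe_nnreal]
          gcongr
          linarith
      _ ≤ ENNReal.ofReal (V / 2) := by
          rw [← ENNReal.ofReal_mul C.coe_nonneg]
          refine ENNReal.ofReal_le_ofReal ?_
          rw [hτ, mul_div_assoc', div_le_div_iff₀ (by positivity) (by positivity)]
          nlinarith [C.coe_nonneg]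
  have hsum : volume Ω ≤ volume (threeParts Ω a a 0) + volume (threeParts Ω a a 1) := by
    refine (measure_mono fun z hz => ?_).trans (measure_union_le _ _)
    rcases lt_or_ge (z (Fin.last m)) a with h' | h'
    · exact Or.inl ⟨hz, h'⟩
    · exact Or.inr ⟨hz, h'⟩
  refine ⟨a, ⟨x, hx, rfl⟩, ?_, ?_, ?_⟩
  · refine hup.trans ?_
    by_contra hlt
    rw [not_le] at hlt
    have h1 : volume Ω < ENNReal.ofReal (V / 2) + ENNReal.ofReal (V / 2) :=
      hsum.trans_lt (ENNReal.add_lt_add_of_lt_of_le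
        (hup.trans_lt ENNReal.ofReal_lt_top).ne hlt hup)
    rw [← ENNReal.ofReal_add (by positivity) (by positivity), add_halves,
      ENNReal.ofReal_toReal hVt] at h1
    exact lt_irrefl _ h1
  · refine (hpos x hx 1 (Or.inl rfl)).trans_le (measure_mono fun z hz => ⟨hz.1, ?_⟩)
    have := hz.2
    simp only [mem_ofPred_eq] at this
    exact (show a ≤ z (Fin.last m) by linarith)
  · refine (hpos x hx (-1) (Or.inr rfl)).trans_le (measure_mono fun z hz => ⟨hz.1, ?_⟩)
    have := hz.2
    simp only [mem_ofPred_eq] at this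
    exact (show z (Fin.last m) < a by linarith)

/-- Thin layers can be cut off from the upper part without upsetting the order by volume. -/
lemma exists_thickness {m : ℕ} {Ω : Set (Euc (m + 1))} (hΩ : Bornology.IsBounded Ω) {a : ℝ}
    (ha : volume (threeParts Ω a a 1) ≤ volume (threeParts Ω a a 0))
    (hpos : 0 < volume (threeParts Ω a a 1)) :
    ∃ δ₀ > 0, ∀ δ, 0 ≤ δ → δ ≤ δ₀ →
      volume (threeParts Ω a (a + δ) 1) ≤ volume (threeParts Ω a (a + δ) 0) ∧
      volume (threeParts Ω a (a + δ) 2) ≤ volume (threeParts Ω a (a + δ) 1) := by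
  obtain ⟨C, hC⟩ := exists_volume_layer_le hΩ
  have hfin : volume (threeParts Ω a a 1) ≠ ⊤ :=
    ((measure_mono inter_subset_left).trans_lt hΩ.measure_lt_top).ne
  set V := (volume (threeParts Ω a a 1)).toReal with hV
  have hV0 : 0 < V := ENNReal.toReal_pos hpos.ne' hfin
  refine ⟨V / (2 * (C + 1)), by positivity, fun δ hδ0 hδ => ⟨?_, ?_⟩⟩
  · refine (measure_mono (t := threeParts Ω a a 1) fun z hz => ⟨hz.1, ?_⟩).trans
      (show _ ≤ volume (threeParts Ω a a 0) from ha)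
    have h : a + δ ≤ z (Fin.last m) := hz.2
    exact (show a ≤ z (Fin.last m) by linarith)
  · have hmid : volume (threeParts Ω a (a + δ) 2) ≤ ENNReal.ofReal (V / 2) := by
      calc volume (threeParts Ω a (a + δ) 2) ≤ C * volume (Ico a (a + δ)) :=
            hC _ measurableSet_Ico
        _ = ENNReal.ofReal C * ENNReal.ofReal δ := by
            rw [Real.volume_Ico, ENNReal.ofReal_coe_nnreal, add_sub_cancel_left]
        _ ≤ ENNReal.ofReal (V / 2) := by
            rw [← ENNReal.ofReal_mul C.coe_nonneg]
            refine ENNReal.ofReal_le_ofReal ?_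
            rw [le_div_iff₀ (by positivity)] at hδ
            have := C.coe_nonneg
            have h2 : (C : ℝ) * δ * 2 ≤ V := by nlinarith
            linarith
    have hsum : volume (threeParts Ω a a 1) ≤
        volume (threeParts Ω a (a + δ) 2) + volume (threeParts Ω a (a + δ) 1) := by
      refine (measure_mono fun z hz => ?_).trans (measure_union_le _ _)
      rcases lt_or_ge (z (Fin.last m)) (a + δ) with h' | h'
      · exact Or.inl ⟨hz.1, hz.2, h'⟩
      · exact Or.inr ⟨hz.1, h'⟩
    refine hmid.trans ?_
    by_contra hlt
    rw [not_le] at hlt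
    have h1 : volume (threeParts Ω a a 1) < ENNReal.ofReal (V / 2) + ENNReal.ofReal (V / 2) :=
      hsum.trans_lt (ENNReal.add_lt_add_of_le_of_lt
        (hmid.trans_lt ENNReal.ofReal_lt_top).ne hmid hlt)
    rw [← ENNReal.ofReal_add (by positivity) (by positivity), add_halves,
      ENNReal.ofReal_toReal hfin] at h1
    exact lt_irrefl _ h1

/-- The interface inside `Ω` belongs to the essential boundary of the lower part. -/
lemma mem_essBoundary_threeParts {m : ℕ} {Ω : Set (Euc (m + 1))} (hΩ : IsOpen Ω) {a : ℝ}
    {x : Euc (m + 1)} (hx : x ∈ Ω) (hxa : x (Fin.last m) = a) :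
    x ∈ essBoundary (threeParts Ω a a 0) := by
  obtain ⟨r, hr, hball⟩ := Metric.isOpen_iff.1 hΩ x hx
  have hinner : ∀ z : Euc (m + 1), inner ℝ (z - x) (-eLast m) = a - z (Fin.last m) := by
    intro z
    rw [inner_neg_right, EuclideanSpace.inner_single_right]
    simp [hxa]
  refine mem_essBoundary_of_halfSpace (ν := -eLast m) hr (by simp) ?_ ?_
  · have : (Metric.ball x r ∩ {z | 0 < inner ℝ (z - x) (-eLast m)}) \ threeParts Ω a a 0 = ∅ := by
      ext z
      simp only [Set.mem_sdiff, mem_inter_iff, mem_ofPred_eq, hinner, mem_empty_iff_false,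
        iff_false, not_and, not_not, and_imp]
      exact fun h1 h2 => ⟨hball h1, show z (Fin.last m) < a by linarith⟩
    rw [this, measure_empty]
  · have : threeParts Ω a a 0 ∩ (Metric.ball x r ∩ {z | inner ℝ (z - x) (-eLast m) < 0}) = ∅ := by
      ext z
      simp only [mem_inter_iff, mem_ofPred_eq, hinner, mem_empty_iff_false,
        iff_false, not_and]
      intro h1 _ h3
      have : z (Fin.last m) < a := h1.2
      linarith
    rw [this, measure_empty]

/-! ### Estimates for maps concentrated in thin layers -/

lemma ofReal_sq_rpow_half {t : ℝ} (ht : 0 ≤ t) :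
    ENNReal.ofReal (t ^ 2) ^ (1 / (2 : ℝ≥0∞).toReal) = ENNReal.ofReal t := by
  rw [ENNReal.ofReal_rpow_of_nonneg (by positivity) (by simp)]
  congr 1
  rw [ENNReal.toReal_ofNat, ← Real.sqrt_eq_rpow, Real.sqrt_sq ht]

lemma eLpNorm_le_of_layer {m : ℕ} {Ω : Set (Euc (m + 1))} {E : Type*} [NormedAddCommGroup E]
    {F : Euc (m + 1) → E} {K : ℝ} (hK : 0 ≤ K) {T : Set ℝ} (hT : MeasurableSet T) {q : ℝ≥0∞}
    (hq0 : q ≠ 0) (hqt : q ≠ ⊤) (hF : ∀ᵐ z ∂(volume.restrict Ω),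
      ‖F z‖ ≤ {z : Euc (m + 1) | z (Fin.last m) ∈ T}.indicator (fun _ => K) z) :
    eLpNorm F q (volume.restrict Ω) ≤
      ENNReal.ofReal K * volume (Ω ∩ {z | z (Fin.last m) ∈ T}) ^ (1 / q.toReal) := by
  have hTm : MeasurableSet {z : Euc (m + 1) | z (Fin.last m) ∈ T} :=
    continuous_last.measurable hT
  refine (eLpNorm_mono_ae_real hF).trans (le_of_eq ?_)
  rw [eLpNorm_indicator_const hTm hq0 hqt, Real.enorm_of_nonneg hK, Measure.restrict_apply hTm,
    inter_comm]

/-- Maps of size `1 / ε` concentrated in layers of thickness `ε²` are bounded in `L²` and converge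
weakly to zero, because the `L²` mass of a fixed map in these layers vanishes. -/
lemma tendsto_integral_inner_of_layer {m : ℕ} {O : Set (Euc (m + 1))} {E : Type*}
    [NormedAddCommGroup E] [InnerProductSpace ℝ E] {A : ℕ → Euc (m + 1) → E}
    {ψ : Euc (m + 1) → E} (hψ : MemLp ψ 2 (volume.restrict O)) {T : ℕ → Set ℝ}
    (hT : ∀ n, MeasurableSet (T n)) {K D : ℝ} (hD : 0 ≤ D) {ε : ℕ → ℝ}
    (hεpos : ∀ n, 0 < ε n) (hε : Tendsto ε atTop (𝓝 0))
    (hvol : ∀ n, volume (O ∩ {z | z (Fin.last m) ∈ T n}) ≤ ENNReal.ofReal ((D * ε n) ^ 2))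
    (hA : ∀ n, ∀ᵐ z ∂(volume.restrict O),
      ‖A n z‖ ≤ {z : Euc (m + 1) | z (Fin.last m) ∈ T n}.indicator (fun _ => K / ε n) z) :
    Tendsto (fun n => ∫ z in O, inner ℝ (A n z) (ψ z)) atTop (𝓝 0) := by
  set μ := volume.restrict O with hμ
  set Z : ℕ → Set (Euc (m + 1)) := fun n => {z | z (Fin.last m) ∈ T n} with hZ
  have hZm : ∀ n, MeasurableSet (Z n) := fun n => continuous_last.measurable (hT n)
  have hμZ : ∀ n, μ (Z n) ≤ ENNReal.ofReal ((D * ε n) ^ 2) := fun n => by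
    rw [hμ, Measure.restrict_apply (hZm n), inter_comm]; exact hvol n
  have hZ0 : Tendsto (fun n => μ (Z n)) atTop (𝓝 0) := by
    have h1 : Tendsto (fun n => ENNReal.ofReal ((D * ε n) ^ 2)) atTop (𝓝 0) := by
      have := ENNReal.tendsto_ofReal ((hε.const_mul D).pow 2)
      simpa using this
    exact tendsto_of_tendsto_of_tendsto_of_le_of_le tendsto_const_nhds h1 (fun _ => zero_le) hμZ
  have hψ2 : ∫⁻ z, ‖ψ z‖ₑ ^ (2 : ℝ) ∂μ ≠ ⊤ := by
    have := lintegral_rpow_enorm_lt_top_of_eLpNorm_lt_top two_ne_zero ENNReal.ofNat_ne_top hψ.2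
    simpa using this.ne
  have hmass : Tendsto (fun n => eLpNorm ψ 2 (μ.restrict (Z n))) atTop (𝓝 0) := by
    have h1 := (tendsto_setLIntegral_zero hψ2 hZ0).ennrpow_const (1 / 2 : ℝ)
    rw [ENNReal.zero_rpow_of_pos (by norm_num)] at h1
    refine h1.congr fun n => ?_
    rw [eLpNorm_eq_lintegral_rpow_enorm_toReal two_ne_zero ENNReal.ofNat_ne_top,
      ENNReal.toReal_ofNat]
  have hbound : ∀ n, ‖∫ z in O, inner ℝ (A n z) (ψ z)‖ₑ ≤
      ENNReal.ofReal (K * D) * eLpNorm ψ 2 (μ.restrict (Z n)) := by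
    intro n
    calc ‖∫ z in O, inner ℝ (A n z) (ψ z)‖ₑ ≤ ∫⁻ z, ‖inner ℝ (A n z) (ψ z)‖ₑ ∂μ :=
          enorm_integral_le_lintegral_enorm _
      _ ≤ ∫⁻ z, (Z n).indicator (fun z => ENNReal.ofReal (K / ε n) * ‖ψ z‖ₑ) z ∂μ := by
          refine lintegral_mono_ae ((hA n).mono fun z hz => ?_)
          have h1 : ‖inner ℝ (A n z) (ψ z)‖ₑ ≤ ‖A n z‖ₑ * ‖ψ z‖ₑ := by
            rw [← ofReal_norm, ← ofReal_norm, ← ofReal_norm,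
              ← ENNReal.ofReal_mul (norm_nonneg _)]
            exact ENNReal.ofReal_le_ofReal (norm_inner_le_norm _ _)
          refine h1.trans ?_
          by_cases hzZ : z ∈ Z n
          · rw [indicator_of_mem hzZ] at hz ⊢
            gcongr
            rw [← ofReal_norm]
            exact ENNReal.ofReal_le_ofReal hz
          · rw [indicator_of_notMem hzZ] at hz
            have : A n z = 0 := norm_le_zero_iff.1 hz
            simp [this]
      _ = ENNReal.ofReal (K / ε n) * eLpNorm ψ 1 (μ.restrict (Z n)) := by
          rw [lintegral_indicator (hZm n), lintegral_const_mul' _ _ ENNReal.ofReal_ne_top,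
            eLpNorm_one_eq_lintegral_enorm]
      _ ≤ ENNReal.ofReal (K / ε n) * (eLpNorm ψ 2 (μ.restrict (Z n)) *
            ENNReal.ofReal (D * ε n)) := by
          gcongr
          refine (eLpNorm_le_eLpNorm_mul_rpow_measure_univ (p := 1) (q := 2) (by norm_num)
            hψ.1.restrict).trans ?_
          gcongr
          rw [Measure.restrict_apply_univ, ← ofReal_sq_rpow_half (mul_nonneg hD (hεpos n).le)]
          have e : 1 / (1 : ℝ≥0∞).toReal - 1 / (2 : ℝ≥0∞).toReal = 1 / (2 : ℝ≥0∞).toReal := by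
            norm_num
          rw [e]
          exact ENNReal.rpow_le_rpow (hμZ n) (by simp)
      _ = ENNReal.ofReal (K * D) * eLpNorm ψ 2 (μ.restrict (Z n)) := by
          rw [mul_comm (eLpNorm ψ 2 _), ← mul_assoc, ← ENNReal.ofReal_mul' (mul_nonneg hD
            (hεpos n).le)]
          congr 2
          have := (hεpos n).ne'
          field_simp
  rw [tendsto_iff_edist_tendsto_0]
  have hlim : Tendsto (fun n => ENNReal.ofReal (K * D) * eLpNorm ψ 2 (μ.restrict (Z n))) atTop
      (𝓝 0) := by
    simpa using ENNReal.Tendsto.const_mul hmass (Or.inr ENNReal.ofReal_ne_top)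
  refine tendsto_of_tendsto_of_tendsto_of_le_of_le tendsto_const_nhds hlim (fun _ => zero_le)
    fun n => ?_
  rw [edist_zero_right]
  exact hbound n

/-! ### The smoothed laminates -/

/-- The deformation whose gradient is the second well in the layer `{a ≤ x_d < a + δ}`, up to
transition zones of width `ε²`, and the identity elsewhere. The upper part of the body is thereby
shifted by `κ δ e_d` with respect to the lower part. -/
def smoothLaminate {m : ℕ} (κ a δ ε : ℝ) : Euc (m + 1) → Euc (m + 1) :=
  layered (fun t => κ * profile a δ (ε ^ 2) t) 0

section SmoothLaminate

variable {m : ℕ} {Ω : Set (Euc (m + 1))} {κ a δ ε : ℝ}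

lemma weakGrad_smoothLaminate (hΩ : IsOpen Ω) (hε : 0 < ε) :
    weakGrad Ω (smoothLaminate κ a δ ε) =ᵐ[volume.restrict Ω]
      fun z => stretch m (κ * profileDeriv a δ (ε ^ 2) (z (Fin.last m))) :=
  weakGrad_layered hΩ (contDiff_const.mul (contDiff_profile (by positivity)))
    (fun t => (hasDerivAt_profile (by positivity) t).const_mul κ) 0

lemma memH2_smoothLaminate (hΩ : IsOpen Ω) (hΩb : Bornology.IsBounded Ω) (hε : 0 < ε) :
    MemH2 Ω (smoothLaminate κ a δ ε) :=
  memH2_layered hΩ hΩb (contDiff_const.mul (contDiff_profile (by positivity)))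
    (fun t => (hasDerivAt_profile (by positivity) t).const_mul κ)
    (contDiff_const.mul contDiff_profileDeriv)
    (fun t => (hasDerivAt_profileDeriv t).const_mul κ)
    (continuous_const.mul continuous_profileDeriv2) 0

lemma abs_profileDeriv_sub_indicator_le (hδ : 0 ≤ δ) (hε : 0 < ε) (t : ℝ) :
    |profileDeriv a δ (ε ^ 2) t - (Ico a (a + δ)).indicator 1 t| ≤
      (transitionZone a δ (ε ^ 2)).indicator (fun _ => 1) t := by
  by_cases ht : t ∈ transitionZone a δ (ε ^ 2)
  · rw [indicator_of_mem ht]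
    have h1 := profileDeriv_nonneg (a := a) (show 0 < ε ^ 2 by positivity) hδ t
    have h2 := profileDeriv_le_one (a := a) (δ := δ) (η := ε ^ 2) t
    unfold indicator
    split_ifs <;> rw [abs_le] <;> constructor <;> simp <;> linarith
  · rw [indicator_of_notMem ht, profileDeriv_eq_indicator (by positivity) hδ ht, sub_self, abs_zero]

lemma norm_grad_sub_phaseMap_le (hΩ : IsOpen Ω) (hκ : 0 < κ) (hδ : 0 ≤ δ) (hε : 0 < ε) :
    ∀ᵐ z ∂(volume.restrict Ω), ‖frob (weakGrad Ω (smoothLaminate κ a δ ε) z -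
      phaseMap 1 (threeParts Ω a (a + δ)) (threePhases m κ) z)‖ ≤
      {z : Euc (m + 1) | z (Fin.last m) ∈ transitionZone a δ (ε ^ 2)}.indicator (fun _ => κ) z := by
  filter_upwards [weakGrad_smoothLaminate hΩ hε, ae_restrict_mem hΩ.measurableSet] with z hz hzΩ
  rw [hz, phaseMap_threeParts (by linarith) κ hzΩ, stretch_sub_stretch, norm_frob_vert, ← mul_sub,
    abs_mul, abs_of_pos hκ]
  refine (mul_le_mul_of_nonneg_left (abs_profileDeriv_sub_indicator_le hδ hε _) hκ.le).trans
    (le_of_eq ?_)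
  simp only [indicator, mem_ofPred_eq]
  split_ifs <;> simp

lemma norm_grad_sub_one_le (hΩ : IsOpen Ω) (hκ : 0 < κ) (hδ : 0 ≤ δ) (hε : 0 < ε) :
    ∀ᵐ z ∂(volume.restrict Ω), ‖frob (weakGrad Ω (smoothLaminate κ a δ ε) z - 1)‖ ≤
      {z : Euc (m + 1) | z (Fin.last m) ∈ Icc a (a + δ + ε ^ 2)}.indicator (fun _ => κ) z := by
  have hη : 0 < ε ^ 2 := by positivity
  filter_upwards [weakGrad_smoothLaminate hΩ hε] with z hz
  rw [hz, ← stretch_zero, stretch_sub_stretch, norm_frob_vert, sub_zero, abs_mul, abs_of_pos hκ,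
    abs_of_nonneg (profileDeriv_nonneg hη hδ _)]
  by_cases h : z (Fin.last m) ∈ Icc a (a + δ + ε ^ 2)
  · rw [indicator_of_mem (s := {z : Euc (m + 1) | z (Fin.last m) ∈ Icc a (a + δ + ε ^ 2)}) h]
    exact mul_le_of_le_one_right hκ.le (profileDeriv_le_one _)
  · rw [indicator_of_notMem (s := {z : Euc (m + 1) | z (Fin.last m) ∈ Icc a (a + δ + ε ^ 2)}) h,
      profileDeriv_eq_indicator hη hδ, indicator_of_notMem, mul_zero]
    · exact fun h' => h ⟨h'.1, by linarith [h'.2]⟩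
    · rintro (h' | h')
      · exact h ⟨h'.1, by linarith [h'.2]⟩
      · exact h ⟨by linarith [h'.1], h'.2⟩

/-- On `Ω` the rescaled displacement only sees the smoothing of the laminate. -/
lemma rescaledDisp_smoothLaminate (hδ : 0 ≤ δ) {z : Euc (m + 1)} (hz : z ∈ Ω) :
    rescaledDisp ε (smoothLaminate κ a δ ε) 1 (threeParts Ω a (a + δ)) (threePhases m κ)
      (threeShifts m κ a δ) z = (ε⁻¹ * (κ * (profile a δ (ε ^ 2) (z (Fin.last m)) -
        clampLayer a δ (z (Fin.last m))))) • eLast m := by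
  rw [rescaledDisp, tsum_affine_threeParts hδ κ hz, smoothLaminate, layered, add_zero,
    add_sub_add_left_eq_sub, ← sub_smul, smul_smul, mul_sub κ]

lemma norm_rescaledDisp_le (hκ : 0 < κ) (hδ : 0 ≤ δ) (hε : 0 < ε) {z : Euc (m + 1)}
    (hz : z ∈ Ω) : ‖rescaledDisp ε (smoothLaminate κ a δ ε) 1 (threeParts Ω a (a + δ))
      (threePhases m κ) (threeShifts m κ a δ) z‖ ≤ 2 * κ * ε := by
  rw [rescaledDisp_smoothLaminate hδ hz, norm_smul]
  simp only [PiLp.norm_single, norm_one, mul_one]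
  rw [Real.norm_eq_abs, abs_mul, abs_mul, abs_of_pos hκ, abs_of_pos (inv_pos.2 hε)]
  calc ε⁻¹ * (κ * _) ≤ ε⁻¹ * (κ * (2 * ε ^ 2)) := by
        gcongr
        exact abs_profile_sub_clampLayer_le (by positivity) _
    _ = 2 * κ * ε := by field_simp

lemma approxGrad_rescaledDisp (hΩ : IsOpen Ω) (hδ : 0 ≤ δ) (hε : 0 < ε) :
    ∀ᵐ z ∂(volume.restrict Ω), approxGrad (rescaledDisp ε (smoothLaminate κ a δ ε) 1
      (threeParts Ω a (a + δ)) (threePhases m κ) (threeShifts m κ a δ)) z =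
      vert m (ε⁻¹ * (κ * (profileDeriv a δ (ε ^ 2) (z (Fin.last m)) -
        (Ico a (a + δ)).indicator 1 (z (Fin.last m))))) := by
  have h1 : ∀ t : ℝ, ∀ᵐ z ∂(volume.restrict Ω), z ∉ {z : Euc (m + 1) | z (Fin.last m) = t} :=
    fun t => ae_restrict_of_ae (measure_eq_zero_iff_ae_notMem.1 (volume_hyperplane t))
  filter_upwards [h1 a, h1 (a + δ), ae_restrict_mem hΩ.measurableSet] with z hza hzb hzΩ
  refine approxGrad_eq_of_hasFDerivAt (v := fun z => (ε⁻¹ * (κ *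
    (profile a δ (ε ^ 2) (z (Fin.last m)) - clampLayer a δ (z (Fin.last m))))) • eLast m) ?_ ?_
  · filter_upwards [hΩ.mem_nhds hzΩ] with w hw using rescaledDisp_smoothLaminate hδ hw
  · exact hasFDerivAt_vertical (h := fun t => ε⁻¹ * (κ * (profile a δ (ε ^ 2) t -
      clampLayer a δ t))) ((((hasDerivAt_profile (by positivity) _).sub
        (hasDerivAt_clampLayer hδ hza hzb)).const_mul κ).const_mul ε⁻¹)

lemma norm_approxGrad_rescaledDisp_le (hΩ : IsOpen Ω) (hκ : 0 < κ) (hδ : 0 ≤ δ) (hε : 0 < ε) :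
    ∀ᵐ z ∂(volume.restrict Ω), ‖frob (approxGrad (rescaledDisp ε (smoothLaminate κ a δ ε) 1
      (threeParts Ω a (a + δ)) (threePhases m κ) (threeShifts m κ a δ)) z)‖ ≤
      {z : Euc (m + 1) | z (Fin.last m) ∈ transitionZone a δ (ε ^ 2)}.indicator
        (fun _ => κ / ε) z := by
  filter_upwards [approxGrad_rescaledDisp hΩ hδ hε] with z hz
  rw [hz, norm_frob_vert, abs_mul, abs_mul, abs_of_pos hκ, abs_of_pos (inv_pos.2 hε)]
  have h := abs_profileDeriv_sub_indicator_le (a := a) hδ hε (z (Fin.last m))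
  calc _ ≤ ε⁻¹ * (κ * (transitionZone a δ (ε ^ 2)).indicator (fun _ => 1) (z (Fin.last m))) := by
        gcongr
    _ = _ := by
        simp only [indicator, mem_ofPred_eq]
        split_ifs <;> simp [div_eq_inv_mul]

lemma aestronglyMeasurable_approxGrad_rescaledDisp (hΩ : IsOpen Ω) (hδ : 0 ≤ δ) (hε : 0 < ε) :
    AEStronglyMeasurable (fun z => frob (approxGrad (rescaledDisp ε (smoothLaminate κ a δ ε) 1
      (threeParts Ω a (a + δ)) (threePhases m κ) (threeShifts m κ a δ)) z))
      (volume.restrict Ω) := by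
  refine AEStronglyMeasurable.congr (f := fun z => frob (vert m (ε⁻¹ * (κ * (profileDeriv a δ
    (ε ^ 2) (z (Fin.last m)) - (Ico a (a + δ)).indicator 1 (z (Fin.last m))))))) ?_
    ((approxGrad_rescaledDisp (κ := κ) (a := a) hΩ hδ hε).mono fun z hz => by simp only [hz])
  have hv : Continuous (vert m) := by
    have : vert m = fun s => stretch m s - stretch m 0 := by
      ext1 s; rw [stretch_sub_stretch, sub_zero]
    rw [this]
    exact (continuous_stretch m).sub continuous_const
  have hm : Measurable fun z : Euc (m + 1) => ε⁻¹ * (κ * (profileDeriv a δ (ε ^ 2)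
      (z (Fin.last m)) - (Ico a (a + δ)).indicator 1 (z (Fin.last m)))) :=
    (((continuous_profileDeriv.comp continuous_last).measurable.sub
      ((measurable_one.indicator measurableSet_Ico).comp
        continuous_last.measurable)).const_mul κ).const_mul ε⁻¹
  exact ((continuous_frob.comp hv).measurable.comp hm).aestronglyMeasurable

/-- The deviation of the smoothed laminate from the identity is uniformly small. -/
lemma norm_smoothLaminate_sub_le (hκ : 0 < κ) (hδ : 0 ≤ δ) (hε : 0 < ε) (z : Euc (m + 1)) :
    ‖smoothLaminate κ a δ ε z - z‖ ≤ κ * (δ + 2 * ε ^ 2) := by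
  rw [smoothLaminate, layered, add_zero, add_sub_cancel_left, norm_smul]
  simp only [PiLp.norm_single, norm_one, mul_one]
  rw [Real.norm_eq_abs, abs_mul, abs_of_pos hκ]
  gcongr
  have h1 := abs_profile_sub_clampLayer_le (a := a) (δ := δ) (show 0 < ε ^ 2 by positivity)
    (z (Fin.last m))
  have h2 := abs_clampLayer_le (a := a) hδ (z (Fin.last m))
  have h3 := abs_add_le (profile a δ (ε ^ 2) (z (Fin.last m)) - clampLayer a δ (z (Fin.last m)))
    (clampLayer a δ (z (Fin.last m)))
  rw [sub_add_cancel] at h3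
  linarith

end SmoothLaminate

/-! ### Properties of the limit triple -/

section LimitTriple

variable {m : ℕ} {Ω : Set (Euc (m + 1))} {κ a : ℝ}

/-- The identity map, normalized to have mean zero on `Ω`. -/
def centeredId {m : ℕ} (Ω : Set (Euc (m + 1))) : Euc (m + 1) → Euc (m + 1) :=
  layered (fun _ => 0) (-(⨍ x in Ω, x))

lemma centeredId_apply (z : Euc (m + 1)) : centeredId Ω z = z - ⨍ x in Ω, x := by
  simp [centeredId, layered, sub_eq_add_neg]

lemma weakGrad_centeredId (hΩ : IsOpen Ω) :
    weakGrad Ω (centeredId Ω) =ᵐ[volume.restrict Ω] fun _ => 1 := by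
  have := weakGrad_layered (m := m) hΩ (contDiff_const (c := (0 : ℝ)))
    (fun t => hasDerivAt_const t (0 : ℝ)) (-(⨍ x in Ω, x))
  simp only [stretch_zero] at this
  exact this

lemma gradJumpSet_centeredId (hΩ : IsOpen Ω) : gradJumpSet Ω (centeredId Ω) = ∅ := by
  refine eq_empty_of_forall_notMem fun x hx => ?_
  obtain ⟨r, hr, hball⟩ := Metric.isOpen_iff.1 hΩ x hx.1
  refine notMem_jumpSet_of_ae_eq hr (c := frob 1) ?_ hx
  filter_upwards [ae_mono (Measure.restrict_mono hball le_rfl) (weakGrad_centeredId hΩ)] with z hz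
  rw [hz]

lemma hasMatBVDeriv_centeredId (hΩ : IsOpen Ω) (hΩb : Bornology.IsBounded Ω) (κ a : ℝ) :
    HasMatBVDeriv Ω (weakGrad Ω (centeredId Ω)) (laminateDeriv hΩb κ a a) := by
  refine hasMatBVDeriv_laminate hΩ hΩb κ le_rfl ?_
  filter_upwards [weakGrad_centeredId hΩ] with z hz
  rw [hz, layerInd, Ico_self, indicator_empty, mul_zero, stretch_zero]

lemma memLimitDeformation_centeredId (hΩ : IsBoundedLipschitzDomain Ω) (κ : ℝ) :
    MemLimitDeformation Ω κ 1 (centeredId Ω) where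
  memH1 := memH1_layered hΩ.isBounded contDiff_const (fun t => hasDerivAt_const t (0 : ℝ))
    contDiff_const _
  mean_zero := by
    have hpos : volume Ω ≠ 0 := (hΩ.isOpen.measure_pos _ hΩ.isConnected.nonempty).ne'
    have hfin : volume Ω ≠ ⊤ := hΩ.isBounded.measure_lt_top.ne
    have hint : IntegrableOn (fun x : Euc (m + 1) => x) Ω :=
      memLp_one_iff_integrable.1 (memLp_of_continuous hΩ.isBounded continuous_id 1)
    have := average_congr (μ := volume.restrict Ω)
      (ae_of_all _ fun z => centeredId_apply (Ω := Ω) z)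
    rw [this, setAverage_eq, integral_sub hint (integrableOn_const hfin), smul_sub,
      ← setAverage_eq, ← setAverage_eq, setAverage_const hpos hfin, sub_self]
  grad_bv := ⟨_, hasMatBVDeriv_centeredId hΩ.isOpen hΩ.isBounded κ 0⟩
  grad_wells := (weakGrad_centeredId hΩ.isOpen).mono fun _ hz => Or.inl hz

lemma memLimitDisplacement_zero (Ω : Set (Euc (m + 1))) :
    MemLimitDisplacement Ω (0 : Euc (m + 1) → Euc (m + 1)) := by
  have hj : ∀ O : Set (Euc (m + 1)), jumpSet O (0 : Euc (m + 1) → Euc (m + 1)) = ∅ := fun O =>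
    eq_empty_of_forall_notMem fun x =>
      notMem_jumpSet_of_ae_eq one_pos (c := 0) (ae_of_all _ fun _ => rfl)
  refine ⟨fun O _ => ⟨⟨integrableOn_zero, fun i => ⟨0, fun k => ⟨?_, fun φ _ => ?_⟩, fun k => ?_⟩⟩,
    ?_, ?_⟩, ?_⟩
  · simp [SignedMeasure.totalVariation_zero]
  · simp [VectorMeasure.integral_zero_vectorMeasure]
  · simp [SignedMeasure.singularPart_zero, SignedMeasure.totalVariation_zero]
  · simp only [approxGrad_zero]
    have : frob (0 : Mat (m + 1)) = 0 := rfl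
    simp only [this]
    exact MemLp.zero
  · simp [hj]
  · exact ⟨0, by simp [hj]⟩

lemma threeParts_self_two : threeParts Ω a a 2 = ∅ := by
  simp [threeParts, threeHeights]

lemma memLimitPartition_threeParts (hΩ : IsBoundedLipschitzDomain Ω)
    (ha : volume (threeParts Ω a a 1) ≤ volume (threeParts Ω a a 0)) :
    MemLimitPartition Ω (threeParts Ω a a) := by
  refine ⟨isCaccioppoliPartition_threeParts hΩ le_rfl ha (by simp [threeParts_self_two]),
    fun _ => a, ?_⟩
  rintro z ⟨hz, hzΩ⟩
  obtain ⟨j, hj⟩ := mem_iUnion.1 hz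
  have := frontier_threeParts_inter_subset hΩ.isOpen j ⟨hj, hzΩ⟩
  rw [union_self] at this
  exact mem_iUnion.2 ⟨0, this⟩

/-- The interface of the limit partition inside `Ω` contains a disc. -/
lemma hausdorffMeasure_essBoundary_threeParts_pos (hΩ : IsOpen Ω) {x : Euc (m + 1)} (hx : x ∈ Ω)
    (hxa : x (Fin.last m) = a) : 0 < Measure.hausdorffMeasure (m : ℝ)
      ((⋃ j, essBoundary (threeParts Ω a a j)) ∩ Ω) := by
  obtain ⟨r, hr, hball⟩ := Metric.isOpen_iff.1 hΩ x hx
  refine (hausdorffMeasure_ball_pos (headCoords x) hr).trans_le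
    (hausdorffMeasure_ge_of_disc_subset (t := a) fun w hw => ?_)
  have hwΩ : joinCoords w a ∈ Ω := by
    refine hball ?_
    rw [Metric.mem_ball, dist_eq_norm]
    refine (norm_le_head_add_last _).trans_lt ?_
    rw [headCoords_sub]
    simpa [hxa, dist_eq_norm] using hw
  exact ⟨mem_iUnion.2 ⟨0, mem_essBoundary_threeParts hΩ hwΩ (by simp)⟩, hwΩ⟩

end LimitTriple

/-! ### Admissibility of the limit triple -/

section Admissible

variable {m : ℕ} {Ω : Set (Euc (m + 1))} {κ a : ℝ} {ε δ : ℕ → ℝ}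

/-- Two distinct parts of positive volume of the limit partition are the lower and the upper part;
their translations differ by the jump of the deformation across the layer. -/
lemma norm_threeShifts_sub (hκ : 0 < κ) {i j : ℕ} (hij : i ≠ j)
    (hi : 0 < volume (threeParts Ω a a i)) (hj : 0 < volume (threeParts Ω a a j)) {t : ℝ}
    (ht : 0 ≤ t) : ‖threeShifts m κ a t i - threeShifts m κ a t j‖ = κ * t := by
  have h2 : ∀ k, 0 < volume (threeParts Ω a a k) → k = 0 ∨ k = 1 := fun k hk => by
    by_contra! h
    have : threeParts Ω a a k = ∅ := by
      rcases eq_or_ne k 2 with rfl | h2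
      · exact threeParts_self_two
      · exact threeParts_of_three_le (by omega)
    simp [this] at hk
  have hn : ‖(κ * t) • eLast m‖ = κ * t := by
    rw [norm_smul]
    simp only [PiLp.norm_single, norm_one, mul_one]
    rw [Real.norm_eq_abs, abs_of_nonneg (by positivity)]
  rcases h2 i hi with rfl | rfl <;> rcases h2 j hj with rfl | rfl
  · exact absurd rfl hij
  · change ‖0 - (κ * t) • eLast m‖ = _
    rw [zero_sub, norm_neg, hn]
  · change ‖(κ * t) • eLast m - 0‖ = _
    rw [sub_zero, hn]
  · exact absurd rfl hij

lemma exists_volume_transitionZone_le (hΩb : Bornology.IsBounded Ω) :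
    ∃ D : ℝ≥0, ∀ a δ ε : ℝ, 0 < ε →
      volume (Ω ∩ {z | z (Fin.last m) ∈ transitionZone a δ (ε ^ 2)}) ≤
        ENNReal.ofReal ((D * ε) ^ 2) := by
  obtain ⟨C, hC⟩ := exists_volume_layer_le hΩb
  refine ⟨NNReal.sqrt (2 * C), fun a δ ε hε => (hC _ measurableSet_transitionZone).trans ?_⟩
  refine (mul_le_mul_right (volume_transitionZone_le (by positivity)) _).trans (le_of_eq ?_)
  rw [← ENNReal.ofReal_coe_nnreal, ← ENNReal.ofReal_mul C.coe_nonneg, mul_pow,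
    ← NNReal.coe_pow, NNReal.sq_sqrt]
  congr 1
  push_cast
  ring

lemma tendsto_volume_layer (hΩb : Bornology.IsBounded Ω) {ι : Type*} {l : Filter ι}
    {T : ι → Set ℝ} (hT : ∀ n, MeasurableSet (T n))
    (h : Tendsto (fun n => volume (T n)) l (𝓝 0)) :
    Tendsto (fun n => volume (Ω ∩ {z | z (Fin.last m) ∈ T n})) l (𝓝 0) := by
  obtain ⟨C, hC⟩ := exists_volume_layer_le hΩb
  have := ENNReal.Tendsto.const_mul (a := (C : ℝ≥0∞)) h (Or.inr ENNReal.coe_ne_top)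
  rw [mul_zero] at this
  exact tendsto_of_tendsto_of_tendsto_of_le_of_le tendsto_const_nhds this (fun _ => zero_le)
    fun n => hC _ (hT n)

lemma tendsto_volume_Ico (hδ : Tendsto δ atTop (𝓝 0)) :
    Tendsto (fun n => volume (Ico a (a + δ n))) atTop (𝓝 0) := by
  simpa [Real.volume_Ico] using ENNReal.tendsto_ofReal hδ

lemma tendsto_eLpNorm_of_layer (hΩb : Bornology.IsBounded Ω) {E : Type*} [NormedAddCommGroup E]
    {F : ℕ → Euc (m + 1) → E} {K : ℝ} (hK : 0 ≤ K) {T : ℕ → Set ℝ}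
    (hT : ∀ n, MeasurableSet (T n)) (h : Tendsto (fun n => volume (T n)) atTop (𝓝 0)) {q : ℝ≥0∞}
    (hq0 : q ≠ 0) (hqt : q ≠ ⊤) (hF : ∀ n, ∀ᵐ z ∂(volume.restrict Ω),
      ‖F n z‖ ≤ {z : Euc (m + 1) | z (Fin.last m) ∈ T n}.indicator (fun _ => K) z) :
    Tendsto (fun n => eLpNorm (F n) q (volume.restrict Ω)) atTop (𝓝 0) := by
  have hq : 0 < 1 / q.toReal := one_div_pos.2 (ENNReal.toReal_pos hq0 hqt)
  have h1 := ENNReal.Tendsto.const_mul (a := ENNReal.ofReal K)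
    ((tendsto_volume_layer hΩb hT h).ennrpow_const (1 / q.toReal)) (Or.inr ENNReal.ofReal_ne_top)
  rw [ENNReal.zero_rpow_of_pos hq, mul_zero] at h1
  exact tendsto_of_tendsto_of_tendsto_of_le_of_le tendsto_const_nhds h1 (fun _ => zero_le)
    fun n => eLpNorm_le_of_layer hK (hT n) hq0 hqt (hF n)

lemma tendsto_volume_symmDiff_threeParts (hΩb : Bornology.IsBounded Ω) (hδ0 : ∀ n, 0 ≤ δ n)
    (hδ : Tendsto δ atTop (𝓝 0)) (j : ℕ) :
    Tendsto (fun n => volume (symmDiff (threeParts Ω a (a + δ n) j) (threeParts Ω a a j)))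
      atTop (𝓝 0) := by
  refine tendsto_of_tendsto_of_tendsto_of_le_of_le tendsto_const_nhds
    (tendsto_volume_layer hΩb (fun n => measurableSet_Ico) (tendsto_volume_Ico (a := a) hδ))
    (fun _ => zero_le) fun n => measure_mono ?_
  -- the symmetric difference lies in the layer
  rintro z (⟨⟨hz, h1⟩, h2⟩ | ⟨⟨hz, h1⟩, h2⟩)
  all_goals
    refine ⟨hz, ?_⟩
    have h2 : z (Fin.last m) ∉ threeHeights _ _ j := fun h => h2 ⟨hz, h⟩
    unfold threeHeights at h1 h2
    change z (Fin.last m) ∈ Ico a (a + δ n)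
    split at h1 <;> simp_all <;> linarith [hδ0 n]

lemma tendsto_eLpNorm_smoothLaminate (hΩ : IsBoundedLipschitzDomain Ω) (hκ : 0 < κ)
    (hεpos : ∀ n, 0 < ε n) (hε : Tendsto ε atTop (𝓝 0)) (hδ0 : ∀ n, 0 ≤ δ n)
    (hδ : Tendsto δ atTop (𝓝 0)) : Tendsto (fun n => eLpNorm (fun x =>
      smoothLaminate κ a (δ n) (ε n) x - (⨍ z in Ω, smoothLaminate κ a (δ n) (ε n) z) -
        centeredId Ω x) 2 (volume.restrict Ω)) atTop (𝓝 0) := by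
  have hpos : volume Ω ≠ 0 := (hΩ.isOpen.measure_pos _ hΩ.isConnected.nonempty).ne'
  have hfin : volume Ω ≠ ⊤ := hΩ.isBounded.measure_lt_top.ne
  set B : ℕ → ℝ := fun n => κ * (δ n + 2 * ε n ^ 2) with hB
  have hB0 : Tendsto B atTop (𝓝 0) := by
    simpa using (hδ.add ((hε.pow 2).const_mul 2)).const_mul κ
  have hbound : ∀ n (z : Euc (m + 1)), ‖smoothLaminate κ a (δ n) (ε n) z - z‖ ≤ B n := fun n z =>
    norm_smoothLaminate_sub_le hκ (hδ0 n) (hεpos n) z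
  have hmean : ∀ n, ‖(⨍ z in Ω, smoothLaminate κ a (δ n) (ε n) z) - ⨍ z in Ω, z‖ ≤ B n := by
    intro n
    have : IsFiniteMeasure (volume.restrict Ω) :=
      ⟨by rw [Measure.restrict_apply_univ]; exact hfin.lt_top⟩
    have hi1 : IntegrableOn (smoothLaminate κ a (δ n) (ε n)) Ω :=
      (memH2_smoothLaminate hΩ.isOpen hΩ.isBounded (hεpos n)).1.1.integrable (by norm_num)
    have hi2 : IntegrableOn (fun x : Euc (m + 1) => x) Ω :=
      memLp_one_iff_integrable.1 (memLp_of_continuous hΩ.isBounded continuous_id 1)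
    rw [setAverage_eq, setAverage_eq, ← smul_sub, ← integral_sub hi1 hi2, norm_smul]
    have h1 := norm_setIntegral_le_of_norm_le_const (μ := volume) (s := Ω) hfin.lt_top
      (fun z _ => hbound n z)
    have h2 : 0 < volume.real Ω := ENNReal.toReal_pos hpos hfin
    rw [norm_inv, Real.norm_of_nonneg h2.le]
    calc _ ≤ (volume.real Ω)⁻¹ * (B n * volume.real Ω) := by gcongr
      _ = B n := by field_simp
  have hF : ∀ n, eLpNorm (fun x => smoothLaminate κ a (δ n) (ε n) x -
      (⨍ z in Ω, smoothLaminate κ a (δ n) (ε n) z) - centeredId Ω x) 2 (volume.restrict Ω) ≤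
      (volume.restrict Ω) univ ^ (2 : ℝ≥0∞).toReal⁻¹ * ENNReal.ofReal (2 * B n) := fun n => by
    refine eLpNorm_le_of_ae_bound (ae_of_all _ fun z => ?_)
    have : smoothLaminate κ a (δ n) (ε n) z - (⨍ z in Ω, smoothLaminate κ a (δ n) (ε n) z) -
        centeredId Ω z = (smoothLaminate κ a (δ n) (ε n) z - z) -
          ((⨍ z in Ω, smoothLaminate κ a (δ n) (ε n) z) - ⨍ z in Ω, z) := by
      rw [centeredId_apply]; abel
    rw [this, two_mul]
    exact (norm_sub_le _ _).trans (add_le_add (hbound n z) (hmean n))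
  refine tendsto_of_tendsto_of_tendsto_of_le_of_le tendsto_const_nhds ?_ (fun _ => zero_le) hF
  have h1 := ENNReal.Tendsto.const_mul
    (a := (volume.restrict Ω) univ ^ (2 : ℝ≥0∞).toReal⁻¹)
    (ENNReal.tendsto_ofReal (hB0.const_mul 2)) (Or.inr ?_)
  · simpa using h1
  · exact (ENNReal.rpow_lt_top_of_nonneg (by positivity)
      (by rwa [Measure.restrict_apply_univ])).ne

/-- The two interfaces of the vanishing layer cancel each other in the limit. -/
lemma tendstoWeakStarBV_phaseMap (hΩ : IsOpen Ω) (hΩb : Bornology.IsBounded Ω) (hκ : 0 < κ)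
    (hδ0 : ∀ n, 0 ≤ δ n) (hδ : Tendsto δ atTop (𝓝 0)) :
    TendstoWeakStarBV Ω (fun n => phaseMap 1 (threeParts Ω a (a + δ n)) (threePhases m κ))
      (weakGrad Ω (centeredId Ω)) := by
  have hab : ∀ n, a ≤ a + δ n := fun n => by linarith [hδ0 n]
  refine ⟨tendsto_eLpNorm_of_layer hΩb hκ.le (fun n => measurableSet_Ico)
    (tendsto_volume_Ico (a := a) hδ) one_ne_zero ENNReal.one_ne_top fun n => ?_,
    fun n => laminateDeriv hΩb κ a (a + δ n), laminateDeriv hΩb κ a a, fun n => ?_,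
    hasMatBVDeriv_centeredId hΩ hΩb κ a, fun i j k φ hφ h0 => ?_⟩
  · filter_upwards [weakGrad_centeredId hΩ, ae_restrict_mem hΩ.measurableSet] with z hz hzΩ
    rw [hz, phaseMap_threeParts (hab n) κ hzΩ, ← stretch_zero, stretch_sub_stretch, norm_frob_vert,
      sub_zero, abs_mul, abs_of_pos hκ]
    simp only [layerInd, indicator, mem_ofPred_eq, Pi.one_apply]
    split_ifs <;> simp
  · refine hasMatBVDeriv_laminate hΩ hΩb κ (hab n) ?_
    filter_upwards [ae_restrict_mem hΩ.measurableSet] with z hz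
    exact phaseMap_threeParts (hab n) κ hz
  · have h1 := tendsto_integral_laminateDeriv hΩ hΩb κ a (b := fun n => a + δ n)
      (by simpa using hδ.const_add a) hφ h0 i j k
    have h2 : ∫ᵛ x, φ x ∂<•(laminateDeriv hΩb κ a a i j k) = 0 := by
      rw [integral_laminateDeriv hΩ hΩb κ a a hφ h0, sub_self, mul_zero, ite_self]
    rwa [h2]

lemma tendstoInMeasure_rescaledDisp (hΩ : IsOpen Ω) (hκ : 0 < κ)
    (hεpos : ∀ n, 0 < ε n) (hε : Tendsto ε atTop (𝓝 0)) (hδ0 : ∀ n, 0 ≤ δ n) :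
    TendstoInMeasure (volume.restrict Ω) (fun n =>
      rescaledDisp (ε n) (smoothLaminate κ a (δ n) (ε n)) 1 (threeParts Ω a (a + δ n))
        (threePhases m κ) (threeShifts m κ a (δ n))) atTop 0 := by
  refine tendstoInMeasure_of_tendsto_eLpNorm_top ?_
  have h1 : Tendsto (fun n => ENNReal.ofReal (2 * κ * ε n)) atTop (𝓝 0) := by
    simpa using ENNReal.tendsto_ofReal (hε.const_mul (2 * κ))
  refine tendsto_of_tendsto_of_tendsto_of_le_of_le tendsto_const_nhds h1 (fun _ => zero_le)
    fun n => ?_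
  simp only [sub_zero, eLpNorm_exponent_top]
  refine eLpNormEssSup_le_of_ae_bound ?_
  filter_upwards [ae_restrict_mem hΩ.measurableSet] with z hz
  exact norm_rescaledDisp_le hκ (hδ0 n) (hεpos n) hz

/-- The smoothed laminates with layers of thickness `δ n → 0`, `δ n / ε n → ∞`, are represented by
the identity, the zero displacement, and the partition of `Ω` into two parts along the hyperplane
at height `a`. -/
theorem isAdmissibleTriple_smoothLaminate (hΩ : IsBoundedLipschitzDomain Ω) (hκ : 0 < κ) (p : ℝ)
    (hεpos : ∀ n, 0 < ε n) (hε : Tendsto ε atTop (𝓝 0)) (hδ0 : ∀ n, 0 ≤ δ n)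
    (hδ : Tendsto δ atTop (𝓝 0)) (hδε : Tendsto (fun n => δ n / ε n) atTop atTop)
    (ha : volume (threeParts Ω a a 1) ≤ volume (threeParts Ω a a 0))
    (h01 : ∀ n, volume (threeParts Ω a (a + δ n) 1) ≤ volume (threeParts Ω a (a + δ n) 0))
    (h12 : ∀ n, volume (threeParts Ω a (a + δ n) 2) ≤ volume (threeParts Ω a (a + δ n) 1)) :
    IsAdmissibleTriple Ω κ p ε (fun n => smoothLaminate κ a (δ n) (ε n)) (centeredId Ω) 0
      (threeParts Ω a a) := by
  have hΩo := hΩ.isOpen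
  have hΩb := hΩ.isBounded
  have hab : ∀ n, a ≤ a + δ n := fun n => by linarith [hδ0 n]
  obtain ⟨D, hD⟩ := exists_volume_transitionZone_le hΩb
  refine ⟨fun _ => 1, fun n => threeParts Ω a (a + δ n), fun _ => threePhases m κ,
    fun n => threeShifts m κ a (δ n), ?_⟩
  refine
    { rotations := fun _ => one_mem _
      partitions := fun n => isCaccioppoliPartition_threeParts hΩ (hab n) (h01 n) (h12 n)
      phases := fun _ j => ?_
      perimeter_bound := ?_
      layers := fun Ω' hΩ' => ⟨0, fun n => ?_⟩
      rigidity := fun Ω' hΩ' => ⟨κ.toNNReal * D, fun n => ?_⟩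
      limit_deformation := ⟨1, one_mem _, memLimitDeformation_centeredId hΩ κ, tendsto_const_nhds⟩
      limit_displacement := memLimitDisplacement_zero Ω
      limit_partition := memLimitPartition_threeParts hΩ ha
      tendsto_sets := tendsto_volume_symmDiff_threeParts hΩb hδ0 hδ
      tendsto_deformation := tendsto_eLpNorm_smoothLaminate hΩ hκ hεpos hε hδ0 hδ
      tendsto_gradient := ?_
      tendsto_phases := tendstoWeakStarBV_phaseMap hΩo hΩb hκ hδ0 hδ
      selection := fun i j hij hi hj _ => ?_
      tendsto_disp := tendstoInMeasure_rescaledDisp hΩo hκ hεpos hε hδ0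
      tendsto_disp_grad := fun Ω' hΩ' => ⟨fun n => ?_, fun ψ hψ => ?_⟩ }
  · unfold threePhases
    split
    · exact Or.inr rfl
    · exact Or.inl rfl
  · obtain ⟨C, hC⟩ := exists_hausdorffMeasure_essBoundary_le hΩ
    exact ⟨C, fun n => hC _ _⟩
  · simp only [layerSet_threeParts (subset_closure.trans hΩ'.2.2), measure_empty, min_zero,
      tsum_zero]
    exact zero_le
  · have hsub : Ω' ⊆ Ω := subset_closure.trans hΩ'.2.2
    refine (eLpNorm_mono_measure _ (Measure.restrict_mono hsub le_rfl)).trans ?_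
    refine (eLpNorm_le_of_layer hκ.le measurableSet_transitionZone two_ne_zero ENNReal.ofNat_ne_top
      (norm_grad_sub_phaseMap_le (a := a) hΩo hκ (hδ0 n) (hεpos n))).trans ?_
    refine (mul_le_mul_right (ENNReal.rpow_le_rpow (hD _ _ _ (hεpos n)) (by positivity)) _).trans ?_
    have hDε : 0 ≤ (D : ℝ) * ε n := mul_nonneg D.coe_nonneg (hεpos n).le
    rw [ofReal_sq_rpow_half hDε, ENNReal.ofReal_mul D.coe_nonneg, ← mul_assoc,
      ENNReal.ofReal_coe_nnreal, ENNReal.coe_mul]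
    exact le_rfl
  · refine tendsto_eLpNorm_of_layer hΩb hκ.le (T := fun n => Icc a (a + δ n + ε n ^ 2))
      (fun n => measurableSet_Icc) ?_ two_ne_zero ENNReal.ofNat_ne_top fun n => ?_
    · simp only [Real.volume_Icc]
      have : Tendsto (fun n => a + δ n + ε n ^ 2 - a) atTop (𝓝 0) := by
        simpa using ((hδ.const_add a).add (hε.pow 2)).sub_const a
      simpa using ENNReal.tendsto_ofReal this
    · filter_upwards [norm_grad_sub_one_le (a := a) hΩo hκ (hδ0 n) (hεpos n),
        weakGrad_centeredId hΩo] with z h1 h2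
      rwa [h2]
  · simp only [norm_threeShifts_sub hκ hij hi hj (hδ0 _), mul_div_assoc]
    exact hδε.const_mul_atTop hκ
  · have hsub : Ω' ⊆ Ω := subset_closure.trans hΩ'.2.2
    have : IsFiniteMeasure (volume.restrict Ω') :=
      ⟨by rw [Measure.restrict_apply_univ]; exact (hΩb.subset hsub).measure_lt_top⟩
    refine MemLp.of_bound ((aestronglyMeasurable_approxGrad_rescaledDisp (κ := κ) (a := a) hΩo
      (hδ0 n) (hεpos n)).mono_measure (Measure.restrict_mono hsub le_rfl)) (κ / ε n) ?_
    filter_upwards [ae_mono (Measure.restrict_mono hsub le_rfl)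
      (norm_approxGrad_rescaledDisp_le (a := a) hΩo hκ (hδ0 n) (hεpos n))] with z hz
    exact hz.trans (indicator_le_self' (fun _ _ => (div_pos hκ (hεpos n)).le) z)
  · have hsub : Ω' ⊆ Ω := subset_closure.trans hΩ'.2.2
    have h0 : ∫ x in Ω',
        inner ℝ (frob (approxGrad (0 : Euc (m + 1) → Euc (m + 1)) x)) (ψ x) = 0 := by
      have : frob (0 : Mat (m + 1)) = 0 := rfl
      simp [approxGrad_zero, this]
    rw [h0]
    exact tendsto_integral_inner_of_layer hψ (fun n => measurableSet_transitionZone) D.coe_nonneg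
      hεpos hε (fun n => (measure_mono (inter_subset_inter_left _ hsub)).trans
        (hD a (δ n) (ε n) (hεpos n)))
      fun n => ae_mono (Measure.restrict_mono hsub le_rfl)
        (norm_approxGrad_rescaledDisp_le hΩo hκ (hδ0 n) (hεpos n))

end Admissible

/-- A thickness which tends to zero more slowly than `ε n`. -/
lemma exists_thickness_sequence {ε : ℕ → ℝ} (hεpos : ∀ n, 0 < ε n) (hε : Tendsto ε atTop (𝓝 0))
    {δ₀ : ℝ} (hδ₀ : 0 < δ₀) : ∃ δ : ℕ → ℝ, (∀ n, 0 ≤ δ n) ∧ (∀ n, δ n ≤ δ₀) ∧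
      Tendsto δ atTop (𝓝 0) ∧ Tendsto (fun n => δ n / ε n) atTop atTop := by
  -- `δ n = √(ε n)`, truncated at `δ₀`
  have hsq : Tendsto (fun n => √(ε n)) atTop (𝓝 0) := by
    simpa [Function.comp_def] using (Real.continuous_sqrt.tendsto 0).comp hε
  have hδ : Tendsto (fun n => min √(ε n) δ₀) atTop (𝓝 0) := by
    simpa [hδ₀.le] using hsq.min (tendsto_const_nhds (x := δ₀))
  refine ⟨fun n => min √(ε n) δ₀, fun n => le_min (Real.sqrt_nonneg _) hδ₀.le,
    fun n => min_le_right _ _, hδ, ?_⟩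
  have h1 : Tendsto (fun n => (√(ε n))⁻¹) atTop atTop :=
    tendsto_inv_nhdsGT_zero.comp (tendsto_nhdsWithin_iff.2
      ⟨hsq, Eventually.of_forall fun n => Real.sqrt_pos.2 (hεpos n)⟩)
  refine h1.congr' ?_
  filter_upwards [hsq.eventually_lt_const hδ₀] with n hn
  rw [min_eq_left hn.le, Real.sqrt_div_self']
  simp

end

theorem proposition3p6 {m : ℕ} (hm : 1 ≤ m) {Ω : Set (Euc (m + 1))}
    (hΩ : IsBoundedLipschitzDomain Ω) (hslices : SlicesConnected Ω)
    {κ : ℝ} (hκ : 0 < κ) {W : Mat (m + 1) → ℝ} (hW : IsTwoWellDensity κ W)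
    {p : ℝ} (hp1 : 1 < p) (hp2 : p < 2)
    {ε : ℕ → ℝ} (hεpos : ∀ n, 0 < ε n) (hε : Tendsto ε atTop (𝓝 0)) :
    (∀ yn : ℕ → Euc (m + 1) → Euc (m + 1), EquiboundedEnergy Ω W ε yn →
      ∀ (y u : Euc (m + 1) → Euc (m + 1)) (P : ℕ → Set (Euc (m + 1))),
        IsAdmissibleTriple Ω κ p ε yn y u P →
          gradJumpSet Ω y ⊆ (⋃ j, frontier (P j)) ∩ Ω) ∧
    (∃ (yn : ℕ → Euc (m + 1) → Euc (m + 1)) (y u : Euc (m + 1) → Euc (m + 1))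
        (P : ℕ → Set (Euc (m + 1))),
      EquiboundedEnergy Ω W ε yn ∧ IsAdmissibleTriple Ω κ p ε yn y u P ∧
        gradJumpSet Ω y ⊂ (⋃ j, frontier (P j)) ∩ Ω ∧
        0 < Measure.hausdorffMeasure (m : ℝ)
          (((⋃ j, essBoundary (P j)) ∩ Ω) \ gradJumpSet Ω y)) := by
  refine ⟨fun yn _ y u P h => gradJumpSet_subset_of_isAdmissibleTriple hΩ.isOpen h, ?_⟩
  obtain ⟨a, ⟨x, hxΩ, hxa⟩, ha, hpos, -⟩ := exists_height hΩ
  obtain ⟨δ₀, hδ₀, hthick⟩ := exists_thickness hΩ.isBounded ha hpos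
  obtain ⟨δ, hδ0, hδle, hδ, hδε⟩ := exists_thickness_sequence hεpos hε hδ₀
  refine ⟨fun n => smoothLaminate κ a (δ n) (ε n), centeredId Ω, 0, threeParts Ω a a,
    ⟨fun n => memH2_smoothLaminate hΩ.isOpen hΩ.isBounded (hεpos n), ?_⟩,
    isAdmissibleTriple_smoothLaminate hΩ hκ p hεpos hε hδ0 hδ hδε ha
      (fun n => (hthick _ (hδ0 n) (hδle n)).1) (fun n => (hthick _ (hδ0 n) (hδle n)).2), ?_, ?_⟩
  · obtain ⟨C₀, hC₀⟩ := exists_energy_layered_profile_le hΩ.isOpen hΩ.isBounded hW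
    exact ⟨C₀, fun n => hC₀ a (δ n) (ε n) (hδ0 n) (hεpos n)⟩
  · rw [gradJumpSet_centeredId hΩ.isOpen, empty_ssubset]
    exact ⟨x, mem_iUnion.2 ⟨0, essBoundary_subset_frontier _
      (mem_essBoundary_threeParts hΩ.isOpen hxΩ hxa)⟩, hxΩ⟩
  · rw [gradJumpSet_centeredId hΩ.isOpen, sdiff_empty]
    exact hausdorffMeasure_essBoundary_threeParts_pos hΩ.isOpen hxΩ hxa
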